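/- Let $\mathcal U,\mathcal B,\mathcal L,\mathcal V$ be pairwise disjoint countably infinite sets (URIs, blank nodes, literals, variables), each numbered by $\mathbb N$, and let $\mathcal T=(\mathcal U\cup\mathcal B)\times\mathcal U\times(\mathcal U\cup\mathcal B\cup\mathcal L)$ be the set of RDF triples. **Queries.** A valuation is a partial map $\mu:\mathcal V\to\mathcal U\cup\mathcal B\cup\mathcal L$; valuations $\mu,\mu'$ are compatible if they agree on $\mathrm{dom}(\mu)\cap\mathrm{dom}(\mu')$. SPARQL expressions are built from triple patterns in $(\mathcal V\cup\mathcal U)\times(\mathcal V\cup\mathcal U)\times(\mathcal V\cup\mathcal U\cup\mathcal L)$ by $(P_1\,\mathsf{AND}\,P_2)$, $(P_1\,\mathsf{UNION}\,P_2)$, $(P_1\,\mathsf{OPT}\,P_2)$ and $(P\,\mathsf{FILTER}\,R)$, where $R$ is a Boolean combination ($\neg,\wedge,\vee$) of conditions $x=c$, $x=y$, $\mathrm{bound}(x)$ with $x,y\in\mathcal V$, $c\in\mathcal U\cup\mathcal L$ (the two equalities are false if a variable in them is unbound). The evaluation $[\![P]\!]_G$ over a possibly infinite $G\subseteq\mathcal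 T$ is the usual set semantics: for a triple pattern $tp$ it is the set of all $\mu$ with $\mathrm{dom}(\mu)=\mathrm{vars}(tp)$ and $\mu[tp]\in G$; $\mathsf{AND}$ is the join $\Omega_1\Join\Omega_2$ (all unions of compatible pairs), $\mathsf{UNION}$ the union, $\mathsf{OPT}$ the set $(\Omega_1\Join\Omega_2)\cup\{\mu\in\Omega_1:\mu\text{ is compatible with no }\mu'\in\Omega_2\}$, and $\mathsf{FILTER}$ the selection of the valuations that satisfy $R$. **Webs.** Fix an infinite set of document symbols. A Web of Linked Data is a triple $W=(D,data,adoc)$ where $D$ is a set of document symbols, $data$ assigns to each $d\in D$ a finite subset of $\mathcal T$ such that the data of distinct documents have no blank node in common, and $adoc:\mathcal U\to D$ is a partial surjective map (so $D$ is finite or countably infinite). Put $\mathrm{AllData}(W)=\bigcup_{d\in D}data(d)$. $W'=(D',data',adoc')$ is an induced subweb of $W$ if $D'\subseteq D$, $data'=data|_{D'}$, and $adoc'$ is the restriction of $adoc$ to $\{u: adoc(u)\in D'\}$. A Linked Data query $q$ maps each Web to a set of valuations; it is satisfiable if $q(W)\ne\emptyset$ for some $W$, and monotonic if $q(W')\subseteq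 q(W)$ whenever $W'$ is an induced subweb of $W$. The SPARQL$_{\mathsf{LD}}$ query (full-Web semantics) that uses $P$ is $q_P(W)=[\![P]\!]_{\mathrm{AllData}(W)}$. **Encodings.** Words are over a finite alphabet of binary digits, marks for the four kinds of names, and punctuation. A name is encoded by the mark of its kind followed by the binary representation of its number; a triple by $\langle \mathrm{enc}(s),\mathrm{enc}(p),\mathrm{enc}(o)\rangle$; a finite set of triples by the list of the codes of its members, in increasing order, between $\langle\!\langle$ and $\rangle\!\rangle$, separated by commas; a document $d$ by $\mathrm{enc}(d)=\mathrm{enc}(data(d))$; a Web by the possibly infinite word $\sharp\,\mathrm{enc}(u_1)\,\mathrm{enc}(adoc(u_1))\,\sharp\,\mathrm{enc}(u_2)\,\mathrm{enc}(adoc(u_2))\,\sharp\cdots$, where $u_1,u_2,\dots$ lists $\mathrm{dom}(adoc)$ in increasing order; a valuation with finite domain $\{v_1<\dots<v_n\}$ by $\langle\!\langle \mathrm{enc}(v_1)\to\mathrm{enc}(\mu(v_1)),\dots,\mathrm{enc}(v_n)\to\mathrm{enc}(\mu(v_n))\rangle\!\rangle$. A possible encoding of a set of valuations is the concatenation of the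 codes of its members, each occurring once, in some (finite or infinite) enumeration. **Machines.** An LD machine is a deterministic Turing machine with finitely many states and finite tape alphabets, with a read-only input tape, a right-infinite Web tape holding $\mathrm{enc}(W)$, a two-way infinite work tape, a right-infinite link traversal tape, and an append-only output tape; the last three are initially empty, and here so is the input tape. It cannot read the Web tape directly. In a special state *expand* the following happens in one step: if the word on the link traversal tape has a suffix $\mathrm{enc}(u)$, $u\in\mathcal U$, and the word on the Web tape contains $\sharp\,\mathrm{enc}(u)\,\mathrm{enc}(adoc(u))\,\sharp$, then $\mathrm{enc}(adoc(u))\,\sharp$ is appended to the word on the link traversal tape; otherwise $\sharp$ is appended; and the computation continues in a fixed state. A query $q$ is finitely computable if some LD machine, for every Web $W$, halts with a possible encoding of $q(W)$ on its output tape. It is eventually computable if there is an LD machine such that for every Web $W$ (1) at each step the word on the output tape is a prefix of a possible encoding of $q(W)$, and (2) for each $\mu\in q(W)$, $\mathrm{enc}(\mu)$ becomes part of the word on the output tape after finitely many steps. **Theorem.** Let $q_P$ be a satisfiable SPARQL$_{\mathsf{LD}}$ query. If $q_P$ is monotonic, then $q_P$ is eventually computable but not finitely computable. If $q_P$ is not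 monotonic, then $q_P$ is not eventually computable. -/

import Mathlib

namespace LinkedData

/-! ## RDF terms, triples, valuations, SPARQL

`U`, `B`, `L`, `V` are the sets of all URIs, blank nodes, literals and variables. Everywhere below
they are arbitrary countably infinite sets, each given with a numbering by the natural numbers
(`Denumerable`), which provides both the total order and the binary representations used in
encodings. -/

/-- An RDF term: an element of the disjoint union of `U`, `B` and `L`. -/
inductive Term (U B L : Type*) where
  | uri (u : U)
  | bnode (b : B)
  | lit (l : L)

/-- An RDF triple: an element of `(U ∪ B) × U × (U ∪ B ∪ L)`. -/
structure Triple (U B L : Type*) where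
  subj : U ⊕ B
  pred : U
  obj : Term U B L

section Sparql

variable {U B L V : Type*}

/-- The subject of a triple, as an RDF term. -/
def Triple.subjTerm (t : Triple U B L) : Term U B L := t.subj.elim Term.uri Term.bnode

/-- The blank nodes among the terms of a triple. -/
def Triple.bnodes (t : Triple U B L) : Set B :=
  {b | t.subjTerm = Term.bnode b ∨ t.obj = Term.bnode b}

/-- A valuation: a partial mapping from variables to RDF terms. -/
abbrev Valuation (U B L V : Type*) := V → Option (Term U B L)

/-- The domain of a valuation. -/
def Valuation.dom (μ : Valuation U B L V) : Set V := {v | μ v ≠ none}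

/-- Two valuations are compatible if they agree wherever both are defined. -/
def Valuation.Compatible (μ₁ μ₂ : Valuation U B L V) : Prop :=
  ∀ v, v ∈ Valuation.dom μ₁ → v ∈ Valuation.dom μ₂ → μ₁ v = μ₂ v

/-- The union of two (compatible) valuations. -/
def Valuation.union (μ₁ μ₂ : Valuation U B L V) : Valuation U B L V :=
  fun v => (μ₁ v).or (μ₂ v)

/-- A triple pattern: an element of `(V ∪ U) × (V ∪ U) × (V ∪ U ∪ L)`. -/
structure TriplePattern (U L V : Type*) where
  subj : V ⊕ U
  pred : V ⊕ U
  obj : V ⊕ (U ⊕ L)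

/-- The variables of a triple pattern. -/
def TriplePattern.vars (tp : TriplePattern U L V) : Set V :=
  {v | tp.subj = Sum.inl v ∨ tp.pred = Sum.inl v ∨ tp.obj = Sum.inl v}

/-- The RDF term that a constant in `U ∪ L` denotes. -/
def constTerm (c : U ⊕ L) : Term U B L := c.elim Term.uri Term.lit

/-- `μ[tp] = t`: replacing the variables of `tp` by their values under `μ` gives the triple `t`. -/
def TriplePattern.Instantiates (tp : TriplePattern U L V) (μ : Valuation U B L V)
    (t : Triple U B L) : Prop :=
  tp.subj.elim μ (fun u => some (Term.uri u)) = some t.subjTerm ∧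
  tp.pred.elim μ (fun u => some (Term.uri u)) = some (Term.uri t.pred) ∧
  tp.obj.elim μ (fun c => some (constTerm c)) = some t.obj

/-- Filter conditions. -/
inductive FilterCond (U L V : Type*) where
  | eqConst (x : V) (c : U ⊕ L)
  | eqVar (x y : V)
  | bound (x : V)
  | neg (R : FilterCond U L V)
  | and (R₁ R₂ : FilterCond U L V)
  | or (R₁ R₂ : FilterCond U L V)

/-- The valuation `μ` satisfies the filter condition. -/
def FilterCond.Sat (μ : Valuation U B L V) : FilterCond U L V → Prop
  | .eqConst x c => μ x = some (constTerm c)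
  | .eqVar x y => x ∈ Valuation.dom μ ∧ y ∈ Valuation.dom μ ∧ μ x = μ y
  | .bound x => x ∈ Valuation.dom μ
  | .neg R => ¬ FilterCond.Sat μ R
  | .and R₁ R₂ => FilterCond.Sat μ R₁ ∧ FilterCond.Sat μ R₂
  | .or R₁ R₂ => FilterCond.Sat μ R₁ ∨ FilterCond.Sat μ R₂

/-- SPARQL expressions. -/
inductive SparqlExpr (U L V : Type*) where
  | pattern (tp : TriplePattern U L V)
  | and (P₁ P₂ : SparqlExpr U L V)
  | union (P₁ P₂ : SparqlExpr U L V)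
  | opt (P₁ P₂ : SparqlExpr U L V)
  | filter (P : SparqlExpr U L V) (R : FilterCond U L V)

/-- The join of two sets of valuations. -/
def join (Ω₁ Ω₂ : Set (Valuation U B L V)) : Set (Valuation U B L V) :=
  {μ | ∃ μ₁ ∈ Ω₁, ∃ μ₂ ∈ Ω₂, Valuation.Compatible μ₁ μ₂ ∧ μ = Valuation.union μ₁ μ₂}

/-- The difference of two sets of valuations: the members of the first set that are compatible
with no member of the second. -/
def diff (Ω₁ Ω₂ : Set (Valuation U B L V)) : Set (Valuation U B L V) :=
  {μ | μ ∈ Ω₁ ∧ ∀ μ₂ ∈ Ω₂, ¬ Valuation.Compatible μ μ₂}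

/-- The evaluation of a SPARQL expression over a (possibly infinite) set of RDF triples. -/
def SparqlExpr.eval (G : Set (Triple U B L)) : SparqlExpr U L V → Set (Valuation U B L V)
  | .pattern tp => {μ | Valuation.dom μ = tp.vars ∧ ∃ t ∈ G, tp.Instantiates μ t}
  | .and P₁ P₂ => join (SparqlExpr.eval G P₁) (SparqlExpr.eval G P₂)
  | .union P₁ P₂ => SparqlExpr.eval G P₁ ∪ SparqlExpr.eval G P₂
  | .opt P₁ P₂ => join (SparqlExpr.eval G P₁) (SparqlExpr.eval G P₂) ∪
      diff (SparqlExpr.eval G P₁) (SparqlExpr.eval G P₂)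
  | .filter P R => {μ | μ ∈ SparqlExpr.eval G P ∧ R.Sat μ}

end Sparql

/-! ## Webs of Linked Data and queries over them -/

/-- A Web of Linked Data `(D, data, adoc)` whose documents are drawn from the set of symbols `Doc`.
The values of `data` outside `docs` play no role. Since `U` is countable and `adoc` is onto `docs`,
the set `docs` is finite or countably infinite. -/
structure Web (U B L Doc : Type*) where
  docs : Set Doc
  data : Doc → Finset (Triple U B L)
  bnodes_disjoint : ∀ d₁ ∈ docs, ∀ d₂ ∈ docs, d₁ ≠ d₂ →
    Disjoint (⋃ t ∈ data d₁, t.bnodes) (⋃ t ∈ data d₂, t.bnodes)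
  adoc : U → Option Doc
  adoc_mem : ∀ u d, adoc u = some d → d ∈ docs
  adoc_surj : ∀ d ∈ docs, ∃ u, adoc u = some d

section Queries

variable {U B L V Doc : Type*}

/-- The set of all RDF triples in a Web. -/
def Web.allData (W : Web U B L Doc) : Set (Triple U B L) := {t | ∃ d ∈ W.docs, t ∈ W.data d}

/-- `W'` is an induced subweb of `W`: its documents are documents of `W`, with the same data, and
its partial mapping `adoc` is that of `W` restricted to the URIs mapped to documents of `W'`. -/
def Web.IsInducedSubweb (W' W : Web U B L Doc) : Prop :=
  W'.docs ⊆ W.docs ∧ (∀ d ∈ W'.docs, W'.data d = W.data d) ∧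
  ∀ u d, W'.adoc u = some d ↔ W.adoc u = some d ∧ d ∈ W'.docs

/-- A Linked Data query: a total function from Webs of Linked Data to sets of valuations. -/
abbrev LDQuery (U B L V Doc : Type*) := Web U B L Doc → Set (Valuation U B L V)

/-- The query has a nonempty result over some Web. -/
def LDQuery.Satisfiable (q : LDQuery U B L V Doc) : Prop := ∃ W, (q W).Nonempty

/-- The query result over an induced subweb is contained in the result over the Web. -/
def LDQuery.Monotonic (q : LDQuery U B L V Doc) : Prop :=
  ∀ W₁ W₂ : Web U B L Doc, W₁.IsInducedSubweb W₂ → q W₁ ⊆ q W₂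

/-- The SPARQL query under full-Web semantics that uses the expression `P`. -/
def sparqlLD (B Doc : Type*) (P : SparqlExpr U L V) : LDQuery U B L V Doc :=
  fun W => P.eval W.allData

end Queries

/-! ## Encodings -/

/-- The symbols used in encodings: the binary digits, one mark for each kind of name (so that the
encodings of URIs, blank nodes, literals and variables are distinct, and no encoding of a URI is a
proper suffix of another one), and the punctuation `♯ ⟨ ⟩ ⟪ ⟫ , →`. -/
inductive Sym where
  | zero | one
  | uriMark | bnodeMark | litMark | varMark
  | sharp | langle | rangle | llangle | rrangle | comma | arrow
  deriving DecidableEq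

/-- A finite or infinite word; the infinite tape holding it is blank (`none`) after its end. -/
abbrev InfWord := ℕ → Option Sym

open Classical in
/-- The concatenation `s 0 ++ s 1 ++ s 2 ++ ⋯` of a sequence of finite words. -/
noncomputable def concatWord (s : ℕ → List Sym) : InfWord := fun k =>
  if h : ∃ n, k < ((List.range n).flatMap s).length then
    ((List.range (Nat.find h)).flatMap s)[k]?
  else none

/-- The finite word `w` is a prefix of the word `x`. -/
def IsPrefixOf (w : List Sym) (x : InfWord) : Prop := ∀ i, ∀ h : i < w.length, x i = some w[i]

/-- The finite word `w` occurs in the word `x` as a contiguous block. -/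
def OccursIn (w : List Sym) (x : InfWord) : Prop :=
  ∃ k, ∀ i, ∀ h : i < w.length, x (k + i) = some w[i]

/-- The binary representation of a natural number. -/
def binary (n : ℕ) : List Sym := n.bits.map fun b => if b then Sym.one else Sym.zero

/-- Concatenation of a list of words, separated by commas. -/
def commaSep (l : List (List Sym)) : List Sym := List.intercalate [Sym.comma] l

section Encodings

variable {U B L V Doc : Type*} [Denumerable U] [Denumerable B] [Denumerable L] [Denumerable V]

/-- The encoding of a URI. -/
def encUri (u : U) : List Sym := Sym.uriMark :: binary (Encodable.encode u)

/-- The encoding of a variable. -/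
def encVar (v : V) : List Sym := Sym.varMark :: binary (Encodable.encode v)

/-- The encoding of an RDF term. -/
def encTerm : Term U B L → List Sym
  | .uri u => encUri u
  | .bnode b => Sym.bnodeMark :: binary (Encodable.encode b)
  | .lit l => Sym.litMark :: binary (Encodable.encode l)

/-- The encoding of an RDF triple. -/
def encTriple (t : Triple U B L) : List Sym :=
  [Sym.langle] ++ encTerm t.subjTerm ++ [Sym.comma] ++ encUri t.pred ++ [Sym.comma] ++
    encTerm t.obj ++ [Sym.rangle]

/-- The position of an RDF term in the total order of terms: first the URIs, then the blank nodes,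
then the literals, each in the order of their numbering. -/
def Term.key : Term U B L → ℕ ×ₗ ℕ
  | .uri u => toLex (0, Encodable.encode u)
  | .bnode b => toLex (1, Encodable.encode b)
  | .lit l => toLex (2, Encodable.encode l)

theorem Term.key_injective : Function.Injective (Term.key : Term U B L → ℕ ×ₗ ℕ) := by
  rintro (a | a | a) (b | b | b) h <;> simp_all [Term.key]

/-- The position of an RDF triple in the lexicographic order of triples. -/
def Triple.key (t : Triple U B L) : (ℕ ×ₗ ℕ) ×ₗ ((ℕ ×ₗ ℕ) ×ₗ (ℕ ×ₗ ℕ)) :=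
  toLex (t.subjTerm.key, toLex ((Term.uri t.pred : Term U B L).key, t.obj.key))

theorem Triple.key_injective :
    Function.Injective (Triple.key : Triple U B L → (ℕ ×ₗ ℕ) ×ₗ ((ℕ ×ₗ ℕ) ×ₗ (ℕ ×ₗ ℕ))) := by
  rintro ⟨s, p, o⟩ ⟨s', p', o'⟩ h
  simp only [Triple.key, EmbeddingLike.apply_eq_iff_eq, Prod.mk.injEq] at h
  obtain ⟨h1, h2, h3⟩ := h
  have h1 := Term.key_injective h1
  have h2 := Term.key_injective h2
  have h3 := Term.key_injective h3
  simp only [Term.uri.injEq] at h2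
  rcases s with s | s <;> rcases s' with s' | s' <;> simp_all [Triple.subjTerm]

/-- The total order of RDF triples. -/
instance Triple.linearOrder : LinearOrder (Triple U B L) :=
  LinearOrder.lift' Triple.key Triple.key_injective

/-- The encoding of a finite set of RDF triples; its members are listed in increasing order. -/
def encTriples (T : Finset (Triple U B L)) : List Sym :=
  [Sym.llangle] ++ commaSep ((T.sort (· ≤ ·)).map encTriple) ++ [Sym.rrangle]

/-- The encoding of a Web: the word `♯ enc(u₁) enc(adoc(u₁)) ♯ enc(u₂) enc(adoc(u₂)) ♯ ⋯`, where
`u₁, u₂, …` lists the URIs in the domain of `adoc` in increasing order. -/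
noncomputable def Web.enc (W : Web U B L Doc) : InfWord :=
  concatWord fun
    | 0 => [Sym.sharp]
    | n + 1 =>
      let u := Denumerable.ofNat U n
      match W.adoc u with
      | none => []
      | some d => encUri u ++ encTriples (W.data d) ++ [Sym.sharp]

open Classical in
/-- The encoding of a valuation with finite domain; its variables are listed in increasing order.
(Valuations with infinite domain have no encoding; the value `[]` is never used for them.) -/
noncomputable def encValuation (μ : Valuation U B L V) : List Sym :=
  if h : (Valuation.dom μ).Finite then
    [Sym.llangle] ++
      commaSep (((h.toFinset.image Encodable.encode).sort (· ≤ ·)).map fun n =>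
        let v := Denumerable.ofNat V n
        encVar v ++ [Sym.arrow] ++ (μ v).elim [] encTerm) ++
      [Sym.rrangle]
  else []

/-- `x` is a possible encoding of the (finite or infinite) set `Ω` of valuations: the concatenation
of the encodings of its members, in some order, each occurring once. Indices `n` with `e n = none`
contribute nothing. -/
def IsEncodingOf (x : InfWord) (Ω : Set (Valuation U B L V)) : Prop :=
  (∀ μ ∈ Ω, (Valuation.dom μ).Finite) ∧
  ∃ e : ℕ → Option (Valuation U B L V),
    (∀ μ, μ ∈ Ω ↔ ∃ n, e n = some μ) ∧
    (∀ m n μ, e m = some μ → e n = some μ → m = n) ∧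
    x = concatWord fun n => (e n).elim [] encValuation

end Encodings

/-! ## Linked Data machines -/

/-- A right-infinite tape: `cells` are the cells up to the rightmost one visited by a write, all
further cells are blank (`none`); `head` is the position of the head. -/
structure RightTape (α : Type) where
  cells : List (Option α)
  head : ℕ

namespace RightTape

variable {α : Type}

/-- The scanned symbol. -/
def read (T : RightTape α) : Option α := (T.cells[T.head]?).join

/-- Write a symbol into the scanned cell. -/
def write (T : RightTape α) (a : Option α) : RightTape α :=
  { T with
    cells := if T.head < T.cells.length then T.cells.set T.head a
      else T.cells ++ List.replicate (T.head - T.cells.length) none ++ [a] }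

/-- Move the head by one cell; a head on the leftmost cell cannot move further to the left. -/
def move (T : RightTape α) : Turing.Dir → RightTape α
  | Turing.Dir.left => { T with head := T.head - 1 }
  | Turing.Dir.right => { T with head := T.head + 1 }

/-- The word on the tape: its contents up to the last nonblank cell. -/
def word (T : RightTape α) : List (Option α) := T.cells.rdropWhile Option.isNone

/-- Append a word directly after the word on the tape; the head keeps its position. -/
def append (T : RightTape α) (w : List α) : RightTape α :=
  { T with cells := T.word ++ w.map some }

end RightTape

/-- What an ordinary step does: it enters a state, writes a symbol to each of the two work tapes,
moves heads (`none` means that the head stays), and appends at most one symbol to the output. -/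
structure LDAction (State Work Link : Type) where
  next : State
  inputMove : Option Turing.Dir
  workWrite : Work
  workMove : Option Turing.Dir
  linkWrite : Option Link
  linkMove : Option Turing.Dir
  output : Option Sym

/-- A Linked Data machine. `Work` is the alphabet of the ordinary work tape (with blank `default`).
The alphabet of the link traversal tape consists of the blank `none`, the encoding symbols, and
finitely many additional symbols `Aux`. When `δ` is undefined (`none`), the machine halts; `resume`
is the state in which the computation continues after the expand procedure. -/
structure LDMachine where
  State : Type
  Work : Type
  Aux : Type
  [finState : Finite State]
  [finWork : Finite Work]
  [finAux : Finite Aux]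
  [inhWork : Inhabited Work]
  start : State
  expand : State
  resume : State
  δ : State → (input : Option Sym) → (work : Work) → (link : Option (Sym ⊕ Aux)) →
    Option (LDAction State Work (Sym ⊕ Aux))

attribute [instance] LDMachine.inhWork

namespace LDMachine

/-- A configuration, without the Web tape (which never changes): the state, the read-only input
tape, the two-way infinite work tape, the link traversal tape, and the word on the output tape. -/
structure Cfg (M : LDMachine) where
  state : M.State
  input : Turing.Tape (Option Sym)
  work : Turing.Tape M.Work
  link : RightTape (Sym ⊕ M.Aux)
  output : List Sym

/-- The initial configuration with the word `w` on the ordinary input tape. -/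
def init (M : LDMachine) (w : List Sym) : M.Cfg where
  state := M.start
  input := Turing.Tape.mk₁ (w.map some)
  work := default
  link := ⟨[], 0⟩
  output := []

/-- The effect of an ordinary step. -/
def act {M : LDMachine} (c : M.Cfg) (a : LDAction M.State M.Work (Sym ⊕ M.Aux)) : M.Cfg where
  state := a.next
  input := a.inputMove.elim c.input (fun d => c.input.move d)
  work := a.workMove.elim (c.work.write a.workWrite) (fun d => (c.work.write a.workWrite).move d)
  link := a.linkMove.elim (c.link.write a.linkWrite) (fun d => (c.link.write a.linkWrite).move d)
  output := c.output ++ a.output.toList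

section Run

variable (U B L : Type*) [Denumerable U] [Denumerable B] [Denumerable L]

/-- The lookup of the expand procedure succeeds with document content `T`: the word `w` on the link
traversal tape has the encoding of some URI `u` as a suffix, and the word `web` on the Web tape
contains `♯ enc(u) enc(T) ♯`. -/
def LookupFinds {A : Type} (web : InfWord) (w : List (Option (Sym ⊕ A)))
    (T : Finset (Triple U B L)) : Prop :=
  ∃ u : U, (encUri u).map (fun s => some (Sum.inl s)) <:+ w ∧
    OccursIn ([Sym.sharp] ++ encUri u ++ encTriples T ++ [Sym.sharp]) web

open Classical in
/-- The word that the expand procedure appends to the word `w` on the link traversal tape: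
the encoding of the document found, followed by `♯`, or only `♯` if the lookup fails. -/
noncomputable def expandAnswer {A : Type} (web : InfWord) (w : List (Option (Sym ⊕ A))) :
    List Sym :=
  if h : ∃ T : Finset (Triple U B L), LookupFinds U B L web w T then
    encTriples h.choose ++ [Sym.sharp]
  else [Sym.sharp]

open Classical in
/-- One computation step with the word `web` on the Web tape. -/
noncomputable def step (M : LDMachine) (web : InfWord) (c : M.Cfg) : Option M.Cfg :=
  if c.state = M.expand then
    some { c with
      state := M.resume
      link := c.link.append ((expandAnswer U B L web c.link.word).map Sum.inl) }
  else
    (M.δ c.state c.input.head c.work.head c.link.read).map (act c)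

end Run

end LDMachine

section Computability

variable {U B L V Doc : Type*} [Denumerable U] [Denumerable B] [Denumerable L] [Denumerable V]

/-- Some LD machine halts on every Web, with a possible encoding of the query result as output. -/
def FinitelyComputable (q : LDQuery U B L V Doc) : Prop :=
  ∃ M : LDMachine, ∀ W : Web U B L Doc,
    ∃ c ∈ StateTransition.eval (M.step U B L W.enc) (M.init []),
      IsEncodingOf (fun i => c.output[i]?) (q W)

/-- There is an LD machine such that, on every Web, the output at each step of the computation is a
prefix of a possible encoding of the query result, and the encoding of every member of the query
result becomes part of the output after finitely many steps. -/
def EventuallyComputable (q : LDQuery U B L V Doc) : Prop :=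
  ∃ M : LDMachine, ∀ W : Web U B L Doc,
    (∀ c, StateTransition.Reaches (M.step U B L W.enc) (M.init []) c →
      ∃ x, IsEncodingOf x (q W) ∧ IsPrefixOf c.output x) ∧
    ∀ μ ∈ q W, ∃ c, StateTransition.Reaches (M.step U B L W.enc) (M.init []) c ∧
      encValuation μ <:+: c.output

end Computability

end LinkedData

/-!
A Linked Data machine sees the Web only through lookups of URIs, and within finitely many steps it
has looked up finitely many of them (`exists_bound_of_reaches`). The two negative claims follow by
relocating documents to URIs that have not been looked up. A machine that halts on the empty Web
cannot tell it from a Web with a solution all of whose documents are located at URIs with large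
numbers (`not_finitelyComputable_sparqlLD`). If passing from an induced subweb to a larger Web
destroys a solution, then a machine that reports the solution on the subweb also reports it on the
larger Web, provided that the additional documents are located at URIs with large numbers
(`not_eventuallyComputable_sparqlLD`).

A monotonic query is computed by exploration: in round `n`, the machine evaluates the query over
the triples found so far, outputs the new solutions, looks up the `n`-th candidate for the encoding
of a URI, and adds the triples in the answer. By monotonicity everything that is output is a
solution over the whole Web, because the documents found so far form an induced subweb.

That every solution is output at some time is a compactness phenomenon
(`SparqlExpr.exists_mem_eval_of_monotonic`), and the solution need not depend on only finitely many
triples for a syntactic reason, as the operator `OPT` involves a negation. Suppose that `μ` is a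
solution over the union of a chain of sets of triples, but over no member. For each finite set of
variables there is a first-order formula that defines the solutions with this domain
(`exists_expresses`). A countable elementary substructure of an ultraproduct of the members then
contains the union of the chain, and `μ` is no solution in it. Since the result of a query is
invariant under injective renaming of all terms other than the constants of the query
(`SparqlExpr.evalIn_map`), both the union and the larger structure can be renamed to sets of
triples without blank nodes. Any two such sets, one contained in the other, are the data of a Web
and of an induced subweb (`eval_subset_of_monotonic`), which contradicts monotonicity.

It remains to carry out the exploration on a machine. The evaluation of an expression over a finite
list of encoded triples is primitive recursive (`exists_evaluator`). Mathlib compiles codes for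
computable functions to Post–Turing machines, and from these parts machines for flowchart programs
are assembled, whose nodes compute on the work tape and whose edges act on the other tapes
(`Program.exists_machine`). Documents are parsed by a shift register that holds the last three
names (`foldl_parseSym_encTriples`).
-/

namespace LinkedData

/-! ### Turing machines for computable functions -/

section

open Turing

/-- The work tape alphabet: a marker for the leftmost cell in use, and one track for each of the
four stacks of Mathlib's machine for partial recursive functions. -/
abbrev StackSym : Type := TM2to1.Γ' PartrecToTM2.K' (fun _ => PartrecToTM2.Γ')

instance PartrecToTM2.K'.instFinite : Finite PartrecToTM2.K' :=
  Finite.of_surjective (fun i : Fin 4 => match i with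
    | 0 => PartrecToTM2.K'.main | 1 => PartrecToTM2.K'.rev
    | 2 => PartrecToTM2.K'.aux | 3 => PartrecToTM2.K'.stack)
    (by rintro (_ | _ | _ | _); exacts [⟨0, rfl⟩, ⟨1, rfl⟩, ⟨2, rfl⟩, ⟨3, rfl⟩])

instance StackSym.instFinite : Finite StackSym :=
  inferInstanceAs (Finite (Bool × (PartrecToTM2.K' → Option PartrecToTM2.Γ')))

/-- The tape `T` holds the list `v` of numbers on the track of the main stack, the other tracks
are empty, and the head is on the marked cell. -/
def HoldsList (v : List ℕ) (T : Tape StackSym) : Prop :=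
  ∃ L : ListBlank (∀ _ : PartrecToTM2.K', Option PartrecToTM2.Γ'),
    (∀ k, L.map (Turing.proj k) =
      ListBlank.mk ((PartrecToTM2.K'.elim (PartrecToTM2.trList v) [] [] [] k).map some).reverse) ∧
    T = Tape.mk' ∅ (TM2to1.addBottom L)

/-- One step of a Post–Turing machine without distinguished initial state. -/
def postStep {Q Γ : Type} [Inhabited Γ] (m : Q → Γ → Option (Q × TM0.Stmt Γ)) (c : Q × Tape Γ) :
    Option (Q × Tape Γ) :=
  (m c.1 c.2.head).map fun p => (p.1, match p.2 with
    | TM0.Stmt.move d => c.2.move d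
    | TM0.Stmt.write a => c.2.write a)

/-- A finite Post–Turing machine that transforms the tape as the code `c` transforms lists. -/
theorem exists_postMachine_of_code (c : ToPartrec.Code) :
    ∃ (Q : Type) (_ : Finite Q) (q₀ : Q) (m : Q → StackSym → Option (Q × TM0.Stmt StackSym)),
      ∀ v w T, w ∈ c.eval v → HoldsList v T → ∃ q T', HoldsList w T' ∧ (∀ a, m q a = none) ∧
        StateTransition.Reaches (postStep m) (q₀, T) (q, T') := by
  let i₁ : Inhabited PartrecToTM2.Λ' := ⟨PartrecToTM2.trNormal c PartrecToTM2.Cont'.halt⟩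
  let i₂ : Inhabited (Option PartrecToTM2.Γ') := ⟨none⟩
  have s₂ := PartrecToTM2.tr_supports c PartrecToTM2.Cont'.halt
  have s₁ := TM2to1.tr_supports PartrecToTM2.tr s₂
  have s₀ := TM1to0.tr_supports (TM2to1.tr PartrecToTM2.tr) s₁
  set M₀ := TM1to0.tr (TM2to1.tr PartrecToTM2.tr) with hM₀
  set S := TM1to0.trStmts (TM2to1.tr PartrecToTM2.tr)
    (TM2to1.trSupp PartrecToTM2.tr
      (PartrecToTM2.codeSupp c PartrecToTM2.Cont'.halt)) with hS
  have hstep : ∀ q a p, M₀ q a = some p → q ∈ S → p.1 ∈ S := fun q a p h => s₀.2 h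
  refine ⟨S, inferInstance, ⟨default, s₀.1⟩, fun q a =>
    (M₀ q a).pmap (fun p h => (⟨p.1, h⟩, p.2)) (fun p h => hstep q a p h q.2), ?_⟩
  rintro v w T hw ⟨L, hL, rfl⟩
  -- chain the three simulations
  have h₂ : PartrecToTM2.halt w ∈ StateTransition.eval (TM2.step PartrecToTM2.tr)
      (PartrecToTM2.init c v) := by
    rw [PartrecToTM2.tr_eval]
    exact Part.mem_map _ hw
  obtain ⟨c₁, ht₁, h₁⟩ := StateTransition.tr_eval (TM2to1.tr_respects PartrecToTM2.tr)
    (TM2to1.TrCfg.mk (q := some (PartrecToTM2.trNormal c PartrecToTM2.Cont'.halt)) (v := none)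
      (S := PartrecToTM2.K'.elim (PartrecToTM2.trList v) [] [] []) L hL) h₂
  obtain ⟨c₀, ht₀, h₀⟩ := StateTransition.tr_eval
    (TM1to0.tr_respects (TM2to1.tr PartrecToTM2.tr)) rfl h₁
  obtain ⟨r₀, e₀⟩ := StateTransition.mem_eval.1 h₀
  cases ht₁ with
  | mk L' hL' =>
  subst ht₀
  have key : ∀ c' : TM0.Cfg StackSym _, StateTransition.Reaches (TM0.step M₀)
      ⟨default, Tape.mk' ∅ (TM2to1.addBottom L)⟩ c' →
      ∃ h : c'.q ∈ S, StateTransition.Reaches (postStep fun (q : S) a =>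
        (M₀ q a).pmap (fun p h => ((⟨p.1, h⟩ : S), p.2)) (fun p h => hstep q a p h q.2))
        (⟨default, s₀.1⟩, Tape.mk' ∅ (TM2to1.addBottom L)) (⟨c'.q, h⟩, c'.Tape) := by
    intro c' hc'
    induction hc' with
    | refl => exact ⟨s₀.1, .refl⟩
    | @tail b d _ hd ih =>
      obtain ⟨hb, ih⟩ := ih
      obtain ⟨qb, Tb⟩ := b
      obtain ⟨p, hp, rfl⟩ := Option.map_eq_some_iff.1 hd
      refine ⟨hstep _ _ _ hp hb, ih.tail ?_⟩
      simp only [postStep, Option.mem_def, Option.map_eq_some_iff, Option.pmap_eq_some_iff]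
      exact ⟨_, ⟨_, hstep _ _ _ hp hb, hp, rfl⟩, rfl⟩
  obtain ⟨hq, hr⟩ := key _ r₀
  exact ⟨_, _, ⟨L', hL', rfl⟩, fun a => rfl, hr⟩

/-- The blank tape becomes an encoding of the empty list when its scanned cell is marked. -/
theorem HoldsList.nil_of_blank :
    HoldsList [] ((default : Tape StackSym).write (true, fun _ => none)) := by
  refine ⟨ListBlank.mk [], fun k => ?_, ?_⟩
  · cases k <;> rfl
  · rfl

/-- A zero or a one at the end of the list can be read off the second cell of the tape. -/
theorem HoldsList.head_move_right {a : ℕ} {b : Bool} {T : Tape StackSym}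
    (h : HoldsList [a, b.toNat] T) :
    (T.move Dir.right).head.2 PartrecToTM2.K'.main = some PartrecToTM2.Γ'.bit1 ↔ b = true := by
  obtain ⟨L, hL, rfl⟩ := h
  have hS := TM2to1.stk_nth_val (k := PartrecToTM2.K'.main)
    (S := PartrecToTM2.trList [a, b.toNat]) 1
    ((hL PartrecToTM2.K'.main).trans (by rw [PartrecToTM2.K'.elim_main]))
  rw [Tape.move_right_mk', Tape.mk'_head, ← ListBlank.nth_zero, ← ListBlank.nth_succ,
    TM2to1.addBottom_nth_snd, hS]
  have h₁ : PartrecToTM2.trPosNum 1 = [PartrecToTM2.Γ'.bit1] := rfl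
  cases b <;> simp [PartrecToTM2.trList, PartrecToTM2.trNat, PartrecToTM2.trNum, h₁]

/-- Codes for a computable function together with a computable predicate; the list to which the
code is applied may carry any further entries. -/
theorem exists_code_of_computable {α : Type} [Primcodable α] {f : α → α} {b : α → Bool}
    (hf : Computable f) (hb : Computable b) :
    ∃ c : ToPartrec.Code, ∀ (v : List ℕ) (x : α), v.headI = Encodable.encode x →
      [Encodable.encode (f x), (b x).toNat] ∈ c.eval v := by
  have hb' : Computable fun x => (b x).toNat := (Primrec.dom_bool Bool.toNat).to_comp.comp hb
  have conv : ∀ {β : Type} [Primcodable β] {g : α → β}, Computable g →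
      ∃ c : ToPartrec.Code, ∀ (v : List ℕ) (x : α), v.headI = Encodable.encode x →
        [Encodable.encode (g x)] ∈ c.eval v := by
    intro β _ g hg
    have hp : Nat.Partrec' fun v : List.Vector ℕ 1 =>
        (Part.ofOption (Encodable.decode (α := α) v.head)).bind
          fun a => Part.map Encodable.encode (Part.some (g a)) :=
      Nat.Partrec'.of_part (f := fun v : List.Vector ℕ 1 => _)
        ((show Partrec _ from Partrec.nat_iff.2 hg).comp
          (Primrec.vector_head.to_comp))
    obtain ⟨c, hc⟩ := ToPartrec.Code.exists_code hp
    refine ⟨c.comp ToPartrec.Code.head, fun v x hv => ?_⟩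
    have := hc ⟨[v.headI], rfl⟩
    have h₁ : (c.comp ToPartrec.Code.head).eval v = c.eval [v.headI] := by
      rw [ToPartrec.Code.comp_eval]
      exact (congrArg (· >>= c.eval) (ToPartrec.Code.head_eval v)).trans (Part.bind_some _ _)
    rw [h₁]
    refine this ▸ ?_
    simp [List.Vector.head, hv]
  obtain ⟨c₁, h₁⟩ := conv hf
  obtain ⟨c₂, h₂⟩ := conv hb'
  refine ⟨c₁.cons c₂, fun v x hv => ?_⟩
  rw [ToPartrec.Code.cons_eval]
  exact Part.mem_bind (h₁ v x hv) (Part.mem_bind (h₂ v x hv) (Part.mem_some _))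

end

/-! ### Programs for Linked Data machines -/

section

open Turing

/-- What a program does after it has transformed its state at a node: go to another node, possibly
after it has appended a symbol to the output, has put a symbol onto the link traversal tape, or has
got the scanned symbol of the link traversal tape; or call the expand procedure. -/
inductive Command (N : Type) where
  | goto (n : N)
  | print (s : Sym) (n : N)
  | put (s : Sym) (n : N)
  | get (f : Option Sym → N)
  | expand

/-- A flowchart program: at each node the state in `α` is transformed by a computable function, a
computable test is made on the old state, and the outcome of the test selects a command. After a
call of the expand procedure, the program continues at the node `resume`. Programs abstract from
the work tape of a Linked Data machine. -/
structure Program (α : Type) [Primcodable α] where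
  Node : Type
  [finNode : Finite Node]
  start : Node
  resume : Node
  upd : Node → α → α
  test : Node → α → Bool
  computable_upd : ∀ n, Computable (upd n)
  computable_test : ∀ n, Computable (test n)
  cmd : Node → Bool → Command Node

/-- A configuration of a program: node, state, word on the link traversal tape, position of the
head of that tape, and output. -/
structure Program.Cfg {α : Type} [Primcodable α] (p : Program α) where
  node : p.Node
  state : α
  link : List Sym
  head : ℕ
  output : List Sym

section

variable (U B L : Type*) [Denumerable U] [Denumerable B] [Denumerable L]

/-- One step of a program. Symbols are put only at the end of the word on the link traversal tape,
and got only from within that word. -/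
inductive Program.Step {α : Type} [Primcodable α] (p : Program α) (web : InfWord) :
    p.Cfg → p.Cfg → Prop
  | goto {n x w h o m} (e : p.cmd n (p.test n x) = .goto m) :
      Step p web ⟨n, x, w, h, o⟩ ⟨m, p.upd n x, w, h, o⟩
  | print {n x w h o s m} (e : p.cmd n (p.test n x) = .print s m) :
      Step p web ⟨n, x, w, h, o⟩ ⟨m, p.upd n x, w, h, o ++ [s]⟩
  | put {n x w h o s m} (e : p.cmd n (p.test n x) = .put s m) (hh : h = w.length) :
      Step p web ⟨n, x, w, h, o⟩ ⟨m, p.upd n x, w ++ [s], h + 1, o⟩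
  | get {n x w h o f} (e : p.cmd n (p.test n x) = .get f) (hh : h < w.length) :
      Step p web ⟨n, x, w, h, o⟩ ⟨f w[h], p.upd n x, w, h + 1, o⟩
  | expand {n x w h o} (e : p.cmd n (p.test n x) = .expand) :
      Step p web ⟨n, x, w, h, o⟩
        ⟨p.resume, p.upd n x, w ++ LDMachine.expandAnswer U B L (A := Empty) web
          (w.map fun s => some (Sum.inl s)), h, o⟩

end

/-- The link traversal tape `T` holds the word `w`, possibly followed by written blanks, and its
head is at position `h`. -/
def HoldsWord (w : List Sym) (h : ℕ) (T : RightTape (Sym ⊕ Empty)) : Prop :=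
  T.head = h ∧ ∃ j, T.cells = w.map (fun s => some (Sum.inl s)) ++ List.replicate j none

namespace HoldsWord

variable {w : List Sym} {h : ℕ} {T : RightTape (Sym ⊕ Empty)}

theorem word_eq (H : HoldsWord w h T) : T.word = w.map fun s => some (Sum.inl s) := by
  obtain ⟨-, j, hj⟩ := H
  rw [RightTape.word, hj]
  have h₁ : ∀ l : List (Option (Sym ⊕ Empty)), (∀ a ∈ l.getLast?, a.isSome) →
      (l ++ List.replicate j none).rdropWhile Option.isNone = l := by
    intro l hl
    clear hj
    induction j with
    | zero =>
      simp only [List.replicate_zero, List.append_nil]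
      rw [List.rdropWhile_eq_self_iff]
      intro hne
      have := hl _ (List.getLast_mem_getLast? hne)
      simpa [Option.isNone_iff_eq_none, Option.isSome_iff_ne_none] using this
    | succ j ih =>
      rw [List.replicate_succ', ← List.append_assoc, List.rdropWhile_concat]
      simpa using ih
  apply h₁
  intro a ha
  rw [List.getLast?_map, Option.mem_def, Option.map_eq_some_iff] at ha
  obtain ⟨s, -, rfl⟩ := ha
  rfl

theorem read_eq (H : HoldsWord w h T) : T.read = w[h]?.map Sum.inl := by
  obtain ⟨rfl, j, hj⟩ := H
  rw [RightTape.read, hj]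
  by_cases hl : T.head < w.length
  · simp [List.getElem?_append_left, hl]
  · rw [List.getElem?_append_right (by simpa using hl), List.getElem?_replicate,
      List.getElem?_eq_none (not_lt.1 hl)]
    split <;> simp

theorem write_read (H : HoldsWord w h T) : HoldsWord w h (T.write T.read) := by
  obtain ⟨rfl, j, hj⟩ := H
  refine ⟨rfl, ?_⟩
  by_cases hl : T.head < T.cells.length
  · refine ⟨j, ?_⟩
    rw [RightTape.write, RightTape.read, if_pos hl, List.getElem?_eq_getElem hl]
    simp only [Option.join_some, List.set_getElem_self]
    exact hj
  · refine ⟨j + (T.head - T.cells.length) + 1, ?_⟩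
    rw [RightTape.write, RightTape.read, List.getElem?_eq_none (not_lt.1 hl), if_neg hl, hj]
    simp only [Option.join_none, List.append_assoc, List.replicate_add, List.replicate_one]

theorem move_right (H : HoldsWord w h T) : HoldsWord w (h + 1) (T.move Dir.right) := by
  obtain ⟨rfl, j, hj⟩ := H
  exact ⟨rfl, j, hj⟩

theorem write_end (H : HoldsWord w w.length T) (s : Sym) :
    HoldsWord (w ++ [s]) w.length (T.write (some (Sum.inl s))) := by
  obtain ⟨hT, j, hj⟩ := H
  refine ⟨hT, ?_⟩
  cases j with
  | zero =>
    refine ⟨0, ?_⟩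
    simp [RightTape.write, hj, hT]
  | succ j =>
    refine ⟨j, ?_⟩
    have : w.length < T.cells.length := by simp [hj]
    rw [RightTape.write, hT, if_pos this]
    simp only [hj, List.set_append]
    simp [List.replicate_succ]

theorem append (H : HoldsWord w h T) (v : List Sym) :
    HoldsWord (w ++ v) h (T.append (v.map Sum.inl)) := by
  refine ⟨H.1, 0, ?_⟩
  rw [RightTape.append, H.word_eq]
  simp [Function.comp_def]

end HoldsWord

/-- Every program is carried out by a Linked Data machine. The hypothesis on the initial state
allows the work tape to be prepared by marking a single cell. -/
theorem Program.exists_machine {α : Type} [Primcodable α] (p : Program α) (x₀ : α)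
    (hx₀ : Encodable.encode x₀ = 0) (U B L : Type*) [Denumerable U] [Denumerable B]
    [Denumerable L] :
    ∃ (M : LDMachine) (R : p.Cfg → M.Cfg → Prop), (∀ a c, R a c → c.output = a.output) ∧
      ∀ web : InfWord,
        (∃ c, R ⟨p.start, x₀, [], 0, []⟩ c ∧
          StateTransition.Reaches (M.step U B L web) (M.init []) c) ∧
        ∀ a a' c, p.Step U B L web a a' → R a c →
          ∃ c', R a' c' ∧ StateTransition.Reaches₁ (M.step U B L web) c c' := by
  choose code hcode using fun n =>
    exists_code_of_computable (p.computable_upd n) (p.computable_test n)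
  choose Q finQ q₀ m hm using fun n => exists_postMachine_of_code (code n)
  have := p.finNode
  -- The states: mark the first cell; expand; compute at a node; look at the result of the test;
  -- carry out the command.
  let St : Type := Option (Option ((Σ n, Q n) ⊕ (p.Node × Option Bool)))
  let run (n : p.Node) (q : Q n) : St := some (some (.inl ⟨n, q⟩))
  let look (n : p.Node) : St := some (some (.inr (n, none)))
  let perform (n : p.Node) (b : Bool) : St := some (some (.inr (n, some b)))
  let enter (n : p.Node) : St := run n (q₀ n)
  let M : LDMachine :=
    { State := St
      Work := StackSym
      Aux := Empty
      start := none
      expand := some none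
      resume := enter p.resume
      δ := fun s _ a l => match s with
        | none => some ⟨enter p.start, none, (true, fun _ => none), none, l, none, none⟩
        | some none => none
        | some (some (.inl ⟨n, q⟩)) => match m n q a with
          | some (q', .move d) => some ⟨run n q', none, a, some d, l, none, none⟩
          | some (q', .write a') => some ⟨run n q', none, a', none, l, none, none⟩
          | none => some ⟨look n, none, a, some .right, l, none, none⟩
        | some (some (.inr (n, none))) =>
          some ⟨perform n (decide (a.2 PartrecToTM2.K'.main = some PartrecToTM2.Γ'.bit1)),
            none, a, some .left, l, none, none⟩
        | some (some (.inr (n, some b))) => match p.cmd n b with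
          | .goto k => some ⟨enter k, none, a, none, l, none, none⟩
          | .print s k => some ⟨enter k, none, a, none, l, none, some s⟩
          | .put s k => some ⟨enter k, none, a, none, some (.inl s), some .right, none⟩
          | .get f => some ⟨enter (f (l.bind fun t => t.elim some Empty.elim)), none, a, none, l,
              some .right, none⟩
          | .expand => some ⟨some none, none, a, none, l, none, none⟩ }
  have step_of : ∀ (web : InfWord) (c : M.Cfg) a, c.state ≠ M.expand →
      M.δ c.state c.input.head c.work.head c.link.read = some a →
      LDMachine.act c a ∈ M.step U B L web c := by
    intro web c a hc ha
    rw [LDMachine.step, if_neg hc, ha]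
    rfl
  have ne_expand : ∀ z, (some (some z) : St) ≠ some none := fun z h => nomatch Option.some.inj h
  let R : p.Cfg → M.Cfg → Prop := fun a c => c.state = enter a.node ∧
    (∃ v : List ℕ, v.headI = Encodable.encode a.state ∧ HoldsList v c.work) ∧
    HoldsWord a.link a.head c.link ∧ c.output = a.output
  -- the computation at a node
  have node : ∀ (web : InfWord) (a : p.Cfg) (c : M.Cfg), R a c → ∃ c' : M.Cfg,
      StateTransition.Reaches₁ (M.step U B L web) c c' ∧
      c'.state = perform a.node (p.test a.node a.state) ∧
      HoldsList [Encodable.encode (p.upd a.node a.state), (p.test a.node a.state).toNat] c'.work ∧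
      HoldsWord a.link a.head c'.link ∧ c'.output = a.output := by
    rintro web ⟨n, x, w, h, o⟩ c ⟨hs, ⟨v, hv, hwork⟩, hlink, hout⟩
    obtain ⟨q, T, hT, hq, hr⟩ := hm n v _ _ (hcode n v x hv) hwork
    have sim : ∀ z : Q n × Tape StackSym,
        StateTransition.Reaches (postStep (m n)) (q₀ n, c.work) z →
        ∃ c' : M.Cfg, StateTransition.Reaches (M.step U B L web) c c' ∧ c'.state = run n z.1 ∧
          c'.work = z.2 ∧ HoldsWord w h c'.link ∧ c'.output = o := by
      intro z hz
      induction hz with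
      | refl => exact ⟨c, .refl, hs, rfl, hlink, hout⟩
      | @tail y z _ hyz ih =>
        obtain ⟨c', hc', hs', hw', hl', ho'⟩ := ih
        obtain ⟨⟨q', s⟩, hp, rfl⟩ := Option.map_eq_some_iff.1 hyz
        rw [← hw'] at hp
        cases s with
        | move d =>
          refine ⟨_, hc'.tail (step_of web c' ⟨run n q', none, c'.work.head, some d, c'.link.read,
            none, none⟩ (by rw [hs']; exact ne_expand _) ?_), rfl, ?_, hl'.write_read, ?_⟩
          · rw [hs']
            simp only [M, run, hp]
          · simp [LDMachine.act, hw']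
          · simp [LDMachine.act, ho']
        | write a =>
          refine ⟨_, hc'.tail (step_of web c' ⟨run n q', none, a, none, c'.link.read,
            none, none⟩ (by rw [hs']; exact ne_expand _) ?_), rfl, ?_, hl'.write_read, ?_⟩
          · rw [hs']
            simp only [M, run, hp]
          · simp [LDMachine.act, hw']
          · simp [LDMachine.act, ho']
    obtain ⟨c₁, r₁, s₁, w₁, l₁, o₁⟩ := sim _ hr
    have e₂ := step_of web c₁ ⟨look n, none, c₁.work.head, some .right, c₁.link.read,
            none, none⟩ (by rw [s₁]; exact ne_expand _) (by
              rw [s₁]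
              simp only [M, run, hq])
    set c₂ := LDMachine.act c₁ _
    have w₂ : c₂.work = T.move .right := by
      simp [c₂, LDMachine.act, w₁]
    have l₂ : HoldsWord w h c₂.link := l₁.write_read
    have o₂ : c₂.output = o := by simp [c₂, LDMachine.act, o₁]
    have s₂ : c₂.state = look n := rfl
    have e₃ := step_of web c₂ ⟨perform n (p.test n x), none, c₂.work.head, some .left,
      c₂.link.read, none, none⟩ (by rw [s₂]; exact ne_expand _) (by
        rw [s₂]
        have := hT.head_move_right
        simp only [M, look, w₂]
        congr 3
        rw [Bool.decide_congr this]
        simp)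
    refine ⟨_, (Relation.TransGen.tail' r₁ e₂).tail e₃, rfl, ?_, l₂.write_read, ?_⟩
    · simpa [LDMachine.act, w₂] using hT
    · simp [LDMachine.act, o₂]
  refine ⟨M, R, fun a c h => h.2.2.2, fun web => ⟨?_, ?_⟩⟩
  · refine ⟨_, ⟨?_, ⟨[], hx₀.symm, HoldsList.nil_of_blank⟩, ⟨?_, 1, ?_⟩, ?_⟩,
      .single (step_of web (M.init []) ⟨enter p.start, none, (true, fun _ => none), none, none,
        none, none⟩ (by simp [M, LDMachine.init]) ?_)⟩ <;> rfl
  · intro a a' c hstep hR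
    obtain ⟨c₁, r₁, s₁, w₁, l₁, o₁⟩ := node web a c hR
    have hne : c₁.state ≠ M.expand := by rw [s₁]; exact ne_expand _
    cases hstep with
    | @goto n x w h o k e =>
      refine ⟨_, ⟨rfl, ⟨[_, (p.test n x).toNat], rfl, ?_⟩, l₁.write_read, ?_⟩,
        r₁.tail (step_of web c₁
        ⟨enter k, none, c₁.work.head, none, c₁.link.read, none, none⟩ hne ?_)⟩
      · simpa [LDMachine.act] using w₁
      · simp [LDMachine.act, o₁]
      · rw [s₁]; simp only [M, perform, e]
    | @print n x w h o s k e =>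
      refine ⟨_, ⟨rfl, ⟨[_, (p.test n x).toNat], rfl, ?_⟩, l₁.write_read, ?_⟩,
        r₁.tail (step_of web c₁
        ⟨enter k, none, c₁.work.head, none, c₁.link.read, none, some s⟩ hne ?_)⟩
      · simpa [LDMachine.act] using w₁
      · simp [LDMachine.act, o₁]
      · rw [s₁]; simp only [M, perform, e]
    | @put n x w h o s k e hh =>
      subst hh
      refine ⟨_, ⟨rfl, ⟨[_, (p.test n x).toNat], rfl, ?_⟩, (l₁.write_end s).move_right, ?_⟩,
        r₁.tail (step_of web c₁
        ⟨enter k, none, c₁.work.head, none, some (.inl s), some .right, none⟩ hne ?_)⟩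
      · simpa [LDMachine.act] using w₁
      · simp [LDMachine.act, o₁]
      · rw [s₁]; simp only [M, perform, e]
    | @get n x w h o f e hh =>
      refine ⟨_, ⟨rfl, ⟨[_, (p.test n x).toNat], rfl, ?_⟩, l₁.write_read.move_right, ?_⟩,
        r₁.tail (step_of web c₁
        ⟨enter (f w[h]), none, c₁.work.head, none, c₁.link.read, some .right, none⟩ hne ?_)⟩
      · simpa [LDMachine.act] using w₁
      · simp [LDMachine.act, o₁]
      · rw [s₁]
        have : c₁.link.read = some (Sum.inl w[h]) := by
          rw [l₁.read_eq, List.getElem?_eq_getElem hh]; rfl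
        simp only [M, perform, e, this]
        rfl
    | @expand n x w h o e =>
      have e₂ := step_of web c₁ ⟨some none, none, c₁.work.head, none, c₁.link.read, none, none⟩
        hne (by rw [s₁]; simp only [M, perform, e])
      set c₂ := LDMachine.act c₁ _
      have w₂ : c₂.work = c₁.work := by simp [c₂, LDMachine.act]
      have l₂ : HoldsWord w h c₂.link := l₁.write_read
      have o₂ : c₂.output = o := by simp [c₂, LDMachine.act, o₁]
      have s₂ : c₂.state = M.expand := rfl
      refine ⟨{ c₂ with
        state := M.resume
        link := c₂.link.append ((LDMachine.expandAnswer U B L web c₂.link.word).map Sum.inl) },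
        ⟨rfl, ⟨[_, (p.test n x).toNat], rfl, by simpa [w₂] using w₁⟩, ?_, o₂⟩, (r₁.tail e₂).tail ?_⟩
      · rw [l₂.word_eq]
        exact l₂.append _
      · rw [LDMachine.step, if_pos s₂]
        rfl

end

/-! ### Words -/

section Words

variable {α : Type*}

theorem flatMap_range_prefix (s : ℕ → List α) {m n : ℕ} (h : m ≤ n) :
    (List.range m).flatMap s <+: (List.range n).flatMap s := by
  obtain ⟨k, rfl⟩ := Nat.exists_eq_add_of_le h
  rw [List.range_add, List.flatMap_append]
  exact List.prefix_append _ _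

theorem concatWord_eq_some_iff {s : ℕ → List Sym} {k : ℕ} {a : Sym} :
    concatWord s k = some a ↔ ∃ n, ((List.range n).flatMap s)[k]? = some a := by
  classical
  have mono : ∀ {m n : ℕ}, m ≤ n → ((List.range m).flatMap s)[k]? = some a →
      ((List.range n).flatMap s)[k]? = some a := by
    intro m n hmn h
    obtain ⟨t, ht⟩ := flatMap_range_prefix s hmn
    rw [← ht]
    obtain ⟨hk, -⟩ := List.getElem?_eq_some_iff.1 h
    rw [List.getElem?_append_left hk, h]
  unfold concatWord
  constructor
  · intro h
    split_ifs at h with hk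
    exact ⟨_, h⟩
  · rintro ⟨n, hn⟩
    have hk : ∃ n, k < ((List.range n).flatMap s).length :=
      ⟨n, (List.getElem?_eq_some_iff.1 hn).1⟩
    rw [dif_pos hk]
    have hf := Nat.find_spec hk
    rcases le_total (Nat.find hk) n with h | h
    · have h₁ := List.getElem?_eq_getElem hf
      obtain ⟨t, ht⟩ := flatMap_range_prefix s h
      rw [← ht, List.getElem?_append_left hf] at hn
      exact hn
    · exact mono h hn

theorem occursIn_concatWord {w : List Sym} (hw : w ≠ []) {s : ℕ → List Sym} :
    OccursIn w (concatWord s) ↔ ∃ n, w <:+: (List.range n).flatMap s := by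
  constructor
  · rintro ⟨k, hk⟩
    have hpos := List.length_pos_iff.2 hw
    obtain ⟨n, hn⟩ := concatWord_eq_some_iff.1 (hk (w.length - 1) (by omega))
    have hlen := (List.getElem?_eq_some_iff.1 hn).1
    refine ⟨n, List.infix_iff_getElem?.2 ⟨k, by omega, fun i hi => ?_⟩⟩
    obtain ⟨m, hm⟩ := concatWord_eq_some_iff.1 (hk i hi)
    rw [List.getElem?_eq_getElem (show i + k < _ by omega)]
    have hm' := (List.getElem?_eq_some_iff.1 hm).1
    rcases le_total m n with h | h <;> obtain ⟨t, ht⟩ := flatMap_range_prefix s h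
    · rw [← hm]
      simp only [← ht, add_comm i k, List.getElem_append_left hm']
      rw [List.getElem?_eq_getElem hm']
    · rw [← ht, List.getElem?_append_left (by omega), add_comm k i,
        List.getElem?_eq_getElem (show i + k < _ by omega)] at hm
      exact hm
  · rintro ⟨n, h⟩
    obtain ⟨k, -, hk⟩ := List.infix_iff_getElem?.1 h
    exact ⟨k, fun i hi => concatWord_eq_some_iff.2 ⟨n, by rw [add_comm]; exact hk i hi⟩⟩

theorem isPrefixOf_concatWord {w : List Sym} {s : ℕ → List Sym} :
    IsPrefixOf w (concatWord s) ↔ ∃ n, w <+: (List.range n).flatMap s := by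
  constructor
  · intro h
    rcases List.eq_nil_or_concat w with rfl | ⟨v, a, rfl⟩
    · exact ⟨0, List.nil_prefix⟩
    · obtain ⟨n, hn⟩ := concatWord_eq_some_iff.1 (h v.length (by simp))
      have hlen := (List.getElem?_eq_some_iff.1 hn).1
      refine ⟨n, List.prefix_iff_getElem?.2 fun i hi => ?_⟩
      obtain ⟨m, hm⟩ := concatWord_eq_some_iff.1 (h i hi)
      have hi' : i < ((List.range n).flatMap s).length := by simp at hi; omega
      have hm' := (List.getElem?_eq_some_iff.1 hm).1
      rcases le_total m n with h | h <;> obtain ⟨t, ht⟩ := flatMap_range_prefix s h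
      · rw [← ht, List.getElem?_append_left hm', hm]
      · rw [← ht, List.getElem?_append_left hi'] at hm
        exact hm
  · rintro ⟨n, h⟩ i hi
    exact concatWord_eq_some_iff.2 ⟨n, List.prefix_iff_getElem?.1 h i hi⟩

theorem IsPrefixOf.of_prefix {v w : List Sym} {x : InfWord} (h : v <+: w) (hw : IsPrefixOf w x) :
    IsPrefixOf v x := by
  intro i hi
  rw [hw i (hi.trans_le h.length_le)]
  exact congrArg some (h.getElem hi).symm

/-- A word that begins with `a` and occurs in `p ++ r`, where `a` is not in `p`, occurs in `r`. -/
theorem infix_of_infix_append {a : α} {l p r : List α} (h : a :: l <:+: p ++ r) (ha : a ∉ p) :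
    a :: l <:+: r := by
  induction p with
  | nil => exact h
  | cons b p ih =>
    rw [List.mem_cons, not_or] at ha
    rw [List.cons_append, List.infix_cons_iff] at h
    rcases h with h | h
    · exact absurd (List.cons_prefix_cons.1 h).1 ha.1
    · exact ih h ha.2

theorem append_cons_inj_of_notMem {a : α} {x y r t : List α} (h : x ++ a :: r = y ++ a :: t)
    (hx : a ∉ x) (hy : a ∉ y) : x = y ∧ r = t := by
  induction x generalizing y with
  | nil =>
    cases y with
    | nil => simpa using h
    | cons b y => simp at h hy; exact absurd h.1 hy.1
  | cons c x ih =>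
    cases y with
    | nil => simp at h hx; exact absurd h.1.symm hx.1
    | cons b y =>
      simp only [List.cons_append, List.cons.injEq, List.mem_cons, not_or] at h hx hy
      obtain ⟨h₁, h₂⟩ := ih h.2 hx.2 hy.2
      exact ⟨by rw [h.1, h₁], h₂⟩

/-- Blocks that begin with `a` and end with `b`, both of which occur nowhere else in them, can be
recognized in a concatenation. -/
theorem mem_of_infix_flatten {a b : α} (hab : a ≠ b) {x : List α} {ys : List (List α)}
    (hxb : b ∉ x) (hy : ∀ y ∈ ys, a ∉ y ∧ b ∉ y)
    (h : a :: (x ++ [b]) <:+: (ys.map fun y => a :: (y ++ [b])).flatten) : x ∈ ys := by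
  induction ys with
  | nil => simp at h
  | cons y ys ih =>
    rw [List.map_cons, List.flatten_cons, List.cons_append, List.infix_cons_iff] at h
    obtain ⟨hya, hyb⟩ := hy y List.mem_cons_self
    rcases h with h | h
    · obtain ⟨t, ht⟩ := (List.cons_prefix_cons.1 h).2
      rw [List.append_assoc, List.append_assoc] at ht
      rw [(append_cons_inj_of_notMem ht hxb hyb).1]
      exact List.mem_cons_self
    · refine List.mem_cons_of_mem _ (ih (fun z hz => hy z (List.mem_cons_of_mem _ hz)) ?_)
      exact infix_of_infix_append h (by simp [hya, hab])

/-- Blocks separated by `a` can be recognized. -/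
theorem mem_of_infix_separated {a : α} {x : List α} {ys : List (List α)}
    (hx : a ∉ x) (hy : ∀ y ∈ ys, a ∉ y)
    (h : a :: (x ++ [a]) <:+: a :: (ys.map fun y => y ++ [a]).flatten) : x ∈ ys := by
  induction ys with
  | nil =>
    have := h.length_le
    simp at this
  | cons y ys ih =>
    have hya := hy y List.mem_cons_self
    rw [List.infix_cons_iff] at h
    rcases h with h | h
    · obtain ⟨t, ht⟩ := (List.cons_prefix_cons.1 h).2
      rw [List.map_cons, List.flatten_cons, List.append_assoc, List.append_assoc] at ht
      rw [(append_cons_inj_of_notMem ht hx hya).1]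
      exact List.mem_cons_self
    · refine List.mem_cons_of_mem _ (ih (fun z hz => hy z (List.mem_cons_of_mem _ hz)) ?_)
      rw [List.map_cons, List.flatten_cons, List.append_assoc] at h
      exact infix_of_infix_append h hya

end Words

/-! ### Unique readability of encodings -/

/-- The symbols from which the encodings of names are built. -/
def Sym.IsName (s : Sym) : Prop :=
  s = .zero ∨ s = .one ∨ s = .uriMark ∨ s = .bnodeMark ∨ s = .litMark ∨ s = .varMark

theorem binary_injective : Function.Injective binary := by
  intro m n h
  have hb : Function.Injective fun b : Bool => if b then Sym.one else Sym.zero := by decide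
  have h₁ : m.bits = n.bits := (List.map_injective_iff.2 hb) h
  refine Nat.digits_inj_iff (b := 2).1 ?_
  rw [Nat.digits_two_eq_bits, Nat.digits_two_eq_bits, h₁]

theorem mem_binary {n : ℕ} {s : Sym} (h : s ∈ binary n) : s = .zero ∨ s = .one := by
  obtain ⟨b, -, rfl⟩ := List.mem_map.1 h
  cases b <;> simp

theorem commaSep_cons (x : List Sym) (l : List (List Sym)) :
    commaSep (x :: l) = x ++ l.flatMap (Sym.comma :: ·) := by
  induction l generalizing x with
  | nil => simp [commaSep]
  | cons y l ih =>
    rw [commaSep, List.intercalate_cons_cons, ← commaSep, ih]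
    simp

theorem notMem_commaSep {s : Sym} {l : List (List Sym)} (hs : s ≠ .comma) (h : ∀ x ∈ l, s ∉ x) :
    s ∉ commaSep l := by
  cases l with
  | nil => simp [commaSep]
  | cons x l =>
    rw [commaSep_cons, List.mem_append, List.mem_flatMap]
    rintro (hx | ⟨y, hy, hsy⟩)
    · exact h x List.mem_cons_self hx
    · rcases List.mem_cons.1 hsy with rfl | hsy
      · exact hs rfl
      · exact h y (List.mem_cons_of_mem _ hy) hsy

theorem commaSep_injOn {l l' : List (List Sym)} (hl : ∀ x ∈ l, x ≠ [] ∧ Sym.comma ∉ x)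
    (hl' : ∀ x ∈ l', x ≠ [] ∧ Sym.comma ∉ x) (h : commaSep l = commaSep l') : l = l' := by
  have ne : ∀ {l : List (List Sym)}, (∀ x ∈ l, x ≠ [] ∧ Sym.comma ∉ x) → l ≠ [] →
      commaSep l ≠ [] := by
    intro l hl hne
    obtain ⟨x, l, rfl⟩ := List.exists_cons_of_ne_nil hne
    rw [commaSep_cons]
    simp [(hl x List.mem_cons_self).1]
  rcases eq_or_ne l [] with rfl | h₁
  · by_contra h₂
    exact ne hl' (Ne.symm h₂) h.symm
  rcases eq_or_ne l' [] with rfl | h₂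
  · exact absurd h (ne hl h₁)
  rw [← List.splitOn_intercalate Sym.comma (fun x hx => (hl x hx).2) h₁,
    ← List.splitOn_intercalate Sym.comma (fun x hx => (hl' x hx).2) h₂]
  exact congrArg _ h

section

variable {U B L V Doc : Type*} [Denumerable U] [Denumerable B] [Denumerable L] [Denumerable V]

theorem isName_of_mem_encUri {u : U} {s : Sym} (h : s ∈ encUri u) : s.IsName := by
  rcases List.mem_cons.1 h with rfl | h
  · simp [Sym.IsName]
  · rcases mem_binary h with rfl | rfl <;> simp [Sym.IsName]

theorem isName_of_mem_encVar {v : V} {s : Sym} (h : s ∈ encVar v) : s.IsName := by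
  rcases List.mem_cons.1 h with rfl | h
  · simp [Sym.IsName]
  · rcases mem_binary h with rfl | rfl <;> simp [Sym.IsName]

theorem isName_of_mem_encTerm {t : Term U B L} {s : Sym} (h : s ∈ encTerm t) : s.IsName := by
  cases t <;> (rcases List.mem_cons.1 h with rfl | h
               · simp [Sym.IsName]
               · rcases mem_binary h with rfl | rfl <;> simp [Sym.IsName])

theorem encUri_injective : Function.Injective (encUri : U → List Sym) := by
  intro u u' h
  exact Encodable.encode_injective (binary_injective (List.cons.inj h).2)

theorem encVar_injective : Function.Injective (encVar : V → List Sym) := by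
  intro u u' h
  exact Encodable.encode_injective (binary_injective (List.cons.inj h).2)

theorem encTerm_injective : Function.Injective (encTerm : Term U B L → List Sym) := by
  intro t t' h
  cases t <;> cases t' <;> simp [encTerm, encUri] at h <;>
    exact congrArg _ (Encodable.encode_injective (binary_injective h))

/-- A word of name symbols before a bracket or separator is determined by the whole. -/
theorem name_append_cons_inj {a : Sym} {x y r t : List Sym} (ha : ¬ a.IsName)
    (hx : ∀ s ∈ x, s.IsName) (hy : ∀ s ∈ y, s.IsName) (h : x ++ a :: r = y ++ a :: t) :
    x = y ∧ r = t :=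
  append_cons_inj_of_notMem h (fun h => ha (hx _ h)) (fun h => ha (hy _ h))

/-- The symbols of an encoded triple are name symbols, commas and angle brackets. -/
theorem notMem_encTriple {t : Triple U B L} {s : Sym} (hs : ¬ s.IsName) (h₁ : s ≠ .langle)
    (h₂ : s ≠ .rangle) (h₃ : s ≠ .comma) : s ∉ encTriple t := by
  have := fun h => hs (isName_of_mem_encTerm (t := t.subjTerm) (s := s) h)
  have := fun h => hs (isName_of_mem_encTerm (t := t.obj) (s := s) h)
  have := fun h => hs (isName_of_mem_encUri (u := t.pred) (s := s) h)
  simp_all [encTriple]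

theorem sharp_notMem_encTriples (T : Finset (Triple U B L)) : Sym.sharp ∉ encTriples T := by
  have : Sym.sharp ∉ commaSep ((T.sort (· ≤ ·)).map encTriple) := by
    refine notMem_commaSep (by decide) fun x hx => ?_
    obtain ⟨t, -, rfl⟩ := List.mem_map.1 hx
    exact notMem_encTriple (by simp [Sym.IsName]) (by decide) (by decide) (by decide)
  simp [encTriples, this]

/-! ### The Web tape -/

/-- The entry of the Web tape for a URI, if it has one. -/
noncomputable def Web.entry (W : Web U B L Doc) (n : ℕ) : Option (List Sym) :=
  (W.adoc (Denumerable.ofNat U n)).map fun d =>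
    encUri (Denumerable.ofNat U n) ++ encTriples (W.data d)

theorem Web.enc_eq (W : Web U B L Doc) : W.enc = concatWord fun
    | 0 => [Sym.sharp]
    | n + 1 => ((W.entry n).toList.map (· ++ [Sym.sharp])).flatten := by
  unfold Web.enc
  congr 1
  funext n
  cases n with
  | zero => rfl
  | succ n =>
    simp only [Web.entry]
    cases W.adoc (Denumerable.ofNat U n) <;> simp

/-- The Web tape holds, between two separators, exactly the entries of the Web. -/
theorem Web.occursIn_enc (W : Web U B L Doc) (u : U) (T : Finset (Triple U B L)) :
    OccursIn ([Sym.sharp] ++ encUri u ++ encTriples T ++ [Sym.sharp]) W.enc ↔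
      ∃ d, W.adoc u = some d ∧ encTriples T = encTriples (W.data d) := by
  rw [Web.enc_eq, occursIn_concatWord (by simp)]
  set s : ℕ → List Sym := fun
    | 0 => [Sym.sharp]
    | n + 1 => ((W.entry n).toList.map (· ++ [Sym.sharp])).flatten with hs
  have hflat : ∀ n, (List.range (n + 1)).flatMap s =
      Sym.sharp :: (((List.range n).filterMap W.entry).map fun y => y ++ [Sym.sharp]).flatten := by
    intro n
    rw [List.range_succ_eq_map, List.flatMap_cons, List.flatMap_map]
    simp only [hs, List.singleton_append, List.cons.injEq, true_and]
    induction List.range n with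
    | nil => rfl
    | cons k l ih =>
      rw [List.flatMap_cons, ih, List.filterMap_cons]
      cases W.entry k <;> simp
  have hentry : ∀ n, ∀ y ∈ W.entry n, Sym.sharp ∉ y := by
    intro n y hy
    obtain ⟨d, -, rfl⟩ := Option.map_eq_some_iff.1 hy
    rw [List.mem_append, not_or]
    exact ⟨fun h => by simpa [Sym.IsName] using isName_of_mem_encUri h,
      sharp_notMem_encTriples _⟩
  have hu : Sym.sharp ∉ encUri u ++ encTriples T := by
    rw [List.mem_append, not_or]
    exact ⟨fun h => by simpa [Sym.IsName] using isName_of_mem_encUri h,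
      sharp_notMem_encTriples _⟩
  constructor
  · rintro ⟨n, hn⟩
    cases n with
    | zero => simp at hn
    | succ n =>
      rw [hflat] at hn
      have := mem_of_infix_separated (x := encUri u ++ encTriples T) hu (fun y hy => by
        obtain ⟨k, -, hk⟩ := List.mem_filterMap.1 hy
        exact hentry k y hk) (by simpa using hn)
      obtain ⟨k, -, hk⟩ := List.mem_filterMap.1 this
      obtain ⟨d, hd, he⟩ := Option.map_eq_some_iff.1 hk
      obtain ⟨h₁, h₂⟩ := name_append_cons_inj (a := Sym.llangle) (by simp [Sym.IsName])
        (fun _ => isName_of_mem_encUri) (fun _ => isName_of_mem_encUri)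
        (by simpa [encTriples] using he)
      obtain rfl := encUri_injective h₁
      exact ⟨d, hd, by rw [encTriples, encTriples]; simpa using h₂.symm⟩
  · rintro ⟨d, hd, hT⟩
    refine ⟨Encodable.encode u + 1 + 1, ?_⟩
    have he : W.entry (Encodable.encode u) = some (encUri u ++ encTriples T) := by
      simp [Web.entry, hd, hT]
    have hsuffix : ∀ ys : List (List Sym),
        [Sym.sharp] <:+ Sym.sharp :: (ys.map fun y => y ++ [Sym.sharp]).flatten := by
      intro ys
      rcases List.eq_nil_or_concat ys with rfl | ⟨zs, z, rfl⟩
      · simp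
      · refine ⟨Sym.sharp :: ((zs.map fun y => y ++ [Sym.sharp]).flatten ++ z), ?_⟩
        simp
    obtain ⟨p, hp⟩ := hsuffix ((List.range (Encodable.encode u)).filterMap W.entry)
    refine ⟨p, [], ?_⟩
    rw [List.range_succ, List.flatMap_append, hflat, ← hp]
    simp [hs, he]

/-! ### The encoding of valuations -/

/-- The item for the variable `v` in the encoding of a valuation that maps `v` to `t`. -/
def encItem (v : V) (t : Term U B L) : List Sym := encVar v ++ [Sym.arrow] ++ encTerm t

theorem encItem_inj {v v' : V} {t t' : Term U B L} (h : encItem v t = encItem v' t') :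
    v = v' ∧ t = t' := by
  obtain ⟨h₁, h₂⟩ := name_append_cons_inj (a := Sym.arrow) (by simp [Sym.IsName])
    (fun _ => isName_of_mem_encVar) (fun _ => isName_of_mem_encVar) (by simpa [encItem] using h)
  exact ⟨encVar_injective h₁, encTerm_injective h₂⟩

theorem notMem_encItem {v : V} {t : Term U B L} {s : Sym} (hs : ¬ s.IsName) (h : s ≠ .arrow) :
    s ∉ encItem v t := by
  have := fun h => hs (isName_of_mem_encTerm (t := t) (s := s) h)
  have := fun h => hs (isName_of_mem_encVar (v := v) (s := s) h)
  simp_all [encItem]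

/-- The encodings of valuations with finite domain consist of items, one for each variable in the
domain. -/
theorem encValuation_eq {μ : Valuation U B L V} (hμ : (Valuation.dom μ).Finite) :
    ∃ l : List (List Sym), encValuation μ = Sym.llangle :: (commaSep l ++ [Sym.rrangle]) ∧
      ∀ x, x ∈ l ↔ ∃ v t, μ v = some t ∧ x = encItem v t := by
  refine ⟨((hμ.toFinset.image Encodable.encode).sort (· ≤ ·)).map fun n =>
    encVar (Denumerable.ofNat V n) ++ [Sym.arrow] ++
      (μ (Denumerable.ofNat V n)).elim [] encTerm, ?_, fun x => ?_⟩
  · rw [encValuation, dif_pos hμ]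
    rfl
  · simp only [List.mem_map, Finset.mem_sort, Finset.mem_image, Set.Finite.mem_toFinset]
    constructor
    · rintro ⟨_, ⟨v, hv, rfl⟩, rfl⟩
      obtain ⟨t, ht⟩ := Option.ne_none_iff_exists'.1 hv
      exact ⟨v, t, ht, by simp [encItem, ht]⟩
    · rintro ⟨v, t, ht, rfl⟩
      exact ⟨_, ⟨v, by simp [Valuation.dom, ht], rfl⟩, by simp [encItem, ht]⟩

theorem encValuation_injOn :
    Set.InjOn (encValuation : Valuation U B L V → List Sym) {μ | (Valuation.dom μ).Finite} := by
  have aux : ∀ {l : List (List Sym)} {μ : Valuation U B L V},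
      (∀ x, x ∈ l ↔ ∃ v t, μ v = some t ∧ x = encItem v t) →
      ∀ x ∈ l, x ≠ [] ∧ Sym.comma ∉ x := by
    intro l μ hl x hx
    obtain ⟨v, t, -, rfl⟩ := (hl x).1 hx
    exact ⟨by simp [encItem], notMem_encItem (by simp [Sym.IsName]) (by decide)⟩
  intro μ hμ ν hν h
  obtain ⟨l, e, hl⟩ := encValuation_eq hμ
  obtain ⟨l', e', hl'⟩ := encValuation_eq hν
  rw [e, e'] at h
  obtain rfl := commaSep_injOn (aux hl) (aux hl') (List.append_cancel_right (List.cons.inj h).2)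
  have sub : ∀ v t, μ v = some t ↔ ν v = some t := by
    intro v t
    constructor <;> intro hv
    · obtain ⟨v', t', h', hi⟩ := (hl' _).1 ((hl _).2 ⟨v, t, hv, rfl⟩)
      obtain ⟨rfl, rfl⟩ := encItem_inj hi
      exact h'
    · obtain ⟨v', t', h', hi⟩ := (hl _).1 ((hl' _).2 ⟨v, t, hv, rfl⟩)
      obtain ⟨rfl, rfl⟩ := encItem_inj hi
      exact h'
  funext v
  exact Option.ext fun t => sub v t

theorem encValuation_body {μ : Valuation U B L V} (hμ : (Valuation.dom μ).Finite) :
    ∃ x, encValuation μ = Sym.llangle :: (x ++ [Sym.rrangle]) ∧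
      Sym.llangle ∉ x ∧ Sym.rrangle ∉ x := by
  obtain ⟨l, e, hl⟩ := encValuation_eq hμ
  refine ⟨_, e, ?_, ?_⟩ <;> refine notMem_commaSep (by decide) fun x hx => ?_ <;>
    obtain ⟨v, t, -, rfl⟩ := (hl x).1 hx <;>
    exact notMem_encItem (by simp [Sym.IsName]) (by decide)

/-- Only members of a set of valuations occur in a possible encoding of it. -/
theorem mem_of_infix_of_isEncodingOf {x : InfWord} {Ω : Set (Valuation U B L V)}
    (hx : IsEncodingOf x Ω) {w : List Sym} (hw : IsPrefixOf w x) {μ : Valuation U B L V}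
    (hμ : (Valuation.dom μ).Finite) (h : encValuation μ <:+: w) : μ ∈ Ω := by
  obtain ⟨hfin, e, he, -, rfl⟩ := hx
  obtain ⟨n, hn⟩ := isPrefixOf_concatWord.1 hw
  have hi := h.trans hn.isInfix
  have hmem : ∀ ν ∈ (List.range n).filterMap e, ν ∈ Ω := by
    intro ν hν
    obtain ⟨k, -, hk⟩ := List.mem_filterMap.1 hν
    exact (he ν).2 ⟨k, hk⟩
  have hflat : ((List.range n).flatMap fun n => (e n).elim [] encValuation) =
      (((List.range n).filterMap e).map encValuation).flatten := by
    induction List.range n with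
    | nil => rfl
    | cons k l ih =>
      rw [List.flatMap_cons, ih, List.filterMap_cons]
      cases e k <;> simp
  rw [hflat] at hi
  let body : List Sym → List Sym := fun w => w.tail.dropLast
  have hbody : ∀ ν : Valuation U B L V, (Valuation.dom ν).Finite →
      encValuation ν = Sym.llangle :: (body (encValuation ν) ++ [Sym.rrangle]) ∧
      Sym.llangle ∉ body (encValuation ν) ∧ Sym.rrangle ∉ body (encValuation ν) := by
    intro ν hν
    obtain ⟨x, e, h₁, h₂⟩ := encValuation_body hν
    simp [e, body, h₁, h₂]
  obtain ⟨e₁, -, e₂⟩ := hbody μ hμ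
  have hmap : ((List.range n).filterMap e).map encValuation =
      (((List.range n).filterMap e).map fun ν => body (encValuation ν)).map
        fun y => Sym.llangle :: (y ++ [Sym.rrangle]) := by
    rw [List.map_map]
    exact List.map_congr_left fun ν hν => (hbody ν (hfin ν (hmem ν hν))).1
  rw [hmap, e₁] at hi
  have := mem_of_infix_flatten (by decide) e₂ (fun y hy => by
    obtain ⟨ν, hν, rfl⟩ := List.mem_map.1 hy
    exact (hbody ν (hfin ν (hmem ν hν))).2) hi
  obtain ⟨ν, hν, hb⟩ := List.mem_map.1 this
  have hνΩ := hmem ν hν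
  have : encValuation ν = encValuation μ := by
    rw [(hbody ν (hfin ν hνΩ)).1, hb, ← e₁]
  rwa [← encValuation_injOn (hfin ν hνΩ) hμ this]

end

/-! ### Evaluation over arbitrary relational structures -/

section

variable {U L V D D' : Type*}

/-- Two partial maps are compatible if they agree wherever both are defined. -/
def CompatibleMaps (μ ν : V → Option D) : Prop := ∀ v, μ v ≠ none → ν v ≠ none → μ v = ν v

/-- Satisfaction of a filter condition by a partial map into a set `D` in which the constants are
interpreted by `cst`. -/
def FilterCond.SatIn (cst : U ⊕ L → D) (μ : V → Option D) : FilterCond U L V → Prop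
  | .eqConst x c => μ x = some (cst c)
  | .eqVar x y => μ x ≠ none ∧ μ y ≠ none ∧ μ x = μ y
  | .bound x => μ x ≠ none
  | .neg R => ¬ R.SatIn cst μ
  | .and R₁ R₂ => R₁.SatIn cst μ ∧ R₂.SatIn cst μ
  | .or R₁ R₂ => R₁.SatIn cst μ ∨ R₂.SatIn cst μ

/-- The evaluation of a SPARQL expression over a set `D` with a ternary relation `R`, in which the
constants are interpreted by `cst`. Three cases matter: RDF terms, encodings of RDF terms, and
models of first-order theories. -/
def SparqlExpr.evalIn (cst : U ⊕ L → D) (R : D → D → D → Prop) :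
    SparqlExpr U L V → Set (V → Option D)
  | .pattern tp => {μ | {v | μ v ≠ none} = tp.vars ∧ ∃ s p o, R s p o ∧
      tp.subj.elim μ (fun u => some (cst (Sum.inl u))) = some s ∧
      tp.pred.elim μ (fun u => some (cst (Sum.inl u))) = some p ∧
      tp.obj.elim μ (fun c => some (cst c)) = some o}
  | .and P₁ P₂ => {μ | ∃ μ₁ ∈ P₁.evalIn cst R, ∃ μ₂ ∈ P₂.evalIn cst R, CompatibleMaps μ₁ μ₂ ∧
      μ = fun v => (μ₁ v).or (μ₂ v)}
  | .union P₁ P₂ => P₁.evalIn cst R ∪ P₂.evalIn cst R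
  | .opt P₁ P₂ => {μ | ∃ μ₁ ∈ P₁.evalIn cst R, ∃ μ₂ ∈ P₂.evalIn cst R, CompatibleMaps μ₁ μ₂ ∧
      μ = fun v => (μ₁ v).or (μ₂ v)} ∪
      {μ | μ ∈ P₁.evalIn cst R ∧ ∀ μ₂ ∈ P₂.evalIn cst R, ¬ CompatibleMaps μ μ₂}
  | .filter P C => {μ | μ ∈ P.evalIn cst R ∧ C.SatIn cst μ}

/-- The variables of a SPARQL expression that can be bound. -/
def SparqlExpr.varList : SparqlExpr U L V → List V
  | .pattern tp => tp.subj.getLeft?.toList ++ tp.pred.getLeft?.toList ++ tp.obj.getLeft?.toList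
  | .and P₁ P₂ => P₁.varList ++ P₂.varList
  | .union P₁ P₂ => P₁.varList ++ P₂.varList
  | .opt P₁ P₂ => P₁.varList ++ P₂.varList
  | .filter P _ => P.varList

/-- The constants of a filter condition. -/
def FilterCond.constList : FilterCond U L V → List (U ⊕ L)
  | .eqConst _ c => [c]
  | .eqVar _ _ => []
  | .bound _ => []
  | .neg R => R.constList
  | .and R₁ R₂ => R₁.constList ++ R₂.constList
  | .or R₁ R₂ => R₁.constList ++ R₂.constList

/-- The constants of a SPARQL expression. -/
def SparqlExpr.constList : SparqlExpr U L V → List (U ⊕ L)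
  | .pattern tp => (tp.subj.getRight?.map Sum.inl).toList ++
      (tp.pred.getRight?.map Sum.inl).toList ++ tp.obj.getRight?.toList
  | .and P₁ P₂ => P₁.constList ++ P₂.constList
  | .union P₁ P₂ => P₁.constList ++ P₂.constList
  | .opt P₁ P₂ => P₁.constList ++ P₂.constList
  | .filter P C => P.constList ++ C.constList

theorem TriplePattern.mem_vars_iff {tp : TriplePattern U L V} {v : V} :
    v ∈ tp.vars ↔ v ∈ (SparqlExpr.pattern tp).varList := by
  obtain ⟨s, p, o⟩ := tp
  rcases s with s | s <;> rcases p with p | p <;> rcases o with o | o <;>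
    simp [TriplePattern.vars, SparqlExpr.varList, eq_comm]

theorem SparqlExpr.mem_varList_of_mem_evalIn {cst : U ⊕ L → D} {R : D → D → D → Prop}
    {P : SparqlExpr U L V} {μ : V → Option D} (h : μ ∈ P.evalIn cst R) {v : V} (hv : μ v ≠ none) :
    v ∈ P.varList := by
  have joined : ∀ {P₁ P₂ : SparqlExpr U L V},
      (∀ {μ}, μ ∈ P₁.evalIn cst R → μ v ≠ none → v ∈ P₁.varList) →
      (∀ {μ}, μ ∈ P₂.evalIn cst R → μ v ≠ none → v ∈ P₂.varList) →
      ∀ {μ}, μ ∈ (P₁.and P₂).evalIn cst R → μ v ≠ none → v ∈ P₁.varList ++ P₂.varList := by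
    rintro P₁ P₂ h₁ h₂ _ ⟨μ₁, hμ₁, μ₂, hμ₂, -, rfl⟩ hv
    rw [List.mem_append]
    by_cases hn : μ₁ v = none
    · exact .inr (h₂ hμ₂ (by simpa [hn] using hv))
    · exact .inl (h₁ hμ₁ hn)
  induction P generalizing μ with
  | pattern tp =>
    rw [← TriplePattern.mem_vars_iff, ← h.1]
    exact hv
  | and P₁ P₂ ih₁ ih₂ => exact joined ih₁ ih₂ h hv
  | union P₁ P₂ ih₁ ih₂ =>
    rcases h with h | h
    · exact List.mem_append_left _ (ih₁ h hv)
    · exact List.mem_append_right _ (ih₂ h hv)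
  | opt P₁ P₂ ih₁ ih₂ =>
    rcases h with h | h
    · exact joined ih₁ ih₂ h hv
    · exact List.mem_append_left _ (ih₁ h.1 hv)
  | filter P C ih => exact ih h.1 hv

/-- Nothing can be found in the empty relation. -/
theorem SparqlExpr.evalIn_eq_empty {cst : U ⊕ L → D} {R : D → D → D → Prop}
    (hR : ∀ s p o, ¬ R s p o) (P : SparqlExpr U L V) : P.evalIn cst R = ∅ := by
  rw [Set.eq_empty_iff_forall_notMem]
  induction P with
  | pattern tp =>
    rintro μ ⟨-, s, p, o, h, -⟩
    exact hR _ _ _ h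
  | and P₁ P₂ ih₁ ih₂ =>
    rintro μ ⟨μ₁, h₁, -⟩
    exact ih₁ _ h₁
  | union P₁ P₂ ih₁ ih₂ =>
    rintro μ (h | h)
    · exact ih₁ _ h
    · exact ih₂ _ h
  | opt P₁ P₂ ih₁ ih₂ =>
    rintro μ (⟨μ₁, h₁, -⟩ | h)
    · exact ih₁ _ h₁
    · exact ih₁ _ h.1
  | filter P C ih =>
    rintro μ h
    exact ih _ h.1

section Embedding

variable {cst : U ⊕ L → D} {cst' : U ⊕ L → D'} {σ : D → D'}

theorem compatibleMaps_map (hσ : Function.Injective σ) {μ ν : V → Option D} :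
    CompatibleMaps (fun v => (μ v).map σ) (fun v => (ν v).map σ) ↔ CompatibleMaps μ ν := by
  refine forall_congr' fun v => ?_
  simp only [ne_eq, Option.map_eq_none_iff, (Option.map_injective hσ).eq_iff]

theorem FilterCond.satIn_map (hσ : Function.Injective σ) {C : FilterCond U L V}
    (hC : ∀ c ∈ C.constList, cst' c = σ (cst c)) {μ : V → Option D} :
    C.SatIn cst' (fun v => (μ v).map σ) ↔ C.SatIn cst μ := by
  induction C with
  | eqConst x c =>
    rw [SatIn, SatIn, hC c (by simp [constList]), ← Option.map_some,
      (Option.map_injective hσ).eq_iff]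
  | eqVar x y =>
    simp only [SatIn, ne_eq, Option.map_eq_none_iff, (Option.map_injective hσ).eq_iff]
  | bound x => simp only [SatIn, ne_eq, Option.map_eq_none_iff]
  | neg R ih => exact not_congr (ih hC)
  | and R₁ R₂ ih₁ ih₂ =>
    exact and_congr (ih₁ fun c h => hC c (List.mem_append_left _ h))
      (ih₂ fun c h => hC c (List.mem_append_right _ h))
  | or R₁ R₂ ih₁ ih₂ =>
    exact or_congr (ih₁ fun c h => hC c (List.mem_append_left _ h))
      (ih₂ fun c h => hC c (List.mem_append_right _ h))

theorem sumElim_map_iff (hσ : Function.Injective σ) {T : Type*} (x : V ⊕ T) (f : T → D)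
    (f' : T → D') (ν : V → Option D) (a : D) (hf : ∀ t, x = Sum.inr t → f' t = σ (f t)) :
    x.elim (fun v => (ν v).map σ) (fun t => some (f' t)) = some (σ a) ↔
      x.elim ν (fun t => some (f t)) = some a := by
  rcases x with v | t
  · rw [Sum.elim_inl, Sum.elim_inl, ← Option.map_some, (Option.map_injective hσ).eq_iff]
  · rw [Sum.elim_inr, Sum.elim_inr, hf t rfl, Option.some_inj, Option.some_inj, hσ.eq_iff]

/-- Evaluation commutes with embeddings that respect the constants of the expression. No condition
is put on elements outside the range of the embedding: the relation holds only within the range. -/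
theorem SparqlExpr.evalIn_map (hσ : Function.Injective σ) {R : D → D → D → Prop}
    {R' : D' → D' → D' → Prop}
    (hR : ∀ s p o, R' s p o ↔ ∃ s₀ p₀ o₀, R s₀ p₀ o₀ ∧ s = σ s₀ ∧ p = σ p₀ ∧ o = σ o₀)
    {P : SparqlExpr U L V} (hP : ∀ c ∈ P.constList, cst' c = σ (cst c)) :
    P.evalIn cst' R' = (fun μ v => (μ v).map σ) '' P.evalIn cst R := by
  have joined : ∀ {P₁ P₂ : SparqlExpr U L V},
      P₁.evalIn cst' R' = (fun μ v => (μ v).map σ) '' P₁.evalIn cst R →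
      P₂.evalIn cst' R' = (fun μ v => (μ v).map σ) '' P₂.evalIn cst R →
      (P₁.and P₂).evalIn cst' R' = (fun μ v => (μ v).map σ) '' (P₁.and P₂).evalIn cst R := by
    intro P₁ P₂ h₁ h₂
    have hor : ∀ a b : Option D, (a.map σ).or (b.map σ) = (a.or b).map σ := by
      intro a b; cases a <;> rfl
    ext μ
    constructor
    · rintro ⟨μ₁, hμ₁, μ₂, hμ₂, hc, rfl⟩
      rw [h₁] at hμ₁
      rw [h₂] at hμ₂
      obtain ⟨ν₁, hν₁, rfl⟩ := hμ₁
      obtain ⟨ν₂, hν₂, rfl⟩ := hμ₂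
      exact ⟨_, ⟨ν₁, hν₁, ν₂, hν₂, (compatibleMaps_map hσ).1 hc, rfl⟩,
        funext fun v => (hor _ _).symm⟩
    · rintro ⟨_, ⟨ν₁, hν₁, ν₂, hν₂, hc, rfl⟩, rfl⟩
      exact ⟨_, h₁ ▸ ⟨ν₁, hν₁, rfl⟩, _, h₂ ▸ ⟨ν₂, hν₂, rfl⟩, (compatibleMaps_map hσ).2 hc,
        funext fun v => (hor _ _).symm⟩
  induction P with
  | pattern tp =>
    obtain ⟨s, p, o⟩ := tp
    have hs : ∀ u, s = Sum.inr u → cst' (Sum.inl u) = σ (cst (Sum.inl u)) :=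
      fun u h => hP _ (by simp [constList, h])
    have hp : ∀ u, p = Sum.inr u → cst' (Sum.inl u) = σ (cst (Sum.inl u)) :=
      fun u h => hP _ (by simp [constList, h])
    have ho : ∀ c, o = Sum.inr c → cst' c = σ (cst c) :=
      fun u h => hP _ (by simp [constList, h])
    have hdom : ∀ ν : V → Option D, {v | (ν v).map σ ≠ none} = {v | ν v ≠ none} := by
      intro ν; ext v; simp
    ext μ
    constructor
    · rintro ⟨hd, a, b, c, habc, h₁, h₂, h₃⟩
      obtain ⟨a, b, c, h₀, rfl, rfl, rfl⟩ := (hR _ _ _).1 habc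
      have hrange : ∀ v, ∃ y : Option D, μ v = y.map σ := by
        intro v
        by_cases hv : μ v = none
        · exact ⟨none, hv⟩
        · have : v ∈ {v | μ v ≠ none} := hv
          rw [hd] at this
          rcases this with h | h | h <;> simp only at h <;> subst h
          · exact ⟨some a, h₁⟩
          · exact ⟨some b, h₂⟩
          · exact ⟨some c, h₃⟩
      choose ν hν using hrange
      obtain rfl : μ = fun v => (ν v).map σ := funext hν
      exact ⟨ν, ⟨by rw [← hd, hdom], a, b, c, h₀, (sumElim_map_iff hσ s _ _ ν a hs).1 h₁,
        (sumElim_map_iff hσ p _ _ ν b hp).1 h₂, (sumElim_map_iff hσ o _ _ ν c ho).1 h₃⟩, rfl⟩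
    · rintro ⟨ν, ⟨hd, a, b, c, habc, h₁, h₂, h₃⟩, rfl⟩
      exact ⟨by rw [← hd, hdom], σ a, σ b, σ c, (hR _ _ _).2 ⟨a, b, c, habc, rfl, rfl, rfl⟩,
        (sumElim_map_iff hσ s _ _ ν a hs).2 h₁, (sumElim_map_iff hσ p _ _ ν b hp).2 h₂,
        (sumElim_map_iff hσ o _ _ ν c ho).2 h₃⟩
  | and P₁ P₂ ih₁ ih₂ =>
    exact joined (ih₁ fun c h => hP c (List.mem_append_left _ h))
      (ih₂ fun c h => hP c (List.mem_append_right _ h))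
  | union P₁ P₂ ih₁ ih₂ =>
    rw [evalIn, evalIn, Set.image_union, ih₁ fun c h => hP c (List.mem_append_left _ h),
      ih₂ fun c h => hP c (List.mem_append_right _ h)]
  | opt P₁ P₂ ih₁ ih₂ =>
    have h₁ := ih₁ fun c h => hP c (List.mem_append_left _ h)
    have h₂ := ih₂ fun c h => hP c (List.mem_append_right _ h)
    rw [evalIn, evalIn, Set.image_union]
    refine congrArg₂ _ (joined h₁ h₂) ?_
    ext μ
    constructor
    · rintro ⟨hμ, hc⟩
      rw [h₁] at hμ
      obtain ⟨ν, hν, rfl⟩ := hμ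
      exact ⟨ν, ⟨hν, fun ν₂ hν₂ h => hc _ (h₂ ▸ ⟨ν₂, hν₂, rfl⟩) ((compatibleMaps_map hσ).2 h)⟩,
        rfl⟩
    · rintro ⟨ν, ⟨hν, hc⟩, rfl⟩
      refine ⟨h₁ ▸ ⟨ν, hν, rfl⟩, fun ν₂ hν₂ h => ?_⟩
      rw [h₂] at hν₂
      obtain ⟨ν₂, hν₂, rfl⟩ := hν₂
      exact hc ν₂ hν₂ ((compatibleMaps_map hσ).1 h)
  | filter P C ih =>
    have h₁ := ih fun c h => hP c (List.mem_append_left _ h)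
    have h₂ : ∀ c ∈ C.constList, cst' c = σ (cst c) := fun c h => hP c (List.mem_append_right _ h)
    ext μ
    constructor
    · rintro ⟨hμ, hC⟩
      rw [h₁] at hμ
      obtain ⟨ν, hν, rfl⟩ := hμ
      exact ⟨ν, ⟨hν, (FilterCond.satIn_map hσ h₂).1 hC⟩, rfl⟩
    · rintro ⟨ν, ⟨hν, hC⟩, rfl⟩
      exact ⟨h₁ ▸ ⟨ν, hν, rfl⟩, (FilterCond.satIn_map hσ h₂).2 hC⟩

end Embedding

end

section

variable {U B L V Doc : Type*}

/-- The ternary relation on RDF terms that a set of triples defines. -/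
def tripleRel (G : Set (Triple U B L)) (s p o : Term U B L) : Prop :=
  ∃ t ∈ G, t.subjTerm = s ∧ Term.uri t.pred = p ∧ t.obj = o

theorem FilterCond.sat_iff_satIn (μ : Valuation U B L V) (C : FilterCond U L V) :
    C.Sat μ ↔ C.SatIn constTerm μ := by
  induction C with
  | neg R ih => exact not_congr ih
  | and R₁ R₂ ih₁ ih₂ => exact and_congr ih₁ ih₂
  | or R₁ R₂ ih₁ ih₂ => exact or_congr ih₁ ih₂
  | _ => exact Iff.rfl

theorem SparqlExpr.eval_eq_evalIn (G : Set (Triple U B L)) (P : SparqlExpr U L V) :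
    P.eval G = P.evalIn constTerm (tripleRel G) := by
  induction P with
  | pattern tp =>
    ext μ
    refine and_congr Iff.rfl ⟨?_, ?_⟩
    · rintro ⟨t, ht, h⟩
      exact ⟨_, _, _, ⟨t, ht, rfl, rfl, rfl⟩, h⟩
    · rintro ⟨_, _, _, ⟨t, ht, rfl, rfl, rfl⟩, h⟩
      exact ⟨t, ht, h⟩
  | and P₁ P₂ ih₁ ih₂ =>
    rw [eval, evalIn, ih₁, ih₂]
    rfl
  | union P₁ P₂ ih₁ ih₂ => rw [eval, evalIn, ih₁, ih₂]
  | opt P₁ P₂ ih₁ ih₂ =>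
    rw [eval, evalIn, ih₁, ih₂]
    rfl
  | filter P C ih =>
    rw [eval, evalIn, ih]
    ext μ
    exact and_congr_right fun _ => FilterCond.sat_iff_satIn μ C

theorem SparqlExpr.eval_empty (P : SparqlExpr U L V) : P.eval (∅ : Set (Triple U B L)) = ∅ := by
  rw [eval_eq_evalIn]
  exact evalIn_eq_empty (by simp [tripleRel]) P

theorem SparqlExpr.mem_varList_of_mem_eval {P : SparqlExpr U L V} {G : Set (Triple U B L)}
    {μ : Valuation U B L V} (h : μ ∈ P.eval G) {v : V} (hv : μ v ≠ none) : v ∈ P.varList := by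
  rw [eval_eq_evalIn] at h
  exact mem_varList_of_mem_evalIn h hv

theorem SparqlExpr.finite_dom_of_mem_eval {P : SparqlExpr U L V} {G : Set (Triple U B L)}
    {μ : Valuation U B L V} (h : μ ∈ P.eval G) : (Valuation.dom μ).Finite :=
  (List.finite_toSet P.varList).subset fun _ hv => mem_varList_of_mem_eval h hv

end

/-! ### Finite computations look up finitely many URIs -/

section

variable {U B L V Doc : Type*} [Denumerable U] [Denumerable B] [Denumerable L] [Denumerable V]

/-- The Web tapes `web` and `web'` hold the same documents for all URIs with numbers below `N`. -/
def AgreeBelow (U B L : Type*) [Denumerable U] [Denumerable B] [Denumerable L] (N : ℕ)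
    (web web' : InfWord) : Prop :=
  ∀ u : U, Encodable.encode u < N → ∀ T : Finset (Triple U B L),
    (OccursIn ([Sym.sharp] ++ encUri u ++ encTriples T ++ [Sym.sharp]) web ↔
      OccursIn ([Sym.sharp] ++ encUri u ++ encTriples T ++ [Sym.sharp]) web')

theorem exists_bound_of_suffix {A : Type} (w : List (Option (Sym ⊕ A))) :
    ∃ N, ∀ u : U, (encUri u).map (fun s => some (Sum.inl s)) <:+ w → Encodable.encode u < N := by
  have hinj : Function.Injective
      fun u : U => (encUri u).map (fun s => (some (Sum.inl s) : Option (Sym ⊕ A))) := by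
    refine Function.Injective.comp (g := List.map fun s => (some (Sum.inl s) : Option (Sym ⊕ A)))
      (List.map_injective_iff.2 fun a b h => ?_) encUri_injective
    simpa using h
  have hfin : {u : U |
      (encUri u).map (fun s => (some (Sum.inl s) : Option (Sym ⊕ A))) <:+ w}.Finite :=
    Set.Finite.of_finite_image ((List.finite_toSet w.tails).subset (by
      rintro _ ⟨u, hu, rfl⟩
      exact (List.mem_tails _ _).2 hu)) hinj.injOn
  obtain ⟨N, hN⟩ := (hfin.image Encodable.encode).bddAbove
  exact ⟨N + 1, fun u hu => Nat.lt_succ_of_le (hN ⟨u, hu, rfl⟩)⟩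

theorem expandAnswer_congr {A : Type} {web web' : InfWord} {w : List (Option (Sym ⊕ A))}
    {N : ℕ}
    (hN : ∀ u : U, (encUri u).map (fun s => some (Sum.inl s)) <:+ w → Encodable.encode u < N)
    (h : AgreeBelow U B L N web web') :
    LDMachine.expandAnswer U B L web w = LDMachine.expandAnswer U B L web' w := by
  have : LDMachine.LookupFinds U B L web w = LDMachine.LookupFinds U B L web' w := by
    funext T
    refine propext (exists_congr fun u => and_congr_right fun hu => h u (hN u hu) T)
  unfold LDMachine.expandAnswer
  rw [this]

/-- A finite computation depends only on the documents of the finitely many URIs that it can have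
looked up. -/
theorem exists_bound_of_reaches {M : LDMachine} {web : InfWord} {c c' : M.Cfg}
    (h : StateTransition.Reaches (M.step U B L web) c c') :
    ∃ N, ∀ web', AgreeBelow U B L N web web' →
      StateTransition.Reaches (M.step U B L web') c c' := by
  induction h with
  | refl => exact ⟨0, fun _ _ => .refl⟩
  | @tail a b _ hab ih =>
    obtain ⟨N, hN⟩ := ih
    obtain ⟨N', hN'⟩ := exists_bound_of_suffix (U := U) a.link.word
    refine ⟨max N N', fun web' h =>
      (hN web' fun u hu => h u (hu.trans_le (le_max_left _ _))).tail ?_⟩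
    have : M.step U B L web a = M.step U B L web' a := by
      unfold LDMachine.step
      rw [expandAnswer_congr hN' fun u hu => h u (hu.trans_le (le_max_right _ _))]
    rwa [← this]

/-- The Web with the documents of `W`, located by `f`. -/
def Web.withAdoc (W : Web U B L Doc) (f : U → Option Doc) (hmem : ∀ u d, f u = some d → d ∈ W.docs)
    (hsurj : ∀ d ∈ W.docs, ∃ u, f u = some d) : Web U B L Doc :=
  { W with adoc := f, adoc_mem := hmem, adoc_surj := hsurj }

theorem agreeBelow_enc {W W' : Web U B L Doc} {N : ℕ}
    (h : ∀ u : U, Encodable.encode u < N → W.adoc u = W'.adoc u)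
    (hd : ∀ d ∈ W.docs, W.data d = W'.data d) : AgreeBelow U B L N W.enc W'.enc := by
  intro u hu T
  rw [Web.occursIn_enc, Web.occursIn_enc, ← h u hu]
  refine exists_congr fun d => and_congr_right fun e => ?_
  rw [hd d (W.adoc_mem u d e)]

theorem encValuation_ne_nil {μ : Valuation U B L V} (hμ : (Valuation.dom μ).Finite) :
    encValuation μ ≠ [] := by
  obtain ⟨x, e, -⟩ := encValuation_body hμ
  simp [e]

theorem IsEncodingOf.eq_none_of_empty {x : InfWord}
    (h : IsEncodingOf x (∅ : Set (Valuation U B L V))) (i : ℕ) : x i = none := by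
  obtain ⟨-, e, he, -, rfl⟩ := h
  have : ∀ n, e n = none := by
    intro n
    by_contra hn
    obtain ⟨μ, hμ⟩ := Option.ne_none_iff_exists'.1 hn
    exact (he μ).2 ⟨n, hμ⟩
  rw [Option.eq_none_iff_forall_ne_some]
  intro a ha
  obtain ⟨n, hn⟩ := concatWord_eq_some_iff.1 ha
  simp [this] at hn

theorem IsEncodingOf.exists_ne_none_of_mem {x : InfWord} {Ω : Set (Valuation U B L V)}
    (h : IsEncodingOf x Ω) {μ : Valuation U B L V} (hμ : μ ∈ Ω) : ∃ i, x i ≠ none := by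
  obtain ⟨hfin, e, he, -, rfl⟩ := h
  obtain ⟨n, hn⟩ := (he μ).1 hμ
  have hne : ((List.range (n + 1)).flatMap fun n => (e n).elim [] encValuation) ≠ [] := by
    rw [List.range_succ, List.flatMap_append]
    simp [hn, encValuation_ne_nil (hfin μ hμ)]
  obtain ⟨a, l, hl⟩ := List.exists_cons_of_ne_nil hne
  refine ⟨0, ?_⟩
  rw [concatWord_eq_some_iff.2 ⟨n + 1, by rw [hl]; rfl⟩]
  simp

/-- A machine that halts on the empty Web has looked up only finitely many URIs, so it cannot tell
the empty Web from one in which all documents are located elsewhere. -/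
theorem not_finitelyComputable_sparqlLD {P : SparqlExpr U L V}
    (hP : (sparqlLD B Doc P).Satisfiable) : ¬ FinitelyComputable (sparqlLD B Doc P) := by
  rintro ⟨M, hM⟩
  obtain ⟨W, μ, hμ⟩ := hP
  let W₀ : Web U B L Doc :=
    { docs := ∅
      data := fun _ => ∅
      bnodes_disjoint := by simp
      adoc := fun _ => none
      adoc_mem := by simp
      adoc_surj := by simp }
  have hempty : sparqlLD B Doc P W₀ = ∅ := by
    have : W₀.allData = ∅ := by simp [Web.allData, W₀]
    rw [sparqlLD, this, SparqlExpr.eval_empty]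
  obtain ⟨c, hc, henc⟩ := hM W₀
  rw [hempty] at henc
  obtain ⟨hreach, hhalt⟩ := StateTransition.mem_eval.1 hc
  obtain ⟨N, hN⟩ := exists_bound_of_reaches hreach
  let W' := W.withAdoc
    (fun u => if Encodable.encode u < N then none
      else W.adoc (Denumerable.ofNat U (Encodable.encode u - N)))
    (fun u d h => by
      split_ifs at h
      exact W.adoc_mem _ _ h)
    (fun d hd => by
      obtain ⟨u, hu⟩ := W.adoc_surj d hd
      exact ⟨Denumerable.ofNat U (Encodable.encode u + N), by simp [hu]⟩)
  have hreach' := hN W'.enc (agreeBelow_enc (fun u hu => by simp [W₀, W', Web.withAdoc, hu])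
    (by simp [W₀]))
  obtain ⟨c', hc', henc'⟩ := hM W'
  have hhalt' : M.step U B L W'.enc c = none := by
    unfold LDMachine.step at hhalt ⊢
    split_ifs at hhalt ⊢
    exact hhalt
  have := Part.mem_unique hc' (StateTransition.mem_eval.2 ⟨hreach', hhalt'⟩)
  subst this
  obtain ⟨i, hi⟩ := henc'.exists_ne_none_of_mem (μ := μ) hμ
  exact hi (henc.eq_none_of_empty i)

/-- If adding documents destroys a solution, a machine that has already reported the solution cannot
have looked up all URIs at which the further documents may be located. -/
theorem not_eventuallyComputable_sparqlLD {P : SparqlExpr U L V}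
    (hP : ¬ (sparqlLD B Doc P).Monotonic) : ¬ EventuallyComputable (sparqlLD B Doc P) := by
  rintro ⟨M, hM⟩
  simp only [LDQuery.Monotonic, not_forall] at hP
  obtain ⟨W₁, W₂, ⟨hdocs, hdata, -⟩, hsub⟩ := hP
  obtain ⟨μ, hμ₁, hμ₂⟩ := Set.not_subset.1 hsub
  -- Documents are located at URIs with even numbers, so that infinitely many URIs are free.
  let W₁' := W₁.withAdoc
    (fun u => if Even (Encodable.encode u)
      then W₁.adoc (Denumerable.ofNat U (Encodable.encode u / 2))
      else none)
    (fun u d h => by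
      split_ifs at h
      exact W₁.adoc_mem _ _ h)
    (fun d hd => by
      obtain ⟨u, hu⟩ := W₁.adoc_surj d hd
      exact ⟨Denumerable.ofNat U (2 * Encodable.encode u), by simp [hu]⟩)
  obtain ⟨c, hreach, hc⟩ := (hM W₁').2 μ hμ₁
  obtain ⟨N, hN⟩ := exists_bound_of_reaches hreach
  let W₂' := W₂.withAdoc
    (fun u => if Even (Encodable.encode u)
      then W₁.adoc (Denumerable.ofNat U (Encodable.encode u / 2))
      else if Encodable.encode u < N then none
      else W₂.adoc (Denumerable.ofNat U ((Encodable.encode u - 1) / 2 - N)))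
    (fun u d h => by
      split_ifs at h
      · exact hdocs (W₁.adoc_mem _ _ h)
      · exact W₂.adoc_mem _ _ h)
    (fun d hd => by
      obtain ⟨u, hu⟩ := W₂.adoc_surj d hd
      refine ⟨Denumerable.ofNat U (2 * (Encodable.encode u + N) + 1), ?_⟩
      have : ¬ Even (2 * (Encodable.encode u + N) + 1) := by simp
      simp only [Denumerable.encode_ofNat, this, if_false]
      rw [if_neg (by omega)]
      simp [hu])
  have hreach' := hN W₂'.enc (agreeBelow_enc
    (fun u hu => by simp only [W₁', W₂', Web.withAdoc]; simp only [hu, if_true])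
    (fun d hd => hdata d hd))
  obtain ⟨x, hx, hpre⟩ := (hM W₂').1 c hreach'
  exact hμ₂ (mem_of_infix_of_isEncodingOf hx hpre
    (SparqlExpr.finite_dom_of_mem_eval (G := W₁.allData) hμ₁) hc)

end

/-! ### SPARQL expressions as first-order formulas -/

section

open FirstOrder FirstOrder.Language

universe w

/-- The function symbols of the language of triples: one constant for each element of `K`. -/
inductive TripleFun (K : Type w) : ℕ → Type w
  | const (k : K) : TripleFun K 0

/-- The only relation symbol of the language of triples. -/
inductive TripleSymbol : ℕ → Type
  | holds : TripleSymbol 3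

/-- The first-order language with one ternary relation symbol and with constants for the elements
of `K`. -/
def tripleLanguage (K : Type w) : FirstOrder.Language.{w, 0} := ⟨TripleFun K, TripleSymbol⟩

theorem card_tripleLanguage_le (K : Type w) [Countable K] :
    (tripleLanguage K).card ≤ Cardinal.aleph0 := by
  have h₁ : Countable ((tripleLanguage K).Functions 0) := by
    refine (Function.Surjective.countable (f := TripleFun.const (K := K)) ?_)
    rintro ⟨k⟩
    exact ⟨k, rfl⟩
  have : Countable (tripleLanguage K).Symbols := by
    refine @instCountableSum _ _ ?_ ?_
    · refine @instCountableSigma _ _ _ fun n => ?_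
      rcases n with _ | n
      · exact h₁
      · exact ⟨fun _ => 0, by rintro ⟨⟩⟩
    · refine @instCountableSigma _ _ _ fun n => ⟨fun _ => 0, ?_⟩
      rintro ⟨⟩ ⟨⟩ -
      rfl
  exact Cardinal.mk_le_aleph0

variable {K : Type w} {U L V : Type*}

/-- The constant for `k`, as a function symbol. -/
def tripleFun (k : K) : (tripleLanguage K).Functions 0 := TripleFun.const k

/-- The ternary relation symbol. -/
def tripleSymbol (K : Type w) : (tripleLanguage K).Relations 3 := TripleSymbol.holds

/-- The element denoted by the constant for `k`. -/
def tripleConst (M : Type*) [(tripleLanguage K).Structure M] (k : K) : M :=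
  Structure.funMap (tripleFun k) ![]

/-- The relation of a structure for the language of triples. -/
def tripleHolds (K : Type w) (M : Type*) [(tripleLanguage K).Structure M] (s p o : M) : Prop :=
  Structure.RelMap (tripleSymbol K) ![s, p, o]

/-- The term for the constant `k`. -/
def constFOTerm {α : Type*} (k : K) : (tripleLanguage K).Term α :=
  .func (tripleFun k) ![]

/-- The atomic formula for the relation. -/
def holdsFormula {α : Type*} (s p o : (tripleLanguage K).Term α) : (tripleLanguage K).Formula α :=
  (tripleSymbol K).formula ![s, p, o]

theorem realize_constFOTerm {α M : Type*} [(tripleLanguage K).Structure M] (k : K) (a : α → M) :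
    (constFOTerm k).realize a = tripleConst M k := by
  exact congrArg (Structure.funMap (tripleFun k)) (funext fun i => i.elim0)

theorem realize_holdsFormula {α M : Type*} [(tripleLanguage K).Structure M]
    (s p o : (tripleLanguage K).Term α) (a : α → M) :
    (holdsFormula s p o).Realize a ↔
      tripleHolds K M (s.realize a) (p.realize a) (o.realize a) := by
  rw [holdsFormula, Formula.realize_rel, tripleHolds]
  refine iff_of_eq (congrArg _ (funext fun i => ?_))
  fin_cases i <;> rfl

open Classical in
/-- The restriction of `a` to the finite set `S`, as a partial map. -/
noncomputable def restrictTo {M : Type*} (S : Finset V) (a : V → M) (v : V) : Option M :=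
  if v ∈ S then some (a v) else none

theorem restrictTo_ne_none {M : Type*} {S : Finset V} {a : V → M} {v : V} :
    restrictTo S a v ≠ none ↔ v ∈ S := by
  simp [restrictTo]

theorem restrictTo_of_mem {M : Type*} {S : Finset V} {a : V → M} {v : V} (h : v ∈ S) :
    restrictTo S a v = some (a v) := if_pos h

/-- The formula `φ` expresses that the restriction of an assignment to `S` is in the result of the
evaluation of `P`, with the constants of `P` named by `cst`, in all structures of a universe. -/
def Expresses (cst : U ⊕ L → K) (P : SparqlExpr U L V) (S : Finset V)
    (φ : (tripleLanguage K).Formula V) : Prop :=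
  ∀ (M : Type w) [(tripleLanguage K).Structure M] (a : V → M),
    φ.Realize a ↔ restrictTo S a ∈ P.evalIn (fun c => tripleConst M (cst c)) (tripleHolds K M)

theorem exists_formula_filterCond (cst : U ⊕ L → K) (C : FilterCond U L V) (S : Finset V) :
    ∃ φ : (tripleLanguage K).Formula V, ∀ (M : Type w) [(tripleLanguage K).Structure M] (a : V → M),
      φ.Realize a ↔ C.SatIn (fun c => tripleConst M (cst c)) (restrictTo S a) := by
  classical
  induction C with
  | eqConst x c =>
    by_cases hx : x ∈ S
    · refine ⟨FirstOrder.Language.Term.equal (.var x) (constFOTerm (cst c)), fun M _ a => ?_⟩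
      rw [Formula.realize_equal, realize_constFOTerm, FilterCond.SatIn, restrictTo_of_mem hx,
        Option.some_inj, FirstOrder.Language.Term.realize_var]
    · exact ⟨⊥, fun M _ a => by simp [FilterCond.SatIn, restrictTo, hx]⟩
  | eqVar x y =>
    by_cases hx : x ∈ S
    · by_cases hy : y ∈ S
      · refine ⟨FirstOrder.Language.Term.equal (.var x) (.var y), fun M _ a => ?_⟩
        simp [FilterCond.SatIn, restrictTo, hx, hy]
      · exact ⟨⊥, fun M _ a => by simp [FilterCond.SatIn, restrictTo, hy]⟩
    · exact ⟨⊥, fun M _ a => by simp [FilterCond.SatIn, restrictTo, hx]⟩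
  | bound x =>
    by_cases hx : x ∈ S
    · exact ⟨⊤, fun M _ a => by simp [FilterCond.SatIn, restrictTo, hx]⟩
    · exact ⟨⊥, fun M _ a => by simp [FilterCond.SatIn, restrictTo, hx]⟩
  | neg R ih =>
    obtain ⟨φ, hφ⟩ := ih
    exact ⟨φ.not, fun M _ a => by rw [Formula.realize_not, hφ]; rfl⟩
  | and R₁ R₂ ih₁ ih₂ =>
    obtain ⟨φ, hφ⟩ := ih₁
    obtain ⟨ψ, hψ⟩ := ih₂
    exact ⟨φ ⊓ ψ, fun M _ a => by rw [Formula.realize_inf, hφ, hψ]; rfl⟩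
  | or R₁ R₂ ih₁ ih₂ =>
    obtain ⟨φ, hφ⟩ := ih₁
    obtain ⟨ψ, hψ⟩ := ih₂
    exact ⟨φ ⊔ ψ, fun M _ a => by rw [Formula.realize_sup, hφ, hψ]; rfl⟩

theorem elim_restrictTo {T M : Type*} [(tripleLanguage K).Structure M] {S : Finset V} (a : V → M)
    (x : V ⊕ T) (f : T → K) (hx : ∀ v, x = .inl v → v ∈ S) :
    x.elim (restrictTo S a) (fun t => some (tripleConst M (f t))) =
      some ((x.elim FirstOrder.Language.Term.var fun t => constFOTerm (f t)).realize a) := by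
  rcases x with v | t
  · exact restrictTo_of_mem (hx v rfl)
  · exact congrArg some (realize_constFOTerm _ _).symm

theorem exists_formula_pattern (cst : U ⊕ L → K) (tp : TriplePattern U L V) (S : Finset V) :
    ∃ φ, Expresses cst (.pattern tp) S φ := by
  classical
  by_cases hS : (S : Set V) = tp.vars
  · refine ⟨holdsFormula
      (tp.subj.elim .var fun u => constFOTerm (cst (.inl u)))
      (tp.pred.elim .var fun u => constFOTerm (cst (.inl u)))
      (tp.obj.elim .var fun c => constFOTerm (cst c)), fun M _ a => ?_⟩
    have mem : ∀ {v}, v ∈ tp.vars → v ∈ S := fun hv => Finset.mem_coe.1 (hS ▸ hv)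
    have h₁ := elim_restrictTo a tp.subj (fun u => cst (.inl u)) fun v hv => mem (.inl hv)
    have h₂ := elim_restrictTo a tp.pred (fun u => cst (.inl u)) fun v hv => mem (.inr (.inl hv))
    have h₃ := elim_restrictTo a tp.obj cst fun v hv => mem (.inr (.inr hv))
    rw [realize_holdsFormula]
    constructor
    · intro h
      refine ⟨?_, _, _, _, h, h₁, h₂, h₃⟩
      rw [← hS]
      ext v
      exact restrictTo_ne_none
    · rintro ⟨-, s, p, o, h, e₁, e₂, e₃⟩
      rw [h₁, Option.some_inj] at e₁
      rw [h₂, Option.some_inj] at e₂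
      rw [h₃, Option.some_inj] at e₃
      rwa [e₁, e₂, e₃]
  · refine ⟨⊥, fun M _ a => ?_⟩
    rw [Formula.realize_bot, false_iff]
    rintro ⟨h, -⟩
    refine hS (h ▸ ?_)
    ext v
    exact restrictTo_ne_none.symm

theorem exists_formula_join (cst : U ⊕ L → K) {P₁ P₂ : SparqlExpr U L V}
    (h₁ : ∀ S, ∃ φ, Expresses cst P₁ S φ) (h₂ : ∀ S, ∃ φ, Expresses cst P₂ S φ) (S : Finset V) :
    ∃ φ, Expresses cst (.and P₁ P₂) S φ := by
  classical
  choose φ hφ using h₁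
  choose ψ hψ using h₂
  refine ⟨Formula.iSup fun p : {p : ↥S.powerset × ↥S.powerset // p.1.1 ∪ p.2.1 = S} =>
    φ p.1.1.1 ⊓ ψ p.1.2.1, fun M _ a => ?_⟩
  rw [Formula.realize_iSup]
  constructor
  · rintro ⟨⟨⟨⟨S₁, hS₁⟩, ⟨S₂, hS₂⟩⟩, hS⟩, h⟩
    rw [Formula.realize_inf, hφ, hψ] at h
    refine ⟨_, h.1, _, h.2, ?_, ?_⟩
    · intro v hv₁ hv₂
      rw [restrictTo_of_mem (restrictTo_ne_none.1 hv₁),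
        restrictTo_of_mem (restrictTo_ne_none.1 hv₂)]
    · simp only at hS
      subst hS
      funext v
      by_cases hv₁ : v ∈ S₁ <;> by_cases hv₂ : v ∈ S₂ <;> simp [restrictTo, hv₁, hv₂]
  · rintro ⟨μ₁, hμ₁, μ₂, hμ₂, hc, hu⟩
    have hu : ∀ v, restrictTo S a v = (μ₁ v).or (μ₂ v) := congrFun hu
    have e₁ : restrictTo (S.filter fun v => μ₁ v ≠ none) a = μ₁ := by
      funext v
      have := hu v
      have := hc v
      cases h : μ₁ v <;> by_cases hv : v ∈ S <;> simp_all [restrictTo]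
    have e₂ : restrictTo (S.filter fun v => μ₂ v ≠ none) a = μ₂ := by
      funext v
      have := hu v
      have := hc v
      cases h : μ₂ v <;> cases h' : μ₁ v <;> by_cases hv : v ∈ S <;> simp_all [restrictTo]
    refine ⟨⟨⟨⟨_, Finset.mem_powerset.2 (Finset.filter_subset (fun v => μ₁ v ≠ none) S)⟩,
      ⟨_, Finset.mem_powerset.2 (Finset.filter_subset (fun v => μ₂ v ≠ none) S)⟩⟩, ?_⟩, ?_⟩
    · ext v
      have := hu v
      simp only [Finset.mem_union, Finset.mem_filter]
      by_cases hv : v ∈ S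
      · cases h' : μ₁ v <;> simp_all [restrictTo]
        grind
      · simp [hv]
    · rw [Formula.realize_inf, hφ, hψ, e₁, e₂]
      exact ⟨hμ₁, hμ₂⟩

/-- The formula uses an existential quantifier for the variables outside `S`. -/
theorem exists_formula_compatible (cst : U ⊕ L → K) {P : SparqlExpr U L V}
    (h : ∀ S, ∃ φ, Expresses cst P S φ) (S : Finset V) :
    ∃ φ : (tripleLanguage K).Formula V, ∀ (M : Type w) [(tripleLanguage K).Structure M] (a : V → M),
      φ.Realize a ↔ ∃ μ ∈ P.evalIn (fun c => tripleConst M (cst c)) (tripleHolds K M),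
        CompatibleMaps (restrictTo S a) μ := by
  classical
  choose φ hφ using h
  refine ⟨Formula.iSup fun S' : ↥P.varList.toFinset.powerset => Formula.iExs ↥(S'.1 \ S)
    ((φ S'.1).relabel fun v => if h : v ∈ S'.1 \ S then .inr ⟨v, h⟩ else .inl v),
    fun M _ a => ?_⟩
  simp only [Formula.realize_iSup, Formula.realize_iExs, Formula.realize_relabel]
  constructor
  · rintro ⟨⟨S', hS'⟩, b, hb⟩
    rw [hφ] at hb
    refine ⟨_, hb, fun v hv hv' => ?_⟩
    rw [restrictTo_ne_none] at hv hv'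
    rw [restrictTo_of_mem hv, restrictTo_of_mem hv']
    simp [hv]
  · rintro ⟨μ, hμ, hc⟩
    refine ⟨⟨P.varList.toFinset.filter fun v => μ v ≠ none, by simp⟩,
      fun v => (μ v).getD (a v), ?_⟩
    rw [hφ]
    convert hμ using 1
    funext v
    by_cases hv : μ v = none
    · simp [restrictTo, hv]
    · have hm := SparqlExpr.mem_varList_of_mem_evalIn hμ hv
      have := hc v
      rw [restrictTo_of_mem (by simp [hm, hv])]
      by_cases hS : v ∈ S
      · have := this (restrictTo_ne_none.2 hS) hv
        rw [restrictTo_of_mem hS] at this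
        simp [hS, this]
      · obtain ⟨x, hx⟩ := Option.ne_none_iff_exists'.1 hv
        simp [hS, hm, hx]

/-- For each finite set of variables, the valuations with this domain in the result of a SPARQL
expression are defined by a first-order formula. -/
theorem exists_expresses (cst : U ⊕ L → K) (P : SparqlExpr U L V) (S : Finset V) :
    ∃ φ, Expresses cst P S φ := by
  induction P generalizing S with
  | pattern tp => exact exists_formula_pattern cst tp S
  | and P₁ P₂ ih₁ ih₂ => exact exists_formula_join cst ih₁ ih₂ S
  | union P₁ P₂ ih₁ ih₂ =>
    obtain ⟨φ, hφ⟩ := ih₁ S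
    obtain ⟨ψ, hψ⟩ := ih₂ S
    exact ⟨φ ⊔ ψ, fun M _ a => by rw [Formula.realize_sup, hφ, hψ]; rfl⟩
  | opt P₁ P₂ ih₁ ih₂ =>
    obtain ⟨φ, hφ⟩ := ih₁ S
    obtain ⟨ψ, hψ⟩ := exists_formula_join cst ih₁ ih₂ S
    obtain ⟨χ, hχ⟩ := exists_formula_compatible cst ih₂ S
    refine ⟨ψ ⊔ (φ ⊓ χ.not), fun M _ a => ?_⟩
    rw [Formula.realize_sup, Formula.realize_inf, Formula.realize_not, hφ, hψ, hχ]
    refine or_congr Iff.rfl (and_congr Iff.rfl ?_)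
    push Not
    rfl
  | filter P C ih =>
    obtain ⟨φ, hφ⟩ := ih S
    obtain ⟨ψ, hψ⟩ := exists_formula_filterCond cst C S
    exact ⟨φ ⊓ ψ, fun M _ a => by rw [Formula.realize_inf, hφ, hψ]; rfl⟩

end

/-! ### Compactness -/

section

open FirstOrder FirstOrder.Language Filter

universe u₁ u₂ u₃

variable {U : Type u₁} {B : Type u₂} {L : Type u₃}

/-- The structure of all RDF terms with the relation defined by the set of triples `G`. -/
def TermModel (_ : Set (Triple U B L)) : Type (max u₁ u₂ u₃) := Term U B L

/-- Each constant denotes itself. -/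
instance TermModel.structure (G : Set (Triple U B L)) :
    (tripleLanguage (Term U B L)).Structure (TermModel G) where
  funMap | .const k, _ => k
  RelMap | .holds, x => tripleRel G (x 0) (x 1) (x 2)

/-- The sentence that says that two constants are distinct. -/
def neSentence {K : Type*} (k k' : K) : (tripleLanguage K).Sentence :=
  (FirstOrder.Language.Term.equal (constFOTerm k) (constFOTerm k')).not

theorem realize_neSentence {K M : Type*} [(tripleLanguage K).Structure M] (k k' : K) :
    M ⊨ neSentence k k' ↔ tripleConst M k ≠ tripleConst M k' := by
  rw [neSentence, Sentence.Realize, Formula.realize_not, Formula.realize_equal,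
    realize_constFOTerm, realize_constFOTerm]

theorem Term.countable [Denumerable U] [Denumerable B] [Denumerable L] :
    Countable (Term U B L) :=
  have : Countable (ℕ ×ₗ ℕ) := inferInstanceAs (Countable (ℕ × ℕ))
  Term.key_injective.countable

/-- A chain of sets of triples has a countable limit model, which satisfies all sentences that hold
from some member of the chain on: a countable elementary substructure of an ultraproduct. -/
theorem exists_countable_limit_model [Denumerable U] [Denumerable B] [Denumerable L]
    (Gs : ℕ → Set (Triple U B L)) :
    ∃ (N : Type (max u₁ u₂ u₃)) (_ : (tripleLanguage (Term U B L)).Structure N), Countable N ∧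
      ∀ φ : (tripleLanguage (Term U B L)).Sentence,
        (∀ᶠ n in atTop, TermModel (Gs n) ⊨ φ) → N ⊨ φ := by
  have : Countable (Term U B L) := Term.countable
  have hne : ∀ n, Nonempty (TermModel (Gs n)) := fun n => ⟨Term.uri (Denumerable.ofNat U 0)⟩
  let M := (hyperfilter ℕ : Filter ℕ).Product fun n => TermModel (Gs n)
  have hM : ∀ φ : (tripleLanguage (Term U B L)).Sentence,
      (∀ᶠ n in atTop, TermModel (Gs n) ⊨ φ) → M ⊨ φ := fun φ hφ =>
    (Ultraproduct.sentence_realize φ).2 (Nat.hyperfilter_le_atTop hφ)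
  have hinj : Function.Injective (tripleConst M : Term U B L → M) := by
    intro k k' h
    by_contra hk
    exact (realize_neSentence k k').1
      (hM _ (.of_forall fun n => (realize_neSentence k k').2 hk)) h
  have : Infinite (Term U B L) :=
    Infinite.of_injective (fun n : ℕ => Term.uri (Denumerable.ofNat U n)) fun m n h => by
      simpa using congrArg Encodable.encode (Term.uri.inj h)
  have : Infinite M := Infinite.of_injective _ hinj
  obtain ⟨N, ⟨f⟩, hN⟩ := exists_elementaryEmbedding_card_eq_of_le (tripleLanguage (Term U B L)) M
    Cardinal.aleph0.{max u₁ u₂ u₃} le_rfl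
    (by simpa using card_tripleLanguage_le (Term U B L)) (by simp)
  exact ⟨N, inferInstance, Cardinal.mk_le_aleph0_iff.1 hN.le,
    fun φ hφ => (f.map_sentence φ).2 (hM φ hφ)⟩

/-- The sentence that says that the constant `k` denotes nothing that is related, in the first or
second position. -/
noncomputable def notSubjPredSentence {K : Type*} (k : K) : (tripleLanguage K).Sentence :=
  (Formula.iExs (Fin 2)
    (holdsFormula (constFOTerm k) (.var (.inr 0)) (.var (.inr 1)) ⊔
      holdsFormula (.var (.inr 0)) (constFOTerm k) (.var (.inr 1)))).not

theorem realize_notSubjPredSentence {K M : Type*} [(tripleLanguage K).Structure M] (k : K) :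
    M ⊨ notSubjPredSentence k ↔ ∀ a b : M, ¬ tripleHolds K M (tripleConst M k) a b ∧
      ¬ tripleHolds K M a (tripleConst M k) b := by
  simp only [notSubjPredSentence, Sentence.Realize, Formula.realize_not, Formula.realize_iExs,
    Formula.realize_sup, realize_holdsFormula, realize_constFOTerm,
    FirstOrder.Language.Term.realize_var, Sum.elim_inr, not_exists, not_or]
  exact ⟨fun h a b => h ![a, b], fun h x => h (x 0) (x 1)⟩

end

section

universe u₁ u₂ u₃

variable {U : Type u₁} {B : Type u₂} {L : Type u₃} {V Doc : Type*}

open Classical in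
/-- The Web with one document for each triple in `H`, which has no blank nodes. -/
noncomputable def tripleWeb {f : Triple U B L → Doc} {g : Triple U B L → U}
    (hf : Function.Injective f) (hg : Function.Injective g) (H : Set (Triple U B L))
    (hH : ∀ t ∈ H, t.bnodes = ∅) : Web U B L Doc where
  docs := f '' H
  data d := (Function.partialInv f d).toFinset
  bnodes_disjoint := by
    rintro _ ⟨t, ht, rfl⟩ d - -
    rw [Function.partialInv_left hf]
    simp [hH t ht]
  adoc u := ((Function.partialInv g u).filter (· ∈ H)).map f
  adoc_mem := by
    intro u d h
    obtain ⟨t, ht, rfl⟩ := Option.map_eq_some_iff.1 h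
    exact ⟨t, by simpa using (Option.filter_eq_some_iff.1 ht).2, rfl⟩
  adoc_surj := by
    rintro _ ⟨t, ht, rfl⟩
    exact ⟨g t, by simp [Function.partialInv_left hg, ht]⟩

theorem allData_tripleWeb {f : Triple U B L → Doc} {g : Triple U B L → U}
    (hf : Function.Injective f) (hg : Function.Injective g) (H : Set (Triple U B L))
    (hH : ∀ t ∈ H, t.bnodes = ∅) : (tripleWeb hf hg H hH).allData = H := by
  ext t
  constructor
  · rintro ⟨_, ⟨t', ht', rfl⟩, h⟩
    have : t ∈ (Function.partialInv f (f t')).toFinset := h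
    rw [Function.partialInv_left hf] at this
    rwa [show t = t' by simpa using this]
  · intro h
    refine ⟨f t, ⟨t, h, rfl⟩, ?_⟩
    change t ∈ (Function.partialInv f (f t)).toFinset
    rw [Function.partialInv_left hf]
    simp

/-- A set of triples without blank nodes is the set of triples in some Web, and its subsets are the
sets of triples in induced subwebs. -/
theorem eval_subset_of_monotonic [Denumerable U] [Denumerable B] [Denumerable L] [Infinite Doc]
    {P : SparqlExpr U L V} (hP : (sparqlLD B Doc P).Monotonic) {G H : Set (Triple U B L)}
    (hH : ∀ t ∈ H, t.bnodes = ∅) (hGH : G ⊆ H) : P.eval G ⊆ P.eval H := by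
  have : Countable (Triple U B L) :=
    have : Countable (ℕ ×ₗ ℕ) := inferInstanceAs (Countable (ℕ × ℕ))
    have : Countable ((ℕ ×ₗ ℕ) ×ₗ ((ℕ ×ₗ ℕ) ×ₗ (ℕ ×ₗ ℕ))) :=
      inferInstanceAs (Countable ((ℕ ×ₗ ℕ) × ((ℕ ×ₗ ℕ) × (ℕ ×ₗ ℕ))))
    Triple.key_injective.countable
  obtain ⟨e, he⟩ := exists_injective_nat (Triple U B L)
  have hf : Function.Injective fun t => Infinite.natEmbedding Doc (e t) :=
    (Infinite.natEmbedding Doc).injective.comp he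
  have hg : Function.Injective fun t => Denumerable.ofNat U (e t) := fun t t' h =>
    he (by simpa using congrArg Encodable.encode h)
  have hG : ∀ t ∈ G, t.bnodes = ∅ := fun t ht => hH t (hGH ht)
  classical
  have := hP (tripleWeb hf hg G hG) (tripleWeb hf hg H hH) ⟨Set.image_mono hGH, fun _ _ => rfl, ?_⟩
  · rwa [sparqlLD, sparqlLD, allData_tripleWeb, allData_tripleWeb] at this
  · intro u d
    cases h : Function.partialInv (fun t => Denumerable.ofNat U (e t)) u with
    | none => simp [tripleWeb, h]
    | some t =>
      simp only [tripleWeb, h, Option.map_eq_some_iff, Option.filter_eq_some_iff, Set.mem_image,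
        Option.some_inj]
      constructor
      · rintro ⟨_, ⟨rfl, ht⟩, rfl⟩
        rw [decide_eq_true_iff] at ht
        exact ⟨⟨t, ⟨rfl, decide_eq_true (hGH ht)⟩, rfl⟩, t, ht, rfl⟩
      · rintro ⟨⟨_, ⟨rfl, ht⟩, rfl⟩, t', ht', hd⟩
        obtain rfl := hf hd
        exact ⟨_, ⟨rfl, decide_eq_true ht'⟩, rfl⟩

/-- The triples whose terms are related by the image of the relation `R` under `σ`. -/
def imageTriples {D : Type*} (σ : D → Term U B L) (R : D → D → D → Prop) : Set (Triple U B L) :=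
  {t | ∃ s p o, R s p o ∧ t.subjTerm = σ s ∧ Term.uri t.pred = σ p ∧ t.obj = σ o}

theorem tripleRel_imageTriples {D : Type*} {σ : D → Term U B L} {R : D → D → D → Prop}
    (hR : ∀ s p o, R s p o → (∃ u, σ s = .uri u) ∧ ∃ u, σ p = .uri u) (s p o : Term U B L) :
    tripleRel (imageTriples σ R) s p o ↔
      ∃ s₀ p₀ o₀, R s₀ p₀ o₀ ∧ s = σ s₀ ∧ p = σ p₀ ∧ o = σ o₀ := by
  constructor
  · rintro ⟨t, ⟨s₀, p₀, o₀, h, e₁, e₂, e₃⟩, rfl, rfl, rfl⟩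
    exact ⟨s₀, p₀, o₀, h, e₁, e₂, e₃⟩
  · rintro ⟨s₀, p₀, o₀, h, rfl, rfl, rfl⟩
    obtain ⟨⟨u, hu⟩, v, hv⟩ := hR _ _ _ h
    exact ⟨⟨.inl u, v, σ o₀⟩, ⟨s₀, p₀, o₀, h, hu.symm, hv.symm, rfl⟩, hu.symm, hv.symm, rfl⟩

/-- A countable set can be renamed to a set of URIs and literals such that finitely many elements
get prescribed names and all others get URIs. -/
theorem exists_renaming [Denumerable U] {D : Type*} [Countable D] (c : U ⊕ L → D)
    (hc : Function.Injective c) (l : List (U ⊕ L)) :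
    ∃ σ : D → Term U B L, Function.Injective σ ∧ (∀ k ∈ l, σ (c k) = constTerm k) ∧
      ∀ x, (∃ u, σ x = .uri u) ∨ ∃ a, x = c (.inr a) ∧ σ x = .lit a := by
  classical
  obtain ⟨e, he⟩ := exists_injective_nat D
  obtain ⟨m, hm⟩ : ∃ m, ∀ u, Sum.inl u ∈ l → Encodable.encode u < m := by
    have : {u : U | (Sum.inl u : U ⊕ L) ∈ l}.Finite :=
      (List.finite_toSet l).preimage Sum.inl_injective.injOn
    obtain ⟨m, hm⟩ := (this.image Encodable.encode).bddAbove
    exact ⟨m + 1, fun u hu => Nat.lt_succ_of_le (hm ⟨u, hu, rfl⟩)⟩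
  let σ : D → Term U B L := fun x =>
    if h : ∃ k ∈ l, c k = x then constTerm h.choose else .uri (Denumerable.ofNat U (m + e x))
  have h₁ : ∀ k ∈ l, σ (c k) = constTerm k := by
    intro k hk
    have h : ∃ k' ∈ l, c k' = c k := ⟨k, hk, rfl⟩
    simp only [σ, dif_pos h]
    rw [hc h.choose_spec.2]
  have h₂ : ∀ x, (¬ ∃ k ∈ l, c k = x) → σ x = .uri (Denumerable.ofNat U (m + e x)) :=
    fun x h => dif_neg h
  have h₃ : ∀ k ∈ l, ∀ n, (constTerm k : Term U B L) ≠ .uri (Denumerable.ofNat U (m + n)) := by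
    rintro (u | a) hk n h
    · have := hm u hk
      rw [Term.uri.inj h] at this
      simp at this
    · cases h
  refine ⟨σ, fun x y hxy => ?_, h₁, fun x => ?_⟩
  · by_cases hx : ∃ k ∈ l, c k = x
    · obtain ⟨k, hk, rfl⟩ := hx
      rw [h₁ k hk] at hxy
      by_cases hy : ∃ k ∈ l, c k = y
      · obtain ⟨k', hk', rfl⟩ := hy
        rw [h₁ k' hk'] at hxy
        rcases k with k | k <;> rcases k' with k' | k' <;> simp_all [constTerm]
      · rw [h₂ y hy] at hxy
        exact (h₃ k hk _ hxy).elim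
    · rw [h₂ x hx] at hxy
      by_cases hy : ∃ k ∈ l, c k = y
      · obtain ⟨k', hk', rfl⟩ := hy
        rw [h₁ k' hk'] at hxy
        exact (h₃ k' hk' _ hxy.symm).elim
      · rw [h₂ y hy] at hxy
        exact he (by simpa using congrArg Encodable.encode (Term.uri.inj hxy))
  · by_cases hx : ∃ k ∈ l, c k = x
    · obtain ⟨k, hk, rfl⟩ := hx
      rw [h₁ k hk]
      rcases k with u | a
      · exact .inl ⟨u, rfl⟩
      · exact .inr ⟨a, rfl, rfl⟩
    · exact .inl ⟨_, h₂ x hx⟩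

open FirstOrder FirstOrder.Language Filter in
/-- The result of a monotonic query is finitary: each valuation in the result over the union of a
chain of sets of triples is in the result over a member of the chain. Otherwise, a countable
elementary substructure of an ultraproduct of the members of the chain satisfies the negation of
the formula for the query although it contains the union of the chain; renamed to a set of triples
without blank nodes, both give Webs at which monotonicity fails. -/
theorem SparqlExpr.exists_mem_eval_of_monotonic [Denumerable U] [Denumerable B] [Denumerable L]
    [Infinite Doc] {P : SparqlExpr U L V} (hP : (sparqlLD B Doc P).Monotonic)
    {Gs : ℕ → Set (Triple U B L)} (hGs : Monotone Gs) {μ : Valuation U B L V}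
    (hμ : μ ∈ P.eval (⋃ n, Gs n)) : ∃ n, μ ∈ P.eval (Gs n) := by
  by_contra! hn
  obtain ⟨N, _, _, hN⟩ := exists_countable_limit_model Gs
  let c : Term U B L → N := tripleConst N
  have hc : Function.Injective c := fun k k' h => by
    by_contra hk
    exact (realize_neSentence k k').1
      (hN _ (.of_forall fun n => (realize_neSentence k k').2 hk)) h
  -- the formula for the domain of `μ`, and the assignment that `μ` gives
  let S : Finset V := (finite_dom_of_mem_eval hμ).toFinset
  have hS : ∀ v, v ∈ S ↔ μ v ≠ none := fun v => (finite_dom_of_mem_eval hμ).mem_toFinset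
  let a : V → Term U B L := fun v => (μ v).getD (.uri (Denumerable.ofNat U 0))
  have ha : ∀ {D : Type _} (f : Term U B L → D),
      restrictTo S (fun v => f (a v)) = fun v => (μ v).map f := by
    intro D f
    funext v
    cases h : μ v <;> simp [restrictTo, hS, h, a]
  obtain ⟨φ, hφ⟩ := exists_expresses (constTerm : U ⊕ L → Term U B L) P S
  have hrealize : ∀ (M : Type (max u₁ u₂ u₃)) [(tripleLanguage (Term U B L)).Structure M],
      (M ⊨ (BoundedFormula.subst φ fun v => constFOTerm (a v)).not) ↔
        (fun v => (μ v).map (tripleConst M : Term U B L → M)) ∉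
          P.evalIn (fun k => tripleConst M (constTerm k : Term U B L))
            (tripleHolds (Term U B L) M) := by
    intro M _
    rw [← ha, ← hφ, Sentence.Realize, Formula.realize_not, Formula.Realize,
      BoundedFormula.realize_subst, Formula.Realize]
    simp only [realize_constFOTerm]
  have hnot := (hrealize N).1 (hN _ (.of_forall fun n => (hrealize (TermModel (Gs n))).2 (by
    have := hn n
    rw [eval_eq_evalIn] at this
    have e : (fun v => (μ v).map (tripleConst (TermModel (Gs n)) : Term U B L → _)) = μ :=
      funext fun v => Option.map_id'
    rw [e]
    exact this)))
  -- the relation of `N` contains all triples of the chain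
  have hholds : ∀ s p o, tripleRel (⋃ n, Gs n) s p o →
      tripleHolds (Term U B L) N (c s) (c p) (c o) := by
    rintro s p o ⟨t, ht, h⟩
    obtain ⟨n, hn⟩ := Set.mem_iUnion.1 ht
    have key : ∀ (M : Type (max u₁ u₂ u₃)) [(tripleLanguage (Term U B L)).Structure M],
        (M ⊨ (holdsFormula (constFOTerm s) (constFOTerm p) (constFOTerm o) :
          (tripleLanguage (Term U B L)).Sentence)) ↔
        tripleHolds (Term U B L) M (tripleConst M s) (tripleConst M p) (tripleConst M o) := by
      intro M _
      rw [Sentence.Realize, realize_holdsFormula, realize_constFOTerm, realize_constFOTerm,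
        realize_constFOTerm]
    exact (key N).1 (hN _ (eventually_atTop.2 ⟨n, fun m hm =>
      (key (TermModel (Gs m))).2 ⟨t, hGs hm hn, h⟩⟩))
  have hlit : ∀ (l : L) x y, ¬ tripleHolds (Term U B L) N (c (.lit l)) x y ∧
      ¬ tripleHolds (Term U B L) N x (c (.lit l)) y := by
    intro l
    refine (realize_notSubjPredSentence (M := N) (Term.lit l)).1 (hN _ (.of_forall fun n =>
      (realize_notSubjPredSentence (M := TermModel (Gs n)) (Term.lit l)).2 fun x y => ?_))
    constructor
    · rintro ⟨⟨s | s, p, o⟩, -, h, -⟩ <;> cases h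
    · rintro ⟨t, -, -, h, -⟩
      cases h
  -- literals are not subjects or predicates in `N`, so the renaming yields triples
  obtain ⟨σ, hσ, hσc, hσu⟩ := exists_renaming (B := B) (fun k => c (constTerm k))
    (hc.comp (by rintro (k | k) (k' | k') h <;> simp_all [constTerm])) P.constList
  have huri : ∀ s p o, tripleHolds (Term U B L) N s p o →
      (∃ u, σ s = .uri u) ∧ ∃ u, σ p = .uri u := by
    intro s p o h
    constructor
    · rcases hσu s with hs | ⟨l, rfl, -⟩
      · exact hs
      · exact ((hlit l _ _).1 h).elim
    · rcases hσu p with hp | ⟨l, rfl, -⟩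
      · exact hp
      · exact ((hlit l _ _).2 h).elim
  have huri' : ∀ s p o, tripleRel (⋃ n, Gs n) s p o →
      (∃ u, σ (c s) = .uri u) ∧ ∃ u, σ (c p) = .uri u :=
    fun s p o h => huri _ _ _ (hholds s p o h)
  have hb : ∀ t ∈ imageTriples σ (tripleHolds (Term U B L) N), t.bnodes = ∅ := by
    rintro t ⟨s, p, o, h, h₁, -, h₃⟩
    have hne : ∀ x b, σ x ≠ .bnode b := by
      intro x b h
      rcases hσu x with ⟨u, hu⟩ | ⟨l, -, hl⟩ <;> simp_all
    ext b
    simp [Triple.bnodes, h₁, h₃, hne]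
  have hsub : imageTriples (fun k => σ (c k)) (tripleRel (⋃ n, Gs n)) ⊆
      imageTriples σ (tripleHolds (Term U B L) N) := by
    rintro t ⟨s, p, o, h, h'⟩
    exact ⟨_, _, _, hholds s p o h, h'⟩
  have hmem : (fun v => (μ v).map fun k => σ (c k)) ∈
      P.eval (imageTriples (fun k => σ (c k)) (tripleRel (⋃ n, Gs n))) := by
    rw [eval_eq_evalIn, evalIn_map (hσ.comp hc) (σ := fun k => σ (c k))
      (tripleRel_imageTriples huri') fun k hk => (hσc k hk).symm]
    exact ⟨μ, by rwa [eval_eq_evalIn] at hμ, rfl⟩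
  have := eval_subset_of_monotonic hP hb hsub hmem
  rw [eval_eq_evalIn, evalIn_map hσ (tripleRel_imageTriples huri)
    (cst := fun k => c (constTerm k)) fun k hk => (hσc k hk).symm] at this
  obtain ⟨ν, hν, he⟩ := this
  refine hnot ?_
  convert hν using 1
  funext v
  refine Option.map_injective hσ ?_
  rw [Option.map_map]
  exact (congrFun he v).symm

end

/-! ### Evaluation over finite relations is primitive recursive -/

section

open Primrec

variable {U L V D : Type*} {k : ℕ} {v : Fin k → V}

/-- The partial map on `V` that assigns `m i` to the variable `v i`, and nothing to other
variables. -/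
noncomputable def ofSlots (v : Fin k → V) (m : Fin k → Option D) : V → Option D :=
  Function.extend v m fun _ => none

theorem ofSlots_apply (hv : Function.Injective v) (m : Fin k → Option D) (i : Fin k) :
    ofSlots v m (v i) = m i :=
  hv.extend_apply m _ i

theorem ofSlots_of_notMem (m : Fin k → Option D) {x : V} (hx : x ∉ Set.range v) :
    ofSlots v m x = none :=
  Function.extend_apply' _ _ _ hx

theorem ofSlots_injective (hv : Function.Injective v) :
    Function.Injective (ofSlots v : (Fin k → Option D) → V → Option D) :=
  fun m m' h => funext fun i => by rw [← ofSlots_apply hv m i, h, ofSlots_apply hv]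

theorem ofSlots_comp (hv : Function.Injective v) {μ : V → Option D}
    (hμ : ∀ x, μ x ≠ none → x ∈ Set.range v) : ofSlots v (μ ∘ v) = μ := by
  funext x
  by_cases hx : x ∈ Set.range v
  · obtain ⟨i, rfl⟩ := hx
    exact ofSlots_apply hv _ _
  · rw [ofSlots_of_notMem _ hx]
    by_contra h
    exact hx (hμ x (Ne.symm h))

theorem compatibleMaps_ofSlots (hv : Function.Injective v) {m₁ m₂ : Fin k → Option D} :
    CompatibleMaps (ofSlots v m₁) (ofSlots v m₂) ↔ CompatibleMaps m₁ m₂ := by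
  constructor
  · intro h i
    simpa only [ofSlots_apply hv] using h (v i)
  · intro h x hx
    by_cases hr : x ∈ Set.range v
    · obtain ⟨i, rfl⟩ := hr
      simpa only [ofSlots_apply hv] using h i (by rwa [ofSlots_apply hv] at hx)
    · exact (hx (ofSlots_of_notMem _ hr)).elim

theorem or_ofSlots (hv : Function.Injective v) (m₁ m₂ : Fin k → Option D) :
    (fun x => (ofSlots v m₁ x).or (ofSlots v m₂ x)) = ofSlots v fun i => (m₁ i).or (m₂ i) := by
  funext x
  by_cases hr : x ∈ Set.range v
  · obtain ⟨i, rfl⟩ := hr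
    simp only [ofSlots_apply hv]
  · simp only [ofSlots_of_notMem _ hr, Option.or_none]

theorem exists_slots (hv : Function.Injective v) {cst : U ⊕ L → D} {R : D → D → D → Prop}
    {P : SparqlExpr U L V} (hP : ∀ x ∈ P.varList, x ∈ Set.range v) {μ : V → Option D}
    (hμ : μ ∈ P.evalIn cst R) : ∃ m, ofSlots v m = μ :=
  ⟨_, ofSlots_comp hv fun _ hx => hP _ (SparqlExpr.mem_varList_of_mem_evalIn hμ hx)⟩

variable [Primcodable D]

theorem primrec_ofSlots_apply (hv : Function.Injective v) (x : V) :
    Primrec fun m : Fin k → Option D => ofSlots v m x := by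
  by_cases hx : x ∈ Set.range v
  · obtain ⟨i, rfl⟩ := hx
    exact (fin_app.comp .id (.const i)).of_eq fun m => (ofSlots_apply hv m i).symm
  · exact (Primrec.const none).of_eq fun m => (ofSlots_of_notMem m hx).symm

theorem primrecPred_const (α : Type*) [Primcodable α] (p : Prop) : PrimrecPred fun _ : α => p := by
  classical
  exact ⟨fun _ => inferInstance, Primrec.const (decide p)⟩

theorem primrecRel_compatibleMaps :
    PrimrecRel (CompatibleMaps : (Fin k → Option D) → (Fin k → Option D) → Prop) := by
  have app : Primrec₂ fun (i : Fin k) (m : Fin k → Option D) => m i :=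
    fin_app.comp .snd .fst
  have h : PrimrecRel fun (i : Fin k) (p : (Fin k → Option D) × (Fin k → Option D)) =>
      ¬ (¬ p.1 i = none ∧ ¬ p.2 i = none ∧ ¬ p.1 i = p.2 i) := by
    have h₁ : Primrec fun q : Fin k × ((Fin k → Option D) × (Fin k → Option D)) => q.2.1 q.1 :=
      app.comp .fst (Primrec.fst.comp .snd)
    have h₂ : Primrec fun q : Fin k × ((Fin k → Option D) × (Fin k → Option D)) => q.2.2 q.1 :=
      app.comp .fst (Primrec.snd.comp .snd)
    exact PrimrecPred.not (.and (.not (Primrec.eq.comp h₁ (.const none)))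
      (.and (.not (Primrec.eq.comp h₂ (.const none))) (.not (Primrec.eq.comp h₁ h₂))))
  refine PrimrecPred.of_eq (h.forall_mem_list.comp (.const (List.finRange k)) .id) fun p => ?_
  refine ⟨fun h i h₁ h₂ => by_contra fun h₃ => h i (List.mem_finRange i) ⟨h₁, h₂, h₃⟩,
    fun h i _ hi => hi.2.2 (h i hi.1 hi.2.1)⟩

theorem FilterCond.primrecPred_satIn (hv : Function.Injective v) (cst : U ⊕ L → D)
    (C : FilterCond U L V) :
    PrimrecPred fun m : Fin k → Option D => C.SatIn cst (ofSlots v m) := by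
  induction C with
  | eqConst x c => exact Primrec.eq.comp (primrec_ofSlots_apply hv x) (.const (some (cst c)))
  | eqVar x y =>
    have hx := primrec_ofSlots_apply (D := D) hv x
    have hy := primrec_ofSlots_apply (D := D) hv y
    exact .and (.not (Primrec.eq.comp hx (.const none)))
      (.and (.not (Primrec.eq.comp hy (.const none))) (Primrec.eq.comp hx hy))
  | bound x => exact .not (Primrec.eq.comp (primrec_ofSlots_apply hv x) (.const none))
  | neg R ih => exact ih.not
  | and R₁ R₂ ih₁ ih₂ => exact ih₁.and ih₂
  | or R₁ R₂ ih₁ ih₂ => exact ih₁.or ih₂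

/-- Lists of slot assignments, computed from a finite relation by a primitive recursive function,
that make up the result of a SPARQL expression. -/
def IsEvaluator (v : Fin k → V) (cst : U ⊕ L → D) (P : SparqlExpr U L V)
    (ev : List (D × D × D) → List (Fin k → Option D)) : Prop :=
  Primrec ev ∧ ∀ G m, m ∈ ev G ↔ ofSlots v m ∈ P.evalIn cst fun s p o => (s, p, o) ∈ G

theorem exists_evaluator_join (hv : Function.Injective v) {cst : U ⊕ L → D}
    {P₁ P₂ : SparqlExpr U L V} (hP₁ : ∀ x ∈ P₁.varList, x ∈ Set.range v)
    (hP₂ : ∀ x ∈ P₂.varList, x ∈ Set.range v) (h₁ : ∃ ev, IsEvaluator v cst P₁ ev)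
    (h₂ : ∃ ev, IsEvaluator v cst P₂ ev) : ∃ ev, IsEvaluator v cst (.and P₁ P₂) ev := by
  classical
  obtain ⟨ev₁, pr₁, h₁⟩ := h₁
  obtain ⟨ev₂, pr₂, h₂⟩ := h₂
  refine ⟨fun G => (ev₁ G).flatMap fun m₁ => (ev₂ G).filterMap fun m₂ =>
    if CompatibleMaps m₁ m₂ then some fun i => (m₁ i).or (m₂ i) else none, ?_, fun G m => ?_⟩
  · refine list_flatMap pr₁ (listFilterMap (pr₂.comp .fst) (Primrec.ite
      (primrecRel_compatibleMaps.comp (Primrec.snd.comp .fst) .snd) (option_some.comp ?_)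
      (.const none)))
    refine fin_curry.2 ?_
    refine (option_orElse.comp
      (fin_app.comp (Primrec.snd.comp (Primrec.fst.comp .fst)) .snd)
      (fin_app.comp (Primrec.snd.comp .fst) .snd)).of_eq fun p => ?_
    simp only [id]
    cases p.1.1.2 p.2 <;> rfl
  · simp only [List.mem_flatMap, List.mem_filterMap, Option.ite_none_right_eq_some,
      Option.some_inj]
    constructor
    · rintro ⟨m₁, hm₁, m₂, hm₂, hc, rfl⟩
      exact ⟨_, (h₁ G m₁).1 hm₁, _, (h₂ G m₂).1 hm₂, (compatibleMaps_ofSlots hv).2 hc,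
        (or_ofSlots hv m₁ m₂).symm⟩
    · rintro ⟨μ₁, hμ₁, μ₂, hμ₂, hc, he⟩
      obtain ⟨m₁, rfl⟩ := exists_slots hv hP₁ hμ₁
      obtain ⟨m₂, rfl⟩ := exists_slots hv hP₂ hμ₂
      rw [or_ofSlots hv] at he
      exact ⟨m₁, (h₁ G m₁).2 hμ₁, m₂, (h₂ G m₂).2 hμ₂, (compatibleMaps_ofSlots hv).1 hc,
        (ofSlots_injective hv he).symm⟩

theorem exists_evaluator_diff (hv : Function.Injective v) {cst : U ⊕ L → D}
    {P₁ P₂ : SparqlExpr U L V} (hP₂ : ∀ x ∈ P₂.varList, x ∈ Set.range v)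
    (h₁ : ∃ ev, IsEvaluator v cst P₁ ev) (h₂ : ∃ ev, IsEvaluator v cst P₂ ev) :
    ∃ ev : List (D × D × D) → List (Fin k → Option D), Primrec ev ∧ ∀ G m, m ∈ ev G ↔
      ofSlots v m ∈ P₁.evalIn cst (fun s p o => (s, p, o) ∈ G) ∧
      ∀ μ₂ ∈ P₂.evalIn cst (fun s p o => (s, p, o) ∈ G), ¬ CompatibleMaps (ofSlots v m) μ₂ := by
  classical
  obtain ⟨ev₁, pr₁, h₁⟩ := h₁
  obtain ⟨ev₂, pr₂, h₂⟩ := h₂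
  refine ⟨fun G => (ev₁ G).filterMap fun m₁ =>
    if ∃ m₂ ∈ ev₂ G, CompatibleMaps m₁ m₂ then none else some m₁, ?_, fun G m => ?_⟩
  · have : PrimrecRel fun m₂ m₁ : Fin k → Option D => CompatibleMaps m₁ m₂ :=
      primrecRel_compatibleMaps.comp .snd .fst
    exact listFilterMap pr₁ (Primrec.ite (this.exists_mem_list.comp (pr₂.comp .fst) .snd)
      (.const none) (option_some.comp .snd))
  · simp only [List.mem_filterMap, Option.ite_none_left_eq_some, Option.some_inj]
    constructor
    · rintro ⟨m', hm', hc, rfl⟩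
      refine ⟨(h₁ G m').1 hm', fun μ₂ hμ₂ h => ?_⟩
      obtain ⟨m₂, rfl⟩ := exists_slots hv hP₂ hμ₂
      exact hc ⟨m₂, (h₂ G m₂).2 hμ₂, (compatibleMaps_ofSlots hv).1 h⟩
    · rintro ⟨hm, hc⟩
      refine ⟨m, (h₁ G m).2 hm, ?_, rfl⟩
      rintro ⟨m₂, hm₂, h⟩
      exact hc _ ((h₂ G m₂).1 hm₂) ((compatibleMaps_ofSlots hv).2 h)

/-- A triple has at most one matching slot assignment, which is found by matching the components of
the pattern one after the other. -/
theorem exists_evaluator_pattern (hv : Function.Injective v) (cst : U ⊕ L → D)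
    (tp : TriplePattern U L V) (hP : ∀ x ∈ (SparqlExpr.pattern tp).varList, x ∈ Set.range v) :
    ∃ ev, IsEvaluator v cst (.pattern tp) ev := by
  classical
  -- the value of the slot `i` that the triple `t` determines
  let val : D × D × D → Fin k → Option D := fun t i =>
    if tp.subj = .inl (v i) then some t.1 else if tp.pred = .inl (v i) then some t.2.1
    else if tp.obj = .inl (v i) then some t.2.2 else none
  let fits : D × D × D → Prop := fun t =>
    tp.subj.elim (ofSlots v (val t)) (fun u => some (cst (.inl u))) = some t.1 ∧
    tp.pred.elim (ofSlots v (val t)) (fun u => some (cst (.inl u))) = some t.2.1 ∧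
    tp.obj.elim (ofSlots v (val t)) (fun c => some (cst c)) = some t.2.2
  have hval : Primrec val := by
    refine fin_curry.2 ((fin_curry₁ (f := fun i t => val t i)).2 fun i => ?_).swap
    exact .ite (primrecPred_const _ _) (option_some.comp .fst)
      (.ite (primrecPred_const _ _) (option_some.comp (Primrec.fst.comp .snd))
        (.ite (primrecPred_const _ _) (option_some.comp (Primrec.snd.comp .snd)) (.const none)))
  have hfits : PrimrecPred fits := by
    have elim : ∀ {T : Type _} (x : V ⊕ T) (f : T → D),
        Primrec fun t => x.elim (ofSlots v (val t)) (fun u => some (f u)) := by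
      rintro T (x | u) f
      · exact (primrec_ofSlots_apply hv x).comp hval
      · exact .const _
    have elim' : ∀ (x : V ⊕ (U ⊕ L)) (f : U ⊕ L → D),
        Primrec fun t => x.elim (ofSlots v (val t)) (fun u => some (f u)) := by
      rintro (x | u) f
      · exact (primrec_ofSlots_apply hv x).comp hval
      · exact .const _
    exact .and (Primrec.eq.comp (elim tp.subj fun u => cst (.inl u)) (option_some.comp .fst))
      (.and (Primrec.eq.comp (elim tp.pred fun u => cst (.inl u))
          (option_some.comp (Primrec.fst.comp .snd)))
        (Primrec.eq.comp (elim' tp.obj cst) (option_some.comp (Primrec.snd.comp .snd))))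
  refine ⟨fun G => G.filterMap fun t => if fits t then some (val t) else none,
    listFilterMap .id (Primrec.ite (hfits.comp .snd) (option_some.comp (hval.comp .snd))
      (.const none)), fun G m => ?_⟩
  have hvars : ∀ x ∈ tp.vars, ∃ i, v i = x := fun x hx => hP x (TriplePattern.mem_vars_iff.1 hx)
  simp only [List.mem_filterMap, Option.ite_none_right_eq_some, Option.some_inj]
  constructor
  · rintro ⟨t, ht, hf, rfl⟩
    refine ⟨?_, t.1, t.2.1, t.2.2, ht, hf⟩
    ext x
    constructor
    · intro hx
      by_cases hr : x ∈ Set.range v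
      · obtain ⟨i, rfl⟩ := hr
        have hx : val t i ≠ none := by rwa [← ofSlots_apply hv (val t) i]
        by_contra hn
        simp only [TriplePattern.vars, Set.mem_ofPred_eq, not_or] at hn
        exact hx (by simp only [val, if_neg hn.1, if_neg hn.2.1, if_neg hn.2.2])
      · exact (hx (ofSlots_of_notMem _ hr)).elim
    · intro hx
      obtain ⟨i, rfl⟩ := hvars x hx
      rw [Set.mem_ofPred_eq, ofSlots_apply hv]
      simp only [val]
      split_ifs with h₁ h₂ h₃
      · simp
      · simp
      · simp
      · rcases hx with h | h | h <;> contradiction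
  · rintro ⟨hd, s, p, o, ht, h⟩
    have : val (s, p, o) = m := by
      funext i
      simp only [val]
      split_ifs with h₁ h₂ h₃
      · rw [h₁, Sum.elim_inl, ofSlots_apply hv] at h
        exact h.1.symm
      · rw [h₂, Sum.elim_inl, ofSlots_apply hv] at h
        exact h.2.1.symm
      · rw [h₃, Sum.elim_inl, ofSlots_apply hv] at h
        exact h.2.2.symm
      · by_contra hn
        have hi : v i ∈ {x | ofSlots v m x ≠ none} := by
          rw [Set.mem_ofPred_eq, ofSlots_apply hv]
          exact Ne.symm hn
        rw [hd] at hi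
        rcases hi with h | h | h <;> contradiction
    exact ⟨_, ht, by simpa only [fits, this] using h, this⟩

theorem exists_evaluator (hv : Function.Injective v) (cst : U ⊕ L → D) (P : SparqlExpr U L V)
    (hP : ∀ x ∈ P.varList, x ∈ Set.range v) : ∃ ev, IsEvaluator v cst P ev := by
  classical
  induction P with
  | pattern tp => exact exists_evaluator_pattern hv cst tp hP
  | and P₁ P₂ ih₁ ih₂ =>
    have hP₁ := fun x hx => hP x (List.mem_append_left _ hx)
    have hP₂ := fun x hx => hP x (List.mem_append_right _ hx)
    exact exists_evaluator_join hv hP₁ hP₂ (ih₁ hP₁) (ih₂ hP₂)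
  | union P₁ P₂ ih₁ ih₂ =>
    obtain ⟨ev₁, pr₁, h₁⟩ := ih₁ fun x hx => hP x (List.mem_append_left _ hx)
    obtain ⟨ev₂, pr₂, h₂⟩ := ih₂ fun x hx => hP x (List.mem_append_right _ hx)
    refine ⟨fun G => ev₁ G ++ ev₂ G, list_append.comp pr₁ pr₂, fun G m => ?_⟩
    rw [List.mem_append, h₁, h₂]
    rfl
  | opt P₁ P₂ ih₁ ih₂ =>
    have hP₁ := fun x hx => hP x (List.mem_append_left _ hx)
    have hP₂ := fun x hx => hP x (List.mem_append_right _ hx)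
    obtain ⟨ev₁, pr₁, h₁⟩ := exists_evaluator_join hv hP₁ hP₂ (ih₁ hP₁) (ih₂ hP₂)
    obtain ⟨ev₂, pr₂, h₂⟩ := exists_evaluator_diff hv hP₂ (ih₁ hP₁) (ih₂ hP₂)
    refine ⟨fun G => ev₁ G ++ ev₂ G, list_append.comp pr₁ pr₂, fun G m => ?_⟩
    rw [List.mem_append, h₁, h₂]
    rfl
  | filter P C ih =>
    obtain ⟨ev, pr, h⟩ := ih hP
    refine ⟨fun G => (ev G).filter fun m => C.SatIn cst (ofSlots v m),
      (listFilter (FilterCond.primrecPred_satIn hv cst C)).comp pr, fun G m => ?_⟩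
    rw [List.mem_filter, h, decide_eq_true_iff]
    rfl

end

/-! ### Evaluation on encodings -/

section

open Primrec

instance Sym.instFinite : Finite Sym :=
  Finite.of_surjective (fun i : Fin 13 => match i with
    | 0 => Sym.zero | 1 => .one | 2 => .uriMark | 3 => .bnodeMark | 4 => .litMark | 5 => .varMark
    | 6 => .sharp | 7 => .langle | 8 => .rangle | 9 => .llangle | 10 => .rrangle | 11 => .comma
    | 12 => .arrow)
    (by
      rintro (_ | _)
      exacts [⟨0, rfl⟩, ⟨1, rfl⟩, ⟨2, rfl⟩, ⟨3, rfl⟩, ⟨4, rfl⟩, ⟨5, rfl⟩, ⟨6, rfl⟩, ⟨7, rfl⟩,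
        ⟨8, rfl⟩, ⟨9, rfl⟩, ⟨10, rfl⟩, ⟨11, rfl⟩, ⟨12, rfl⟩])

/-- Some numbering of the symbols; since there are finitely many, all of them are equivalent. -/
noncomputable instance Sym.instPrimcodable : Primcodable Sym :=
  Primcodable.ofEquiv (Fin (Nat.card Sym)) (Finite.equivFin Sym)

theorem primrec_commaSep : Primrec commaSep := by
  refine (list_casesOn (f := fun l : List (List Sym) => l) (g := fun _ => ([] : List Sym))
    (h := fun _ p => p.1 ++ p.2.flatMap (Sym.comma :: ·)) .id (.const [])
    (list_append.comp (Primrec.fst.comp .snd) (list_flatMap (Primrec.snd.comp .snd)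
      (list_cons.comp (.const _) .snd)))).of_eq fun l => ?_
  cases l with
  | nil => rfl
  | cons x l => exact (commaSep_cons x l).symm

variable {U B L V : Type*} [Denumerable U] [Denumerable B] [Denumerable L] [Denumerable V]
  {k : ℕ} {v : Fin k → V}

/-- The encoding of a valuation that is given by the codes of the values of the variables. -/
def formatSlots (v : Fin k → V) (m : Fin k → Option (List Sym)) : List Sym :=
  Sym.llangle :: (commaSep ((List.finRange k).filterMap fun i =>
    (m i).map fun w => encVar (v i) ++ [Sym.arrow] ++ w) ++ [Sym.rrangle])

theorem primrec_formatSlots (v : Fin k → V) : Primrec (formatSlots v) := by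
  refine list_cons.comp (.const _) (list_append.comp (primrec_commaSep.comp
    (listFilterMap (.const _) (option_map (fin_app.comp .fst .snd) ?_))) (.const _))
  exact list_append.comp (list_append.comp ((Primrec.dom_finite fun i => encVar (v i)).comp
    (Primrec.snd.comp .fst)) (.const _)) .snd

theorem formatSlots_eq (hv : StrictMono fun i => Encodable.encode (v i))
    {m : Fin k → Option (List Sym)} {μ : Valuation U B L V}
    (h : ofSlots v m = fun x => (μ x).map encTerm) : formatSlots v m = encValuation μ := by
  have hinj : Function.Injective v := fun i j hij => hv.injective (congrArg Encodable.encode hij)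
  have hm : ∀ i, m i = (μ (v i)).map encTerm := fun i => by
    rw [← ofSlots_apply hinj m i, h]
  have hdom : ∀ x, x ∈ Valuation.dom μ → x ∈ Set.range v := fun x hx => by
    by_contra hr
    have := congrFun h x
    rw [ofSlots_of_notMem _ hr] at this
    exact hx (Option.map_eq_none_iff.1 this.symm)
  have hfin : (Valuation.dom μ).Finite := (Set.finite_range v).subset hdom
  have hsort : (hfin.toFinset.image Encodable.encode).sort (· ≤ ·) =
      ((List.finRange k).filter fun i => (μ (v i)).isSome).map fun i => Encodable.encode (v i) := by
    have hs : (((List.finRange k).filter fun i => (μ (v i)).isSome).map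
        fun i => Encodable.encode (v i)).Pairwise (· < ·) :=
      List.pairwise_map.2 (((List.pairwise_lt_finRange k).filter _).imp fun h => hv h)
    rw [← (List.toFinset_sort (· ≤ ·) (hs.imp fun h => h.ne)).2 (hs.imp fun h => h.le)]
    congr 1
    ext n
    simp only [Finset.mem_image, Set.Finite.mem_toFinset, List.mem_toFinset, List.mem_map,
      List.mem_filter, List.mem_finRange, true_and]
    constructor
    · rintro ⟨x, hx, rfl⟩
      obtain ⟨i, rfl⟩ := hdom x hx
      exact ⟨i, Option.isSome_iff_ne_none.2 hx, rfl⟩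
    · rintro ⟨i, hi, rfl⟩
      exact ⟨v i, Option.isSome_iff_ne_none.1 hi, rfl⟩
  rw [encValuation, dif_pos hfin, hsort, formatSlots, List.map_map]
  simp only [List.cons_append, List.nil_append, List.append_assoc]
  congr 3
  induction List.finRange k with
  | nil => rfl
  | cons i l ih =>
    rw [List.filterMap_cons, List.filter_cons, hm]
    cases hi : μ (v i) with
    | none => simpa using ih
    | some t => simpa [hi] using ih

/-- A triple, as a triple of words. -/
def Triple.words (t : Triple U B L) : List Sym × List Sym × List Sym :=
  (encTerm t.subjTerm, encUri t.pred, encTerm t.obj)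

/-- The codes of the results of a SPARQL expression can be computed from the codes of finitely
many triples. -/
theorem SparqlExpr.exists_primrec_eval (P : SparqlExpr U L V) :
    ∃ ev : List (List Sym × List Sym × List Sym) → List (List Sym), Primrec ev ∧
      ∀ G (T : Set (Triple U B L)), (∀ w, w ∈ G ↔ ∃ t ∈ T, t.words = w) →
        ∀ w, w ∈ ev G ↔ ∃ μ ∈ P.eval T, encValuation μ = w := by
  classical
  let S : Finset ℕ := (P.varList.map Encodable.encode).toFinset
  let v : Fin S.card → V := fun i => Denumerable.ofNat V (S.orderEmbOfFin rfl i)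
  have hv : StrictMono fun i => Encodable.encode (v i) := fun i j hij => by
    simpa [v] using hij
  have hinj : Function.Injective v := fun i j hij => hv.injective (congrArg Encodable.encode hij)
  have hP : ∀ x ∈ P.varList, x ∈ Set.range v := by
    intro x hx
    have : Encodable.encode x ∈ Set.range (S.orderEmbOfFin rfl) := by
      rw [Finset.range_orderEmbOfFin]
      simpa [S] using hx
    obtain ⟨i, hi⟩ := this
    exact ⟨i, by simp [v, hi]⟩
  obtain ⟨ev, pr, h⟩ := exists_evaluator hinj
    (fun c => encTerm (constTerm c : Term U B L)) P hP
  refine ⟨fun G => (ev G).map (formatSlots v), list_map pr ((primrec_formatSlots v).comp .snd),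
    fun G T hG w => ?_⟩
  have hmap := SparqlExpr.evalIn_map (encTerm_injective (U := U) (B := B) (L := L))
    (R := tripleRel T) (R' := fun s p o => (s, p, o) ∈ G) (fun s p o => by
      rw [hG]
      constructor
      · rintro ⟨t, ht, he⟩
        simp only [Triple.words, Prod.mk.injEq] at he
        obtain ⟨rfl, rfl, rfl⟩ := he
        exact ⟨_, _, _, ⟨t, ht, rfl, rfl, rfl⟩, rfl, rfl, rfl⟩
      · rintro ⟨_, _, _, ⟨t, ht, rfl, rfl, rfl⟩, rfl, rfl, rfl⟩
        exact ⟨t, ht, rfl⟩) (P := P) (cst := constTerm)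
    (cst' := fun c => encTerm (constTerm c : Term U B L)) fun _ _ => rfl
  rw [← eval_eq_evalIn] at hmap
  simp only [List.mem_map, h, hmap, Set.mem_image]
  constructor
  · rintro ⟨m, ⟨μ, hμ, he⟩, rfl⟩
    exact ⟨μ, hμ, (formatSlots_eq hv he.symm).symm⟩
  · rintro ⟨μ, hμ, rfl⟩
    have : ofSlots v ((fun x => (μ x).map encTerm) ∘ v) = fun x => (μ x).map encTerm :=
      ofSlots_comp hinj fun x hx => hP x (mem_varList_of_mem_eval hμ fun h => hx (by simp [h]))
    exact ⟨_, ⟨μ, hμ, this.symm⟩, formatSlots_eq hv this⟩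

end

/-! ### Prefixes of possible encodings -/

section

variable {U B L V : Type*} [Denumerable U] [Denumerable B] [Denumerable L] [Denumerable V]

/-- Each enumeration of finitely many members of a set can be continued to one of the whole set. -/
theorem exists_isEncodingOf_of_nodup {Ω : Set (Valuation U B L V)}
    (hΩ : ∀ μ ∈ Ω, (Valuation.dom μ).Finite) {l : List (Valuation U B L V)} (hl : l.Nodup)
    (hlΩ : ∀ μ ∈ l, μ ∈ Ω) : ∃ x, IsEncodingOf x Ω ∧ IsPrefixOf (l.flatMap encValuation) x := by
  classical
  have : Countable Sym := Finite.to_countable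
  have : Countable {μ // μ ∈ Ω ∧ μ ∉ l} := Function.Injective.countable
    (f := fun μ => encValuation μ.1) fun μ ν h =>
      Subtype.ext (encValuation_injOn (hΩ _ μ.2.1) (hΩ _ ν.2.1) h)
  have := Encodable.ofCountable {μ // μ ∈ Ω ∧ μ ∉ l}
  let e : ℕ → Option (Valuation U B L V) := fun n =>
    if n < l.length then l[n]? else
      (Encodable.decode₂ {μ // μ ∈ Ω ∧ μ ∉ l} (n - l.length)).map Subtype.val
  have e_lt : ∀ {n}, n < l.length → e n = l[n]? := fun h => if_pos h
  have e_ge : ∀ {n}, ¬ n < l.length → ∀ {μ}, e n = some μ ↔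
      ∃ h : μ ∈ Ω ∧ μ ∉ l, Encodable.encode (⟨μ, h⟩ : {μ // μ ∈ Ω ∧ μ ∉ l}) = n - l.length := by
    intro n hn μ
    simp only [e, if_neg hn, Option.map_eq_some_iff, Encodable.decode₂_eq_some]
    constructor
    · rintro ⟨⟨μ, h⟩, he, rfl⟩
      exact ⟨h, he⟩
    · rintro ⟨h, he⟩
      exact ⟨⟨μ, h⟩, he, rfl⟩
  refine ⟨_, ⟨hΩ, e, fun μ => ⟨fun hμ => ?_, ?_⟩, fun m n μ hm hn => ?_, rfl⟩,
    isPrefixOf_concatWord.2 ⟨l.length, ?_⟩⟩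
  · by_cases hml : μ ∈ l
    · obtain ⟨n, hn, rfl⟩ := List.getElem_of_mem hml
      exact ⟨n, by rw [e_lt hn, List.getElem?_eq_getElem hn]⟩
    · exact ⟨l.length + Encodable.encode (⟨μ, hμ, hml⟩ : {μ // μ ∈ Ω ∧ μ ∉ l}),
        (e_ge (by simp)).2 ⟨⟨hμ, hml⟩, by simp⟩⟩
  · rintro ⟨n, hn⟩
    by_cases h : n < l.length
    · rw [e_lt h] at hn
      exact hlΩ _ (List.mem_of_getElem? hn)
    · exact ((e_ge h).1 hn).1.1
  · by_cases h : m < l.length <;> by_cases h' : n < l.length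
    · rw [e_lt h] at hm
      rw [e_lt h'] at hn
      exact (hl.getElem_inj_iff (hi := h) (hj := h')).1 (by
        rw [List.getElem?_eq_getElem h] at hm
        rw [List.getElem?_eq_getElem h'] at hn
        exact (Option.some_inj.1 hm).trans (Option.some_inj.1 hn).symm)
    · rw [e_lt h] at hm
      exact (((e_ge h').1 hn).1.2 (List.mem_of_getElem? hm)).elim
    · rw [e_lt h'] at hn
      exact (((e_ge h).1 hm).1.2 (List.mem_of_getElem? hn)).elim
    · obtain ⟨_, h₁⟩ := (e_ge h).1 hm
      obtain ⟨_, h₂⟩ := (e_ge h').1 hn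
      omega
  · have : ((List.range l.length).map fun n => (e n).elim [] encValuation) =
        l.map encValuation := by
      refine List.ext_getElem (by simp) fun n h _ => ?_
      have hn : n < l.length := by simpa using h
      simp [e_lt hn, List.getElem?_eq_getElem hn]
    rw [List.flatMap_def, List.flatMap_def, this]

end

/-! ### The program for a monotonic query -/

section

open Primrec

/-- What remains to be done in a round: to append a symbol to the output (first summand), to put a
symbol onto the link traversal tape (second summand), to call the expand procedure (`true`), or to
read its answer (`false`). -/
abbrev Act : Type := Sym ⊕ Sym ⊕ Bool

/-- The state of the program: the remaining actions of the round; the number of the round and the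
codes of the valuations that have been output; the registers of the parser and the triples that
have been read. -/
abbrev SearchState : Type :=
  List Act × (ℕ × List (List Sym)) ×
    ((List Sym × List Sym × List Sym) × List (List Sym × List Sym × List Sym))

/-- The nodes of the program. -/
inductive SearchNode where
  | round
  | pop
  | test (i : Fin (Nat.card Act))
  | parse (s : Sym)

instance SearchNode.instFinite : Finite SearchNode :=
  Finite.of_surjective
    (fun x : (Unit ⊕ Unit) ⊕ Fin (Nat.card Act) ⊕ Sym => match x with
      | .inl (.inl _) => .round
      | .inl (.inr _) => .pop
      | .inr (.inl i) => .test i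
      | .inr (.inr s) => .parse s)
    (by
      rintro (_ | _ | i | s)
      exacts [⟨.inl (.inl ()), rfl⟩, ⟨.inl (.inr ()), rfl⟩, ⟨.inr (.inl i), rfl⟩,
        ⟨.inr (.inr s), rfl⟩])

/-- The parser keeps the last two names and the name that it is reading; at the end of a triple,
these are its components. -/
def parseSym (s : Sym)
    (x : (List Sym × List Sym × List Sym) × List (List Sym × List Sym × List Sym)) :
    (List Sym × List Sym × List Sym) × List (List Sym × List Sym × List Sym) :=
  match s with
  | .langle => ((x.1.1, x.1.2.1, []), x.2)
  | .comma => ((x.1.2.1, x.1.2.2, []), x.2)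
  | .rangle => (x.1, x.2 ++ [x.1])
  | .zero | .one | .uriMark | .bnodeMark | .litMark | .varMark =>
    ((x.1.1, x.1.2.1, x.1.2.2 ++ [s]), x.2)
  | _ => x

theorem primrec_parseSym (s : Sym) : Primrec (parseSym s) := by
  have r₁ : Primrec fun x : (List Sym × List Sym × List Sym) ×
      List (List Sym × List Sym × List Sym) => x.1.1 := Primrec.fst.comp .fst
  have r₂ : Primrec fun x : (List Sym × List Sym × List Sym) ×
      List (List Sym × List Sym × List Sym) => x.1.2.1 := Primrec.fst.comp (Primrec.snd.comp .fst)
  have r₃ : Primrec fun x : (List Sym × List Sym × List Sym) ×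
      List (List Sym × List Sym × List Sym) => x.1.2.2 := Primrec.snd.comp (Primrec.snd.comp .fst)
  have name : Primrec fun x : (List Sym × List Sym × List Sym) ×
      List (List Sym × List Sym × List Sym) => ((x.1.1, x.1.2.1, x.1.2.2 ++ [s]), x.2) :=
    ((r₁.pair (r₂.pair (list_append.comp r₃ (.const [s])))).pair .snd)
  cases s
  case langle => exact (r₁.pair (r₂.pair (.const []))).pair .snd
  case comma => exact (r₂.pair (r₃.pair (.const []))).pair .snd
  case rangle => exact Primrec.fst.pair (list_append.comp .snd (list_cons.comp .fst (.const [])))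
  case zero | one | uriMark | bnodeMark | litMark | varMark => exact name
  all_goals exact .id

/-- The name that is looked up in round `n`. All words of binary digits occur, so all URIs are
looked up; a word that does not encode a URI is answered like one without a document. -/
def lookupWord (n : ℕ) : List Sym :=
  Sym.uriMark :: ((Encodable.decode (α := List Bool) n).getD []).map
    fun b => if b then Sym.one else Sym.zero

theorem primrec_lookupWord : Primrec lookupWord :=
  list_cons.comp (.const _) (list_map (option_getD.comp .decode (.const []))
    ((Primrec.dom_finite fun b : Bool => if b then Sym.one else Sym.zero).comp .snd))

theorem exists_lookupWord_eq {U : Type*} [Denumerable U] (u : U) : ∃ n, lookupWord n = encUri u :=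
  ⟨Encodable.encode (Encodable.encode u).bits, by simp [lookupWord, encUri, binary]⟩

theorem uriMark_notMem_tail_lookupWord (n : ℕ) : Sym.uriMark ∉ (lookupWord n).tail := by
  intro h
  obtain ⟨b, -, hb⟩ := List.mem_map.1 h
  cases b <;> cases hb

open Classical in
/-- The members of the list `l` that are not in `done`, each once. -/
noncomputable def newWords (l done : List (List Sym)) : List (List Sym) :=
  l.filter (fun w => w ∉ done) ∪ []

theorem mem_newWords {l done : List (List Sym)} {w : List Sym} :
    w ∈ newWords l done ↔ w ∈ l ∧ w ∉ done := by
  simp [newWords]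

theorem nodup_newWords (l done : List (List Sym)) : (newWords l done).Nodup :=
  List.Nodup.union _ List.nodup_nil

theorem primrec_newWords : Primrec₂ newWords := by
  classical
  have mem : PrimrecRel fun (w : List Sym) (l : List (List Sym)) => w ∈ l :=
    PrimrecPred.of_eq ((Primrec.eq (α := List Sym)).exists_mem_list.comp .snd .fst)
      fun p => by simp
  have filter : Primrec₂ fun l done : List (List Sym) => l.filter fun w => w ∉ done :=
    PrimrecRel.listFilter (R := fun w done => w ∉ done) mem.not
  refine (list_foldr (h := fun _ (p : List Sym × List (List Sym)) =>
    if p.1 ∈ p.2 then p.2 else p.1 :: p.2) filter (.const []) ?_).of_eq fun p => ?_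
  · exact .ite (mem.comp (Primrec.fst.comp .snd) (Primrec.snd.comp .snd))
      (Primrec.snd.comp .snd) (list_cons.comp (Primrec.fst.comp .snd) (Primrec.snd.comp .snd))
  · change _ = List.union _ _
    rw [List.union]
    congr 1
    funext w l
    rw [List.insert]
    simp

/-- The actions of round `n`, in which the word `w` is output. -/
def roundActs (w : List Sym) (n : ℕ) : List Act :=
  w.map Sum.inl ++ ((lookupWord n).map (fun s => .inr (.inl s)) ++
    [.inr (.inr true), .inr (.inr false)])

/-- The start of a round: the query is evaluated over the triples that have been read. -/
noncomputable def startRound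
    (ev : List (List Sym × List Sym × List Sym) → List (List Sym)) (x : SearchState) :
    SearchState :=
  (roundActs (newWords (ev x.2.2.2) x.2.1.2).flatten x.2.1.1,
    (x.2.1.1 + 1, x.2.1.2 ++ newWords (ev x.2.2.2) x.2.1.2), x.2.2)

theorem primrec_startRound {ev : List (List Sym × List Sym × List Sym) → List (List Sym)}
    (hev : Primrec ev) : Primrec (startRound ev) := by
  have number : Primrec fun x : SearchState => x.2.1.1 :=
    Primrec.fst.comp (Primrec.fst.comp .snd)
  have done : Primrec fun x : SearchState => x.2.1.2 :=
    Primrec.snd.comp (Primrec.fst.comp .snd)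
  have new : Primrec fun x : SearchState => newWords (ev x.2.2.2) x.2.1.2 :=
    primrec_newWords.comp (hev.comp (Primrec.snd.comp (Primrec.snd.comp .snd))) done
  refine .pair (list_append.comp (list_map (list_flatten.comp new) ?_)
    (list_append.comp (list_map (primrec_lookupWord.comp number) ?_) (.const _)))
    (.pair (.pair (succ.comp number) (list_append.comp done new)) (Primrec.snd.comp .snd))
  · exact (Primrec.dom_finite (Sum.inl : Sym → Act)).comp .snd
  · exact (Primrec.dom_finite (fun s : Sym => (.inr (.inl s) : Act))).comp .snd

/-- Where the program goes after it has read a symbol of the answer. -/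
def readNext : Option Sym → SearchNode
  | some .sharp => .round
  | some s => .parse s
  | none => .round

/-- How an action is performed. -/
def performAct : Act → Command SearchNode
  | .inl s => .print s .pop
  | .inr (.inl s) => .put s .pop
  | .inr (.inr true) => .expand
  | .inr (.inr false) => .get readNext

/-- The first of the nodes at which the next action is identified. -/
noncomputable def firstTest : SearchNode := .test ⟨0, Nat.card_pos⟩

/-- In each round, the program outputs the codes of the new results of the evaluation of a query
over the triples that have been read, looks up the next name, and reads the answer. -/
noncomputable def searchProgram
    {ev : List (List Sym × List Sym × List Sym) → List (List Sym)} (hev : Primrec ev) :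
    Program SearchState where
  Node := SearchNode
  start := .round
  resume := .pop
  upd
    | .round => startRound ev
    | .pop => fun x => (x.1.tail, x.2)
    | .test _ => id
    | .parse s => fun x => (x.1, x.2.1, parseSym s x.2.2)
  test
    | .test i => fun x => decide (x.1.head? = some ((Finite.equivFin Act).symm i))
    | _ => fun _ => true
  computable_upd
    | .round => (primrec_startRound hev).to_comp
    | .pop => Primrec.to_comp ((list_tail.comp .fst).pair .snd)
    | .test _ => Computable.id
    | .parse s => Primrec.to_comp (Primrec.fst.pair ((Primrec.fst.comp .snd).pair
        ((primrec_parseSym s).comp (Primrec.snd.comp .snd))))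
  computable_test
    | .round => Computable.const true
    | .pop => Computable.const true
    | .test _ => Primrec.to_comp ((Primrec.eq.comp (list_head?.comp .fst) (.const _)).decide)
    | .parse _ => Computable.const true
  cmd
    | .test i => fun b =>
      if b then performAct ((Finite.equivFin Act).symm i)
      else if h : i + 1 < Nat.card Act then .goto (.test ⟨i + 1, h⟩) else .goto .round
    | _ => fun _ => .goto firstTest

end

/-! ### Runs of the program -/

section

open Relation

variable {U B L : Type*} [Denumerable U] [Denumerable B] [Denumerable L]
  {ev : List (List Sym × List Sym × List Sym) → List (List Sym)} {hev : Primrec ev} {web : InfWord}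
  {x : SearchState} {w o : List Sym} {h : ℕ} {l : List Act}

/-- The next action is found among the finitely many ones. -/
theorem searchProgram_findAct {a : Act} (hx : x.1.head? = some a) :
    ReflTransGen ((searchProgram hev).Step U B L web) ⟨firstTest, x, w, h, o⟩
      ⟨.test (Finite.equivFin Act a), x, w, h, o⟩ := by
  have : ∀ j (hj : j < Nat.card Act), j ≤ Finite.equivFin Act a →
      ReflTransGen ((searchProgram hev).Step U B L web) ⟨firstTest, x, w, h, o⟩
        ⟨.test ⟨j, hj⟩, x, w, h, o⟩ := by
    intro j
    induction j with
    | zero => exact fun _ _ => .refl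
    | succ j ih =>
      intro hj hja
      refine (ih (Nat.lt_of_succ_lt hj) (Nat.le_of_succ_le hja)).tail ?_
      refine Program.Step.goto (p := searchProgram hev) ?_
      have : (Finite.equivFin Act).symm ⟨j, Nat.lt_of_succ_lt hj⟩ ≠ a := by
        intro he
        rw [← he, Equiv.apply_symm_apply] at hja
        exact absurd hja (by simp)
      simp only [searchProgram, hx, Option.some_inj, this.symm, decide_false, Bool.false_eq_true,
        if_false, dif_pos hj]
  exact this _ _ le_rfl

/-- The command of the next action is executed. -/
theorem searchProgram_cmd {a : Act} (hx : x.1.head? = some a) :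
    (searchProgram hev).cmd (.test (Finite.equivFin Act a))
      ((searchProgram hev).test (.test (Finite.equivFin Act a)) x) = performAct a := by
  simp [searchProgram, hx]

theorem searchProgram_pop :
    (searchProgram hev).Step U B L web ⟨.pop, x, w, h, o⟩ ⟨firstTest, (x.1.tail, x.2), w, h, o⟩ :=
  Program.Step.goto (p := searchProgram hev) rfl

theorem searchProgram_print {s : Sym} :
    ReflTransGen ((searchProgram hev).Step U B L web) ⟨firstTest, (.inl s :: l, x.2), w, h, o⟩
      ⟨firstTest, (l, x.2), w, h, o ++ [s]⟩ :=
  ((searchProgram_findAct rfl).tail (Program.Step.print (p := searchProgram hev)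
    (searchProgram_cmd rfl))).tail searchProgram_pop

theorem searchProgram_printList {s : List Sym} :
    ReflTransGen ((searchProgram hev).Step U B L web)
      ⟨firstTest, (s.map Sum.inl ++ l, x.2), w, h, o⟩
      ⟨firstTest, (l, x.2), w, h, o ++ s⟩ := by
  induction s generalizing o with
  | nil =>
    rw [List.append_nil]
    exact .refl
  | cons a s ih =>
    refine searchProgram_print.trans ?_
    have := ih (o := o ++ [a])
    rwa [List.append_assoc] at this

theorem searchProgram_put {s : Sym} :
    ReflTransGen ((searchProgram hev).Step U B L web)
      ⟨firstTest, (.inr (.inl s) :: l, x.2), w, w.length, o⟩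
      ⟨firstTest, (l, x.2), w ++ [s], (w ++ [s]).length, o⟩ := by
  rw [List.length_append]
  exact ((searchProgram_findAct rfl).tail (Program.Step.put (p := searchProgram hev)
    (searchProgram_cmd rfl) rfl)).tail searchProgram_pop

theorem searchProgram_putList {s : List Sym} :
    ReflTransGen ((searchProgram hev).Step U B L web)
      ⟨firstTest, (s.map (fun s => .inr (.inl s)) ++ l, x.2), w, w.length, o⟩
      ⟨firstTest, (l, x.2), w ++ s, (w ++ s).length, o⟩ := by
  induction s generalizing w with
  | nil =>
    rw [List.append_nil]
    exact .refl
  | cons a s ih =>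
    refine searchProgram_put.trans ?_
    have := ih (w := w ++ [a])
    rwa [List.append_assoc] at this

theorem searchProgram_expand :
    ReflTransGen ((searchProgram hev).Step U B L web)
      ⟨firstTest, (.inr (.inr true) :: l, x.2), w, h, o⟩
      ⟨firstTest, (l, x.2), w ++ LDMachine.expandAnswer U B L (A := Empty) web
          (w.map fun s => some (Sum.inl s)), h, o⟩ :=
  ((searchProgram_findAct rfl).tail (Program.Step.expand (p := searchProgram hev)
    (searchProgram_cmd rfl))).tail searchProgram_pop

theorem searchProgram_get {a : Sym} {r : List Sym} :
    ReflTransGen ((searchProgram hev).Step U B L web)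
      ⟨firstTest, (.inr (.inr false) :: l, x.2), w ++ a :: r, w.length, o⟩
      ⟨readNext (some a), (.inr (.inr false) :: l, x.2), w ++ a :: r, w.length + 1, o⟩ := by
  have := Program.Step.get (U := U) (B := B) (L := L) (web := web) (p := searchProgram hev)
    (x := (.inr (.inr false) :: l, x.2)) (w := w ++ a :: r) (h := w.length) (o := o)
    (f := readNext) (searchProgram_cmd (a := .inr (.inr false)) rfl) (by simp)
  rw [List.getElem_append_right le_rfl] at this
  simp only [Nat.sub_self, List.getElem_cons_zero] at this
  exact (searchProgram_findAct rfl).tail this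

/-- The answer `s` of the expand procedure is read up to the delimiter `♯`. -/
theorem searchProgram_read {s : List Sym} (hs : Sym.sharp ∉ s) :
    ReflTransGen ((searchProgram hev).Step U B L web)
      ⟨firstTest, (.inr (.inr false) :: l, x.2), w ++ (s ++ [Sym.sharp]), w.length, o⟩
      ⟨.round, (.inr (.inr false) :: l, x.2.1, s.foldl (fun y a => parseSym a y) x.2.2),
        w ++ (s ++ [Sym.sharp]), (w ++ (s ++ [Sym.sharp])).length, o⟩ := by
  induction s generalizing w x with
  | nil =>
    rw [List.length_append]
    exact searchProgram_get
  | cons a s ih =>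
    rw [List.mem_cons, not_or] at hs
    refine searchProgram_get.trans ?_
    have e : readNext (some a) = .parse a := by
      cases a <;> first | rfl | exact (hs.1 rfl).elim
    rw [e]
    refine .head (Program.Step.goto (p := searchProgram hev) (m := firstTest) rfl) ?_
    have := ih (w := w ++ [a]) (x := (x.1, x.2.1, parseSym a x.2.2)) hs.2
    rw [List.append_assoc w [a], List.length_append (as := w) (bs := [a])] at this
    exact this

end

/-! ### The answer of the expand procedure -/

section

variable {U B L V Doc : Type*} [Denumerable U] [Denumerable B] [Denumerable L] [Denumerable V]

theorem eq_of_cons_suffix {α : Type*} {a : α} {x y p : List α} (h : a :: x <:+ p ++ a :: y)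
    (hx : a ∉ x) (hy : a ∉ y) : x = y := by
  rcases List.suffix_or_suffix_of_suffix h (List.suffix_append p (a :: y)) with h | h <;>
    rcases List.suffix_cons_iff.1 h with h | h
  · exact (List.cons.inj h).2
  · exact (hy (h.subset List.mem_cons_self)).elim
  · exact (List.cons.inj h).2.symm
  · exact (hx (h.subset List.mem_cons_self)).elim

theorem uriMark_notMem_binary (n : ℕ) : Sym.uriMark ∉ binary n := by
  intro h
  obtain ⟨b, -, hb⟩ := List.mem_map.1 h
  cases b <;> cases hb

/-- The triples that are found in round `n`. -/
def foundTriples (W : Web U B L Doc) (n : ℕ) : Set (Triple U B L) :=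
  {t | ∃ u d, encUri u = lookupWord n ∧ W.adoc u = some d ∧ t ∈ W.data d}

/-- The answer that the expand procedure gives in round `n`. Since a mark begins the name, no other
URI is looked up than the one that `lookupWord n` encodes, if there is one. -/
theorem expandAnswer_lookupWord (W : Web U B L Doc) (w : List Sym) (n : ℕ) :
    ∃ s, LDMachine.expandAnswer U B L (A := Empty) W.enc
        ((w ++ lookupWord n).map fun s => some (Sum.inl s)) = s ++ [Sym.sharp] ∧
      (s = [] ∧ foundTriples W n = ∅ ∨
        ∃ T : Finset (Triple U B L), s = encTriples T ∧ foundTriples W n = T) := by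
  have hinj : Function.Injective fun s : Sym => (some (Sum.inl s) : Option (Sym ⊕ Empty)) :=
    fun s s' h => Sum.inl_injective (Option.some_injective _ h)
  have huniq : ∀ u : U, (encUri u).map (fun s => (some (Sum.inl s) : Option (Sym ⊕ Empty))) <:+
      (w ++ lookupWord n).map (fun s => some (Sum.inl s)) → encUri u = lookupWord n := by
    intro u hu
    obtain ⟨q, hq⟩ := hu
    obtain ⟨q', y, he, -, hy⟩ := List.map_eq_append_iff.1 hq.symm
    obtain rfl := List.map_injective_iff.2 hinj hy
    exact congrArg (Sym.uriMark :: ·) (eq_of_cons_suffix (p := w) ⟨q', he.symm⟩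
      (uriMark_notMem_binary _) (uriMark_notMem_tail_lookupWord n))
  have hfound : ∀ (u : U) (d : Doc), encUri u = lookupWord n → W.adoc u = some d →
      foundTriples W n = W.data d := by
    intro u d hu hd
    ext t
    constructor
    · rintro ⟨u', d', hu', hd', ht⟩
      obtain rfl := encUri_injective (hu'.trans hu.symm)
      rw [hd] at hd'
      obtain rfl := Option.some_injective _ hd'
      exact ht
    · exact fun ht => ⟨u, d, hu, hd, ht⟩
  by_cases h : ∃ T : Finset (Triple U B L), LDMachine.LookupFinds U B L (A := Empty) W.enc
      ((w ++ lookupWord n).map fun s => some (Sum.inl s)) T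
  · refine ⟨_, dif_pos h, .inr ?_⟩
    obtain ⟨u, hu, hT⟩ := h.choose_spec
    obtain ⟨d, hd, he⟩ := (W.occursIn_enc u _).1 hT
    exact ⟨W.data d, he, hfound u d (huniq u hu) hd⟩
  · refine ⟨[], dif_neg h, .inl ⟨rfl, ?_⟩⟩
    rw [Set.eq_empty_iff_forall_notMem]
    rintro t ⟨u, d, hu, hd, ht⟩
    refine h ⟨W.data d, u, ?_, (W.occursIn_enc u _).2 ⟨d, hd, rfl⟩⟩
    rw [hu, List.map_append]
    exact List.suffix_append _ _

theorem foldl_parseSym_name {s : List Sym} (hs : ∀ a ∈ s, a.IsName)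
    (a b c : List Sym) (G : List (List Sym × List Sym × List Sym)) :
    s.foldl (fun y a => parseSym a y) ((a, b, c), G) = ((a, b, c ++ s), G) := by
  induction s generalizing c with
  | nil => simp
  | cons d s ih =>
    rw [List.foldl_cons]
    have : parseSym d ((a, b, c), G) = ((a, b, c ++ [d]), G) := by
      have := hs d List.mem_cons_self
      cases d <;> first | rfl | simp [Sym.IsName] at this
    rw [this, ih fun x hx => hs x (List.mem_cons_of_mem _ hx), List.append_assoc]
    rfl

theorem foldl_parseSym_encTriple (t : Triple U B L)
    (x : (List Sym × List Sym × List Sym) × List (List Sym × List Sym × List Sym)) :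
    (encTriple t).foldl (fun y a => parseSym a y) x = (t.words, x.2 ++ [t.words]) := by
  obtain ⟨⟨a, b, c⟩, G⟩ := x
  simp only [encTriple, List.foldl_append, List.foldl_cons, List.foldl_nil]
  have langle : ∀ y, parseSym .langle y = ((y.1.1, y.1.2.1, []), y.2) := fun _ => rfl
  have comma : ∀ y, parseSym .comma y = ((y.1.2.1, y.1.2.2, []), y.2) := fun _ => rfl
  have rangle : ∀ y, parseSym .rangle y = (y.1, y.2 ++ [y.1]) := fun _ => rfl
  simp only [langle, comma, rangle, foldl_parseSym_name (fun _ => isName_of_mem_encTerm),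
    foldl_parseSym_name (fun _ => isName_of_mem_encUri), List.nil_append]
  rfl

/-- The parser finds the triples of a document. -/
theorem foldl_parseSym_encTriples (T : Finset (Triple U B L))
    (x : (List Sym × List Sym × List Sym) × List (List Sym × List Sym × List Sym)) :
    ((encTriples T).foldl (fun y a => parseSym a y) x).2 =
      x.2 ++ (T.sort (· ≤ ·)).map Triple.words := by
  have comma : ∀ (l : List (Triple U B L)) x,
      (((l.map encTriple).flatMap (Sym.comma :: ·)).foldl (fun y a => parseSym a y) x).2 =
        x.2 ++ l.map Triple.words := by
    intro l
    induction l with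
    | nil => simp
    | cons t l ih =>
      intro x
      rw [List.map_cons, List.flatMap_cons, List.foldl_append, ih, List.foldl_cons,
        foldl_parseSym_encTriple]
      simp [parseSym]
  have body : ∀ (l : List (Triple U B L)) x,
      ((commaSep (l.map encTriple)).foldl (fun y a => parseSym a y) x).2 =
        x.2 ++ l.map Triple.words := by
    rintro (_ | ⟨t, l⟩) x
    · simp [commaSep]
    · rw [List.map_cons, commaSep_cons, List.foldl_append, comma, foldl_parseSym_encTriple]
      simp
  rw [encTriples, List.foldl_append, List.foldl_append]
  exact body _ _

end

/-! ### Monotonic queries are eventually computable -/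

section

variable {U B L Doc : Type*}

open Classical in
/-- The induced subweb with the documents in `D`. -/
noncomputable def Web.restrict (W : Web U B L Doc) (D : Set Doc) : Web U B L Doc where
  docs := W.docs ∩ D
  data := W.data
  bnodes_disjoint d₁ h₁ d₂ h₂ := W.bnodes_disjoint d₁ h₁.1 d₂ h₂.1
  adoc u := (W.adoc u).filter (· ∈ D)
  adoc_mem u d h := by
    obtain ⟨h₁, h₂⟩ := Option.filter_eq_some_iff.1 h
    exact ⟨W.adoc_mem u d h₁, by simpa using h₂⟩
  adoc_surj := by
    rintro d ⟨h₁, h₂⟩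
    obtain ⟨u, hu⟩ := W.adoc_surj d h₁
    exact ⟨u, by simp [hu, h₂]⟩

theorem Web.isInducedSubweb_restrict (W : Web U B L Doc) (D : Set Doc) :
    (W.restrict D).IsInducedSubweb W := by
  refine ⟨Set.inter_subset_left, fun _ _ => rfl, fun u d => ?_⟩
  simp only [restrict, Option.filter_eq_some_iff, decide_eq_true_eq, Set.mem_inter_iff]
  exact ⟨fun h => ⟨h.1, W.adoc_mem u d h.1, h.2⟩, fun h => ⟨h.1, h.2.2⟩⟩

variable [Denumerable U] {W : Web U B L Doc}

/-- The triples that are found in the first `n` rounds. -/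
def foundBefore (W : Web U B L Doc) (n : ℕ) : Set (Triple U B L) :=
  {t | ∃ m < n, t ∈ foundTriples W m}

theorem monotone_foundBefore : Monotone (foundBefore W) := by
  rintro m n hmn t ⟨k, hk, ht⟩
  exact ⟨k, hk.trans_le hmn, ht⟩

theorem iUnion_foundBefore : ⋃ n, foundBefore W n = W.allData := by
  ext t
  rw [Set.mem_iUnion]
  constructor
  · rintro ⟨n, m, -, u, d, -, hd, ht⟩
    exact ⟨d, W.adoc_mem u d hd, ht⟩
  · rintro ⟨d, hd, ht⟩
    obtain ⟨u, hu⟩ := W.adoc_surj d hd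
    obtain ⟨m, hm⟩ := exists_lookupWord_eq u
    exact ⟨m + 1, m, Nat.lt_succ_self m, u, d, hm.symm, hu, ht⟩

end

section

open Relation

variable {U B L V Doc : Type*} [Denumerable U] {P : SparqlExpr U L V}
  {W : Web U B L Doc} {ev : List (List Sym × List Sym × List Sym) → List (List Sym)}
  {hev : Primrec ev}

/-- A monotonic query gives only final results over the triples found so far. -/
theorem eval_foundBefore_subset (hP : (sparqlLD B Doc P).Monotonic) (n : ℕ) :
    P.eval (foundBefore W n) ⊆ sparqlLD B Doc P W := by
  let D : Set Doc := {d | ∃ m < n, ∃ u, encUri u = lookupWord m ∧ W.adoc u = some d}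
  have : (W.restrict D).allData = foundBefore W n := by
    ext t
    constructor
    · rintro ⟨d, ⟨-, m, hm, u, hu, hd⟩, ht⟩
      exact ⟨m, hm, u, d, hu, hd, ht⟩
    · rintro ⟨m, hm, u, d, hu, hd, ht⟩
      exact ⟨d, ⟨W.adoc_mem u d hd, m, hm, u, hu, hd⟩, ht⟩
  rw [← this]
  exact hP _ _ (W.isInducedSubweb_restrict D)

variable [Denumerable B] [Denumerable L] [Denumerable V]

/-- The configurations at the start of round `n`. -/
structure IsRoundStart (P : SparqlExpr U L V) (hev : Primrec ev) (W : Web U B L Doc) (n : ℕ)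
    (a : (searchProgram hev).Cfg) : Prop where
  node_eq : a.node = .round
  head_eq : a.head = a.link.length
  number_eq : a.state.2.1.1 = n
  output_eq : a.output = a.state.2.1.2.flatten
  nodup : a.state.2.1.2.Nodup
  sound : ∀ w ∈ a.state.2.1.2, ∃ m, ∃ μ ∈ P.eval (foundBefore W m), encValuation μ = w
  triples : ∀ w, w ∈ a.state.2.2.2 ↔ ∃ t ∈ foundBefore W n, t.words = w

theorem isRoundStart_zero :
    IsRoundStart P hev W 0 ⟨.round, ([], (0, []), (([], [], []), [])), [], 0, []⟩ where
  node_eq := rfl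
  head_eq := rfl
  number_eq := rfl
  output_eq := rfl
  nodup := List.nodup_nil
  sound := by simp
  triples := by simp [foundBefore]

/-- A round, in which all results over the triples found before are output. -/
theorem IsRoundStart.exists_next
    (hspec : ∀ G (T : Set (Triple U B L)), (∀ w, w ∈ G ↔ ∃ t ∈ T, t.words = w) →
      ∀ w, w ∈ ev G ↔ ∃ μ ∈ P.eval T, encValuation μ = w)
    {n : ℕ} {a : (searchProgram hev).Cfg} (ha : IsRoundStart P hev W n a) :
    ∃ a', IsRoundStart P hev W (n + 1) a' ∧
      TransGen ((searchProgram hev).Step U B L W.enc) a a' ∧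
      ∀ μ ∈ P.eval (foundBefore W n), encValuation μ ∈ a'.state.2.1.2 := by
  obtain ⟨node, ⟨todo, ⟨k, done⟩, regs, G⟩, w, h, o⟩ := a
  obtain ⟨h₁, h₂, h₃, h₄, h₅, h₆, h₇⟩ := ha
  simp only at h₁ h₂ h₃ h₄ h₅ h₆ h₇
  subst h₁ h₂ h₃ h₄
  have hev' := hspec G _ h₇
  obtain ⟨s, hs, hfound⟩ := expandAnswer_lookupWord W w k
  have hsharp : Sym.sharp ∉ s := by
    rcases hfound with ⟨rfl, -⟩ | ⟨T, rfl, -⟩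
    · simp
    · exact sharp_notMem_encTriples T
  let x : SearchState := startRound ev (todo, (k, done), regs, G)
  refine ⟨⟨.round, ([.inr (.inr false)], x.2.1, s.foldl (fun y a => parseSym a y) x.2.2),
    w ++ lookupWord k ++ (s ++ [Sym.sharp]), (w ++ lookupWord k ++ (s ++ [Sym.sharp])).length,
    done.flatten ++ (newWords (ev G) done).flatten⟩, ⟨rfl, rfl, rfl, ?_, ?_, ?_, ?_⟩, ?_, ?_⟩
  · exact List.flatten_append.symm
  · exact List.nodup_append.2 ⟨h₅, nodup_newWords _ _, fun u hu u' hu' he =>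
      (mem_newWords.1 hu').2 (he ▸ hu)⟩
  · intro u hu
    rcases List.mem_append.1 hu with hu | hu
    · exact h₆ u hu
    · exact ⟨k, (hev' u).1 (mem_newWords.1 hu).1⟩
  · intro u
    have hsucc : foundBefore W (k + 1) = foundBefore W k ∪ foundTriples W k := by
      ext t
      constructor
      · rintro ⟨m, hm, ht⟩
        rcases Nat.lt_succ_iff_lt_or_eq.1 hm with hm | rfl
        · exact .inl ⟨m, hm, ht⟩
        · exact .inr ht
      · rintro (⟨m, hm, ht⟩ | ht)
        · exact ⟨m, hm.trans (Nat.lt_succ_self k), ht⟩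
        · exact ⟨k, Nat.lt_succ_self k, ht⟩
    rw [hsucc]
    rcases hfound with ⟨rfl, hf⟩ | ⟨T, rfl, hf⟩
    · rw [hf, Set.union_empty]
      exact h₇ u
    · change u ∈ ((encTriples T).foldl (fun y a => parseSym a y) (regs, G)).2 ↔ _
      rw [foldl_parseSym_encTriples, List.mem_append, h₇, hf]
      simp [or_and_right, exists_or]
  · refine .head' (Program.Step.goto (p := searchProgram hev) rfl)
      ((searchProgram_printList (x := x)).trans ((searchProgram_putList (x := x)).trans
        ((searchProgram_expand (x := x)).trans ?_)))
    rw [hs]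
    exact searchProgram_read (x := x) hsharp
  · intro μ hμ
    have := (hev' _).2 ⟨μ, hμ, rfl⟩
    by_cases hd : encValuation μ ∈ done
    · exact List.mem_append_left _ hd
    · exact List.mem_append_right _ (mem_newWords.2 ⟨this, hd⟩)

theorem output_prefix_of_reaches {M : LDMachine} {web : InfWord} {c c' : M.Cfg}
    (h : StateTransition.Reaches (M.step U B L web) c c') : c.output <+: c'.output := by
  induction h with
  | refl => exact List.prefix_rfl
  | @tail b c' _ hb ih =>
    refine ih.trans ?_
    rw [LDMachine.step, Option.mem_def] at hb
    split_ifs at hb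
    · obtain rfl := Option.some_injective _ hb
      exact List.prefix_rfl
    · obtain ⟨a, -, rfl⟩ := Option.map_eq_some_iff.1 hb
      exact List.prefix_append _ _

theorem exists_isEncodingOf_of_isRoundStart (hP : (sparqlLD B Doc P).Monotonic) {n : ℕ}
    {a : (searchProgram hev).Cfg} (ha : IsRoundStart P hev W n a) :
    ∃ x, IsEncodingOf x (sparqlLD B Doc P W) ∧ IsPrefixOf a.output x := by
  have : ∀ w : {w // w ∈ a.state.2.1.2}, ∃ μ ∈ sparqlLD B Doc P W, encValuation μ = w.1 := by
    rintro ⟨w, hw⟩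
    obtain ⟨m, μ, hμ, he⟩ := ha.sound w hw
    exact ⟨μ, eval_foundBefore_subset hP m hμ, he⟩
  choose f hf he using this
  have hmap : ((a.state.2.1.2.attach).map f).map encValuation = a.state.2.1.2 := by
    rw [List.map_map, show encValuation ∘ f = Subtype.val from funext he,
      List.attach_map_subtype_val]
  have hflat : a.state.2.1.2.flatten = (a.state.2.1.2.attach.map f).flatMap encValuation := by
    rw [List.flatMap_def, hmap]
  have hnodup : ((a.state.2.1.2.attach.map f).map encValuation).Nodup := by
    rw [hmap]
    exact ha.nodup
  rw [ha.output_eq, hflat]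
  refine exists_isEncodingOf_of_nodup (fun μ hμ => SparqlExpr.finite_dom_of_mem_eval hμ)
    (List.Nodup.of_map encValuation hnodup) fun μ hμ => ?_
  obtain ⟨w, -, rfl⟩ := List.mem_map.1 hμ
  exact hf w

/-- The outputs of the program at the starts of its rounds are prefixes of possible encodings, and
all outputs in between are prefixes of these. -/
theorem eventuallyComputable_sparqlLD [Infinite Doc] (hP : (sparqlLD B Doc P).Monotonic) :
    EventuallyComputable (sparqlLD B Doc P) := by
  obtain ⟨ev, hev, hspec⟩ := P.exists_primrec_eval (B := B)
  obtain ⟨M, R, hR, hM⟩ := (searchProgram hev).exists_machine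
    ([], (0, []), (([], [], []), [])) rfl U B L
  refine ⟨M, fun W => ?_⟩
  obtain ⟨⟨c₀, hc₀, hreach⟩, hstep⟩ := hM W.enc
  have hsteps : ∀ {a a' c}, TransGen ((searchProgram hev).Step U B L W.enc) a a' → R a c →
      ∃ c', R a' c' ∧ StateTransition.Reaches₁ (M.step U B L W.enc) c c' := by
    intro a a' c h hc
    induction h with
    | single h => exact hstep _ _ _ h hc
    | tail _ h ih =>
      obtain ⟨c₁, hc₁, h₁⟩ := ih
      obtain ⟨c₂, hc₂, h₂⟩ := hstep _ _ _ h hc₁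
      exact ⟨c₂, hc₂, h₁.trans h₂⟩
  constructor
  · -- each computation step is followed by the start of a round
    intro c hc
    obtain ⟨n, a, d, ha, hd, hcd⟩ : ∃ n a d, IsRoundStart P hev W n a ∧ R a d ∧
        StateTransition.Reaches (M.step U B L W.enc) c d := by
      induction hc with
      | refl => exact ⟨0, _, c₀, isRoundStart_zero, hc₀, hreach⟩
      | @tail b c _ hbc ih =>
        obtain ⟨n, a, d, ha, hd, hbd⟩ := ih
        obtain ⟨a', ha', hs, -⟩ := ha.exists_next hspec
        obtain ⟨d', hd', hdd'⟩ := hsteps hs hd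
        obtain ⟨c', hc', hc'd⟩ := TransGen.head'_iff.1 (TransGen.trans_right hbd hdd')
        obtain rfl := Option.mem_unique hbc hc'
        exact ⟨n + 1, a', d', ha', hd', hc'd⟩
    obtain ⟨x, hx, hax⟩ := exists_isEncodingOf_of_isRoundStart hP ha
    exact ⟨x, hx, IsPrefixOf.of_prefix (hR a d hd ▸ output_prefix_of_reaches hcd) hax⟩
  · intro μ hμ
    have hrounds : ∀ n, ∃ a d, IsRoundStart P hev W n a ∧ R a d ∧
        StateTransition.Reaches (M.step U B L W.enc) (M.init []) d := by
      intro n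
      induction n with
      | zero => exact ⟨_, c₀, isRoundStart_zero, hc₀, hreach⟩
      | succ n ih =>
        obtain ⟨a, d, ha, hd, h⟩ := ih
        obtain ⟨a', ha', hs, -⟩ := ha.exists_next hspec
        obtain ⟨d', hd', hdd'⟩ := hsteps hs hd
        exact ⟨a', d', ha', hd', h.trans hdd'.to_reflTransGen⟩
    -- the solution shows up after finitely many rounds, since the query is finitary
    obtain ⟨n, hn⟩ := SparqlExpr.exists_mem_eval_of_monotonic hP (monotone_foundBefore (W := W))
      (by rwa [iUnion_foundBefore])
    obtain ⟨a, d, ha, hd, h⟩ := hrounds n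
    obtain ⟨a', ha', hs, hout⟩ := ha.exists_next hspec
    obtain ⟨d', hd', hdd'⟩ := hsteps hs hd
    refine ⟨d', h.trans hdd'.to_reflTransGen, ?_⟩
    rw [hR a' d' hd', ha'.output_eq]
    exact List.infix_of_mem_flatten (hout μ hn)

end

end LinkedData

theorem mainTheorem1 {U B L V Doc : Type*} [Denumerable U] [Denumerable B] [Denumerable L]
    [Denumerable V] [Infinite Doc] (P : LinkedData.SparqlExpr U L V)
    (hsat : (LinkedData.sparqlLD B Doc P).Satisfiable) :
    ((LinkedData.sparqlLD B Doc P).Monotonic →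
      LinkedData.EventuallyComputable (LinkedData.sparqlLD B Doc P) ∧
      ¬ LinkedData.FinitelyComputable (LinkedData.sparqlLD B Doc P)) ∧
    (¬ (LinkedData.sparqlLD B Doc P).Monotonic →
      ¬ LinkedData.EventuallyComputable (LinkedData.sparqlLD B Doc P)) :=
  ⟨fun h => ⟨LinkedData.eventuallyComputable_sparqlLD h,
    LinkedData.not_finitelyComputable_sparqlLD hsat⟩,
    LinkedData.not_eventuallyComputable_sparqlLD⟩
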